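/- **Setting.** Let $h:\mathbb N_0\to[0,\infty)$ be positive at two points at least, let $A(\eta)=\log\sum_{y\ge 0}e^{\eta y}h(y)$, let $N$ be the interior of $\{\eta\in\mathbb R:\sum_y e^{\eta y}h(y)<\infty\}$, and $p(y|\eta)=\exp\{\eta y-A(\eta)\}h(y)$ for $\eta\in N$. Write $\mathcal R(A')=A'(N)$ and $(A')^{-1}:\mathcal R(A')\to N$. Let $\Theta\subset\mathbb R^d$ be compact and, for $\theta\in\Theta$, let $f_\theta$ be a non-negative function on $[0,\infty)\times\mathbb N_0$. A stationary solution of the model with parameter $\theta_0$ is a strictly stationary process $(X_t,Y_t)_{t\in\mathbb Z}$, with $Y_t$ integrable and $\mathbb N_0$-valued and $X_t\in\mathcal R(A')$, such that $$Y_t\mid\mathcal F_{t-1}\sim p(\cdot|\eta_t),\qquad X_t=A'(\eta_t)=\mathbb E(Y_t|\mathcal F_{t-1})=f_{\theta_0}(X_{t-1},Y_{t-1})\quad\text{a.s.},$$ where $\mathcal F_{t-1}=\sigma(X_s,Y_s:s\le t-1)$. For a sequence $y=(y_1,y_2,\dots)$ of integers let $f^\theta_\infty(y)=\lim_{k\to\infty}f_\theta(\cdots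 f_\theta(f_\theta(0,y_k),y_{k-1})\cdots,y_1)$. Call $y$ admissible if $h(y_k)>0$ for all $k$ and $\sum_k r^ky_k<\infty$ for all $r\in[0,1)$. Along a path $(Y_t)_{t\in\mathbb Z}$ put $$X_t(\theta)=f^\theta_\infty(Y_{t-1},Y_{t-2},\dots),\quad \eta_t(\theta)=(A')^{-1}(X_t(\theta)),\quad \ell_t(\theta)=\eta_t(\theta)Y_t-A(\eta_t(\theta)).$$ **Assumptions on the model.** - A($\Theta$): there are $\delta_1,\delta_2\ge0$ with $\delta_1+\delta_2<1$ and $\sup_{\theta\in\Theta}|f_\theta(x,y)-f_\theta(x',y')|\le\delta_1|x-x'|+\delta_2|y-y'|$ for all $x,x'\ge0$, $y,y'\in\mathbb N_0$. - (A1): for all $\theta\in\Theta$ and admissible $y$, $f^\theta_\infty(y)\in\mathcal R(A')$ and $f^\theta_\infty(y)\ge x^*_\theta\ge x^*$, where $x^*_\theta,x^*\in\mathcal R(A')$ do not depend on $y$, and $x^*$ does not depend on $\theta$. - (A2), (A5): for all admissible $y$ the map $\theta\mapsto f^\theta_\infty(y)$ is continuous, respectively twice continuously differentiable, on $\Theta$.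 **Assumptions on a parameter $\theta_0$ and a stationary solution $(X_t,Y_t)$ with this parameter.** - (A0): $\theta_0$ is an interior point of $\Theta$. - (A3): $\mathbb E\big[Y_1\,|\sup_{\theta\in\Theta}\eta_1(\theta)|\big]<\infty$. - (A4): if $\theta\in\Theta$ and $X_t(\theta)=X_t(\theta_0)$ a.s. for some $t\ge1$, then $\theta=\theta_0$. - (A6): for all $i,j\in\{1,\dots,d\}$ and all $t$, $\mathbb E\big[\sup_{\theta\in\Theta}|A''(\eta_t(\theta))\,\partial_i\eta_t(\theta)\,\partial_j\eta_t(\theta)|\big]<\infty$ and $\mathbb E\big[\sup_{\theta\in\Theta}|(Y_t-A'(\eta_t(\theta)))\,\partial_i\partial_j\eta_t(\theta)|\big]<\infty$, where the derivatives are with respect to $\theta\in\Theta$. **Change-point alternative.** Let $\theta^*_1\ne\theta^*_2$, and let $(X^{(i)}_t,Y^{(i)}_t)$, $i=1,2$, be stationary solutions with parameters $\theta^*_i$, defined on one probability space (with no restriction on their joint law). Let $\tau^*\in(0,1)$ and $t^*=[n\tau^*]$. For the sample size $n$ the process is $Y_t=Y^{(1)}_t$ for $t\le t^*$ and $Y_t=Y^{(2)}_t$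 for $t>t^*$. For $1\le k\le k'\le n$ let $\hat\theta_n(T_{k,k'})$ be any maximiser over $\Theta$ of $\sum_{t=k}^{k'}\ell_t(\theta)$, computed along this process. **Test statistic.** Let $u_n,v_n$ be sequences of natural numbers with $u_n,v_n\to\infty$ and $u_n/n,v_n/n\to0$. Let $q:(0,1)\to(0,\infty)$ be non-decreasing near $0$, non-increasing near $1$, with $\inf_{\varphi<\tau<1-\varphi}q(\tau)>0$ for all $0<\varphi<1/2$. With $I_t(\theta)=A''(\eta_t(\theta))\,\frac{\partial\eta_t(\theta)}{\partial\theta}\big(\frac{\partial\eta_t(\theta)}{\partial\theta}\big)^{T}$, let $$\hat\Omega_n(u_n)=\frac12\Big[\frac1{u_n}\sum_{t=1}^{u_n}I_t\big(\hat\theta_n(T_{1,u_n})\big)+\frac1{n-u_n}\sum_{t=u_n+1}^{n}I_t\big(\hat\theta_n(T_{u_n+1,n})\big)\Big],$$ $$\hat C_{n,k}=\frac1{q^2(k/n)}\,\frac{k^2(n-k)^2}{n^3}\,\big(\hat\theta_n(T_{1,k})-\hat\theta_n(T_{k+1,n})\big)^{T}\,\hat\Omega_n(u_n)\,\big(\hat\theta_n(T_{1,k})-\hat\theta_n(T_{k+1,n})\big),\qquad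 \hat C_n=\max_{v_n\le k\le n-v_n}\hat C_{n,k}.$$ **Theorem.** Assume A($\Theta$), (A1), (A2), (A5), and (A0), (A3), (A4), (A6) for both $\theta^*_1,(X^{(1)}_t,Y^{(1)}_t)$ and $\theta^*_2,(X^{(2)}_t,Y^{(2)}_t)$. Assume also that the matrix $\Omega^{(1)}=\mathbb E[I_0(\theta^*_1)]$, computed along $Y^{(1)}$, is positive definite. Then $\hat C_n\to+\infty$ almost surely as $n\to\infty$. Hence also (when the $\hat C_n$ are random variables) $\hat C_n\to+\infty$ in probability: $P(\hat C_n>c)\to1$ for every $c\in\mathbb R$, so the test that rejects for $\hat C_n>c_\alpha$ has asymptotic power one. -/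

import Mathlib

open MeasureTheory Filter Topology

noncomputable section

namespace CountSeries

/-! ### One-parameter exponential families on the non-negative integers -/

/-- `h` is the base function of an exponential family on `ℕ`: it is non-negative and has at least two
atoms (equivalently, the mean function `A'` below is invertible). -/
structure IsBase (h : ℕ → ℝ) : Prop where
  nonneg : ∀ y, 0 ≤ h y
  two_atoms : ∃ a b, a ≠ b ∧ 0 < h a ∧ 0 < h b

/-- The (open) natural parameter space. -/
def natParam (h : ℕ → ℝ) : Set ℝ :=
  interior {η : ℝ | Summable fun y : ℕ => Real.exp (η * y) * h y}

/-- The cumulant function `A`, i.e. the only function for which `∑ y, exp (η y - A η) h y = 1`. -/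
def cumulant (h : ℕ → ℝ) (η : ℝ) : ℝ :=
  Real.log (∑' y : ℕ, Real.exp (η * y) * h y)

/-- `p(y | η) = exp (η y - A η) h y`. -/
def density (h : ℕ → ℝ) (η : ℝ) (y : ℕ) : ℝ :=
  Real.exp (η * y - cumulant h η) * h y

/-- `A'`. -/
def meanFun (h : ℕ → ℝ) : ℝ → ℝ := deriv (cumulant h)

/-- `A''`. -/
def varFun (h : ℕ → ℝ) : ℝ → ℝ := deriv (deriv (cumulant h))

/-- The range `R(A')` of `A'` on the natural parameter space. -/
def meanRange (h : ℕ → ℝ) : Set ℝ := meanFun h '' natParam h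

/-- `(A')⁻¹`, defined on `meanRange h`. -/
def meanInv (h : ℕ → ℝ) : ℝ → ℝ := Function.invFunOn (meanFun h) (natParam h)

/-! ### The model -/

/-- The parameter space `ℝ^d` with its Euclidean norm. -/
abbrev Param (d : ℕ) := EuclideanSpace ℝ (Fin d)

section Model

variable {Ω : Type*} [MeasurableSpace Ω]

/-- The σ-field generated by the whole past strictly before time `t`. -/
@[reducible]
def pastSigma (X : ℤ → Ω → ℝ) (Y : ℤ → Ω → ℕ) (t : ℤ) : MeasurableSpace Ω :=
  ⨆ s : {s : ℤ // s < t},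
    (MeasurableSpace.comap (X s) inferInstance ⊔ MeasurableSpace.comap (Y s) inferInstance)

/-- `(Y_t)`, with conditional means `(X_t)`, is a stationary solution of the model with autoregressive
function `f θ`: given the past, `Y_t` has the law `p(· | η_t)` with `η_t = (A')⁻¹(X_t)`,
where `X_t = E(Y_t | past) = f_θ (X_{t-1}, Y_{t-1})`. -/
structure IsStationarySolution {d : ℕ} (P : Measure Ω) (h : ℕ → ℝ)
    (f : Param d → ℝ → ℕ → ℝ) (θ : Param d) (X : ℤ → Ω → ℝ) (Y : ℤ → Ω → ℕ) : Prop where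
  measurable_X : ∀ t, Measurable (X t)
  measurable_Y : ∀ t, Measurable (Y t)
  mem_range : ∀ t, ∀ᵐ ω ∂P, X t ω ∈ meanRange h
  recursion : ∀ t, ∀ᵐ ω ∂P, X t ω = f θ (X (t - 1) ω) (Y (t - 1) ω)
  integrable : ∀ t, Integrable (fun ω => (Y t ω : ℝ)) P
  condMean : ∀ t, P[fun ω => (Y t ω : ℝ) | pastSigma X Y t] =ᵐ[P] X t
  condLaw : ∀ t (y : ℕ),
    P[Set.indicator {ω | Y t ω = y} (fun _ => (1 : ℝ)) | pastSigma X Y t]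
      =ᵐ[P] fun ω => density h (meanInv h (X t ω)) y
  stationary :
    P.map (fun ω (t : ℤ) => (X (t + 1) ω, Y (t + 1) ω)) = P.map (fun ω (t : ℤ) => (X t ω, Y t ω))

end Model

/-! ### Conditional means as functions of the past observations -/

/-- `backIter f θ k y` is the conditional mean at the present time when the recursion
`x ↦ f θ x y` is run through the last `k` observations `y (k-1), …, y 1, y 0` (`y 0` being the most
recent one), starting from `0`. -/
def backIter {d : ℕ} (f : Param d → ℝ → ℕ → ℝ) (θ : Param d) : ℕ → (ℕ → ℕ) → ℝ
  | 0, _ => 0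
  | k + 1, y => f θ (backIter f θ k fun i => y (i + 1)) (y 0)

/-- `f_∞^θ (y 0, y 1, …)`: the conditional mean as a function of the infinite past. -/
def fInf {d : ℕ} (f : Param d → ℝ → ℕ → ℝ) (θ : Param d) (y : ℕ → ℕ) : ℝ :=
  limUnder atTop fun k => backIter f θ k y

/-- The pasts on which `f_∞` is considered: sequences of values that the family can take, growing
subexponentially (so that the limit defining `f_∞` exists; almost every path is of this kind). -/
def admissible (h : ℕ → ℝ) : Set (ℕ → ℕ) :=
  {y | (∀ k, 0 < h (y k)) ∧ ∀ r : ℝ, 0 ≤ r → r < 1 → Summable fun k => r ^ k * (y k : ℝ)}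

section Likelihood

variable {d : ℕ} (h : ℕ → ℝ) (f : Param d → ℝ → ℕ → ℝ) (Θ : Set (Param d))

/-- `X_t(θ) = f_∞^θ (y_{t-1}, y_{t-2}, …)` along a path `y`. -/
def fitted (y : ℤ → ℕ) (t : ℤ) (θ : Param d) : ℝ :=
  fInf f θ fun k : ℕ => y (t - 1 - k)

/-- `η_t(θ) = (A')⁻¹ (X_t(θ))`. -/
def eta (y : ℤ → ℕ) (t : ℤ) (θ : Param d) : ℝ :=
  meanInv h (fitted f y t θ)

/-- `ℓ_t(θ) = η_t(θ) y_t - A(η_t(θ))`. -/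
def logLik (y : ℤ → ℕ) (t : ℤ) (θ : Param d) : ℝ :=
  eta h f y t θ * (y t : ℝ) - cumulant h (eta h f y t θ)

/-- `L(T_{k,k'}, θ)`, the conditional log-likelihood computed on the times `k, …, k'`. -/
def segLogLik (y : ℤ → ℕ) (k k' : ℕ) (θ : Param d) : ℝ :=
  ∑ t ∈ Finset.Icc k k', logLik h f y (t : ℤ) θ

/-- `a` is a maximum likelihood estimate over `Θ`, computed on the times `k, …, k'`. -/
def IsMLE (y : ℤ → ℕ) (k k' : ℕ) (a : Param d) : Prop :=
  a ∈ Θ ∧ IsMaxOn (segLogLik h f y k k') Θ a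

/-- The `i`-th partial derivative, relative to the set `Θ`, of a function of the parameter. -/
def partialD (i : Fin d) (F : Param d → ℝ) (θ : Param d) : ℝ :=
  fderivWithin ℝ F Θ θ (EuclideanSpace.single i 1)

/-- `A''(η_t(θ)) (∂η_t(θ)/∂θ) (∂η_t(θ)/∂θ)ᵀ`. -/
def infoTerm (y : ℤ → ℕ) (t : ℤ) (θ : Param d) : Matrix (Fin d) (Fin d) ℝ :=
  Matrix.of fun i j =>
    varFun h (eta h f y t θ) * partialD Θ i (eta h f y t) θ * partialD Θ j (eta h f y t) θ

/-- `Ω = E[A''(η_0(θ)) (∂η_0(θ)/∂θ) (∂η_0(θ)/∂θ)ᵀ]`. -/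
def info {Ω : Type*} [MeasurableSpace Ω] (P : Measure Ω) (Y : ℤ → Ω → ℕ) (θ : Param d) :
    Matrix (Fin d) (Fin d) ℝ :=
  Matrix.of fun i j => ∫ ω, infoTerm h f Θ (fun t => Y t ω) 0 θ i j ∂P

/-- `Ω̂_n(u)`, with `est k k'` the estimate computed on the times `k, …, k'`. -/
def infoHat (n u : ℕ) (y : ℤ → ℕ) (est : ℕ → ℕ → Param d) : Matrix (Fin d) (Fin d) ℝ :=
  (1 / 2 : ℝ) •
    ((1 / (u : ℝ)) • ∑ t ∈ Finset.Icc 1 u, infoTerm h f Θ y (t : ℤ) (est 1 u)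
      + (1 / ((n : ℝ) - (u : ℝ))) •
          ∑ t ∈ Finset.Icc (u + 1) n, infoTerm h f Θ y (t : ℤ) (est (u + 1) n))

/-- `Ĉ_{n,k}`. -/
def statAt (q : ℝ → ℝ) (n u k : ℕ) (y : ℤ → ℕ) (est : ℕ → ℕ → Param d) : ℝ :=
  1 / q ((k : ℝ) / n) ^ 2 * ((k : ℝ) ^ 2 * ((n : ℝ) - k) ^ 2 / (n : ℝ) ^ 3) *
    ((fun i => (est 1 k - est (k + 1) n) i) ⬝ᵥ
      (infoHat h f Θ n u y est).mulVec fun i => (est 1 k - est (k + 1) n) i)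

/-- `Ĉ_n = max_{v ≤ k ≤ n - v} Ĉ_{n,k}`. -/
def changeStat (q : ℝ → ℝ) (n u v : ℕ) (y : ℤ → ℕ) (est : ℕ → ℕ → Param d) : ℝ :=
  sSup ((fun k => statAt h f Θ q n u k y est) '' {k : ℕ | v ≤ k ∧ k + v ≤ n})

/-! ### Assumptions -/

/-- The Lipschitz-type condition **A(Θ)**. -/
def LipschitzCond : Prop :=
  ∃ δ₁ δ₂ : ℝ, 0 ≤ δ₁ ∧ 0 ≤ δ₂ ∧ δ₁ + δ₂ < 1 ∧
    ∀ θ ∈ Θ, ∀ x x' : ℝ, 0 ≤ x → 0 ≤ x' → ∀ y y' : ℕ,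
      |f θ x y - f θ x' y'| ≤ δ₁ * |x - x'| + δ₂ * |(y : ℝ) - (y' : ℝ)|

/-- **A1**: `f_∞^θ ≥ x*_θ ≥ x*` with `x*_θ`, `x*` in the range of `A'`; moreover `f_∞^θ` takes its
values in this range, so that `(A')⁻¹ (f_∞^θ)` makes sense. -/
def AssumptionA1 : Prop :=
  (∀ θ ∈ Θ, ∀ y ∈ admissible h, fInf f θ y ∈ meanRange h) ∧
  ∃ xs : Param d → ℝ, ∃ x₀ ∈ meanRange h, ∀ θ ∈ Θ,
    xs θ ∈ meanRange h ∧ x₀ ≤ xs θ ∧ ∀ y ∈ admissible h, xs θ ≤ fInf f θ y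

/-- **A2**: `θ ↦ f_∞^θ (y)` is continuous. -/
def AssumptionA2 : Prop :=
  ∀ y ∈ admissible h, ContinuousOn (fun θ => fInf f θ y) Θ

/-- **A5**: `θ ↦ f_∞^θ (y)` is twice continuously differentiable. -/
def AssumptionA5 : Prop :=
  ∀ y ∈ admissible h, ContDiffOn ℝ 2 (fun θ => fInf f θ y) Θ

/-- The assumptions **A0**, **A3**, **A4**, **A6**, which bear on the true parameter `θ₀` and on the
law of the process `Y`. -/
structure ProcessAssumptions {Ω : Type*} [MeasurableSpace Ω] (P : Measure Ω)
    (θ₀ : Param d) (Y : ℤ → Ω → ℕ) : Prop where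
  a0 : θ₀ ∈ interior Θ
  a3 : ∫⁻ ω, ‖(Y 1 ω : ℝ) * |sSup (eta h f (fun t => Y t ω) 1 '' Θ)|‖ₑ ∂P < ⊤
  a4 : ∀ θ ∈ Θ,
    (∃ t : ℤ, 1 ≤ t ∧
      ∀ᵐ ω ∂P, fitted f (fun s => Y s ω) t θ = fitted f (fun s => Y s ω) t θ₀) → θ = θ₀
  a6_first : ∀ (t : ℤ) (i j : Fin d),
    ∫⁻ ω, ⨆ θ ∈ Θ, ‖varFun h (eta h f (fun s => Y s ω) t θ) *
      partialD Θ i (eta h f (fun s => Y s ω) t) θ *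
      partialD Θ j (eta h f (fun s => Y s ω) t) θ‖ₑ ∂P < ⊤
  a6_second : ∀ (t : ℤ) (i j : Fin d),
    ∫⁻ ω, ⨆ θ ∈ Θ, ‖((Y t ω : ℝ) - meanFun h (eta h f (fun s => Y s ω) t θ)) *
      partialD Θ i (partialD Θ j (eta h f (fun s => Y s ω) t)) θ‖ₑ ∂P < ⊤

end Likelihood

/-- Weight functions: positive on `(0,1)`, non-decreasing near `0`, non-increasing near `1`, and
bounded away from zero on each `(φ, 1 - φ)`. -/
structure IsWeight (q : ℝ → ℝ) : Prop where
  pos : ∀ τ ∈ Set.Ioo (0 : ℝ) 1, 0 < q τ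
  mono_zero : ∃ ε > (0 : ℝ), MonotoneOn q (Set.Ioo 0 ε)
  anti_one : ∃ ε > (0 : ℝ), AntitoneOn q (Set.Ioo (1 - ε) 1)
  inf_pos : ∀ φ : ℝ, 0 < φ → φ < 1 / 2 → ∃ c > (0 : ℝ), ∀ τ ∈ Set.Ioo φ (1 - φ), c ≤ q τ

/-- The path with a single change after time `tstar`. -/
def concat (tstar : ℤ) (y₁ y₂ : ℤ → ℕ) : ℤ → ℕ :=
  fun t => if t ≤ tstar then y₁ t else y₂ t

end CountSeries

end

noncomputable section

namespace CountSeries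

/-! ### Exponential families -/

/-! Maximising the likelihood amounts to minimising a sum of logarithmic losses, the loss at a time
being minus the logarithm of the predictive probability of the observation. The losses are
non-negative because the observations are discrete. Only two split points are examined: k₀ = ⌊εn⌋
and k₁ = n - k₀, for a small ε. The window (0, k₀] lies in the first regime, so its estimate is near
θ₁. The window (k₁, n] starts at least εn steps after the change, so its estimate is near θ₂.
Suppose that the two estimates compared at k₀ are close, and that the two compared at k₁ are close.
Then the estimate a on (k₀, n] is near θ₁ and the estimate b on (0, k₁] is near θ₂. Since a does at
least as well as b on (k₀, n], and b at least as well as a on (0, k₁], adding the two inequalities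
cancels the mixed segment (k₀, k₁] (`sum_loss_exchange`): b on (0, k₀] together with a on (k₁, n]
costs no more than a on (0, k₀] together with b on (k₁, n]. But a is the better one on (0, k₀] and b
on (k₁, n], by `exists_separation` in each regime. So at k₀ or at k₁ the estimates differ by a fixed
amount, and there the statistic is at least a constant times n (`le_statAt`). The behaviour of
estimates on segments that mix the regimes is never needed, and the weight is evaluated only near 0
and 1, where monotonicity bounds it from above.

`exists_separation` combines two uniform bounds on average losses. The lower one, away from the true
parameter (`exists_average_loss_ge`), is Wald's argument: Gibbs' inequality
(`IsRegime.integral_loss_lt`), Fatou on shrinking balls, compactness. The upper one, near the true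
parameter (`exists_average_loss_le`), uses that a non-negative function with second derivative
bounded above cannot grow fast (`le_of_second_deriv_le`). Both tolerate small errors in the
predictive probabilities; well after the change these errors are exponentially small
(`isShadow_concat_right`).

Averages are controlled by the pointwise ergodic theorem, obtained from a maximal inequality
(`integral_nonneg_of_unbounded`). Ergodicity (`IsRegime.ergodic`) comes from contraction:
expectations of L-Lipschitz functions under the family are L-Lipschitz in the mean
(`abs_tsum_law_mul_sub_le`), so each unconstrained step shrinks the influence of the past on the
future by δ₁ + δ₂ (`cylProb_delay_lipschitz`). Of the estimated information matrix, the first half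
is coercive (`exists_average_info_ge`), and of the second half only positive semidefiniteness is
used. -/

/-- The measure on `ℕ` with weights `h`. -/
def baseMeasure (h : ℕ → ℝ) : Measure ℕ :=
  Measure.count.withDensity fun y => ((h y).toNNReal : ENNReal)

/-- The identity of `ℕ` as a real random variable. -/
abbrev natVar : ℕ → ℝ := fun y => (y : ℝ)

variable {h : ℕ → ℝ}

lemma integrable_baseMeasure_iff (hh : IsBase h) {g : ℕ → ℝ} :
    Integrable g (baseMeasure h) ↔ Summable fun y => g y * h y := by
  rw [baseMeasure, integrable_withDensity_iff_integrable_smul (by fun_prop), integrable_count_iff,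
    ← summable_norm_iff (f := fun y => g y * h y)]
  refine summable_congr fun y => ?_
  simp [NNReal.smul_def, hh.nonneg y, mul_comm]

lemma integral_baseMeasure (hh : IsBase h) (g : ℕ → ℝ) :
    ∫ y, g y ∂(baseMeasure h) = ∑' y, g y * h y := by
  by_cases hg : Integrable g (baseMeasure h)
  · have h1 := (integrable_baseMeasure_iff hh).1 hg
    rw [baseMeasure, integral_withDensity_eq_integral_smul (by fun_prop), integral_countable]
    · refine tsum_congr fun y => ?_
      simp [NNReal.smul_def, hh.nonneg y, mul_comm, Measure.real]
    · rw [integrable_count_iff]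
      refine h1.norm.congr fun y => ?_
      simp [NNReal.smul_def, hh.nonneg y, mul_comm]
  · rw [integral_undef hg, tsum_eq_zero_of_not_summable]
    rwa [integrable_baseMeasure_iff hh] at hg

/-- With `cumulant_eq`, this makes the analyticity and moment formulas for cumulant generating
functions available for the family. -/
lemma natParam_eq (hh : IsBase h) :
    natParam h = interior (ProbabilityTheory.integrableExpSet natVar (baseMeasure h)) := by
  unfold natParam ProbabilityTheory.integrableExpSet
  congr 1
  ext η
  exact (integrable_baseMeasure_iff hh).symm

lemma cumulant_eq (hh : IsBase h) :
    cumulant h = ProbabilityTheory.cgf natVar (baseMeasure h) := by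
  ext η
  simp only [cumulant, ProbabilityTheory.cgf, ProbabilityTheory.mgf]
  rw [integral_baseMeasure hh]

lemma isOpen_natParam : IsOpen (natParam h) := isOpen_interior

lemma convex_natParam (hh : IsBase h) : Convex ℝ (natParam h) := by
  rw [natParam_eq hh]
  exact ProbabilityTheory.convex_integrableExpSet.interior

lemma summable_exp {η : ℝ} (hη : η ∈ natParam h) :
    Summable fun y : ℕ => Real.exp (η * y) * h y := by
  have : η ∈ {η : ℝ | Summable fun y : ℕ => Real.exp (η * y) * h y} := interior_subset hη
  exact this

lemma tsum_exp_pos (hh : IsBase h) {η : ℝ} (hη : η ∈ natParam h) :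
    0 < ∑' y : ℕ, Real.exp (η * y) * h y := by
  obtain ⟨a, -, -, ha, -⟩ := hh.two_atoms
  exact (summable_exp hη).tsum_pos (fun y => mul_nonneg (Real.exp_nonneg _) (hh.nonneg y)) a
    (mul_pos (Real.exp_pos _) ha)

lemma density_eq (hh : IsBase h) {η : ℝ} (hη : η ∈ natParam h) (y : ℕ) :
    density h η y = Real.exp (η * y) * h y / ∑' y : ℕ, Real.exp (η * y) * h y := by
  rw [density, cumulant, Real.exp_sub, Real.exp_log (tsum_exp_pos hh hη)]
  ring

lemma density_nonneg (hh : IsBase h) (η : ℝ) (y : ℕ) : 0 ≤ density h η y :=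
  mul_nonneg (Real.exp_nonneg _) (hh.nonneg y)

lemma density_pos {η : ℝ} {y : ℕ} (hy : 0 < h y) : 0 < density h η y :=
  mul_pos (Real.exp_pos _) hy

lemma density_eq_zero {η : ℝ} {y : ℕ} (hy : h y = 0) : density h η y = 0 := by
  simp [density, hy]

lemma hasSum_density (hh : IsBase h) {η : ℝ} (hη : η ∈ natParam h) :
    HasSum (density h η) 1 := by
  have := (summable_exp hη).hasSum.div_const (∑' y : ℕ, Real.exp (η * y) * h y)
  rw [div_self (tsum_exp_pos hh hη).ne'] at this
  exact this.congr_fun fun y => density_eq hh hη y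

lemma density_le_one (hh : IsBase h) {η : ℝ} (hη : η ∈ natParam h) (y : ℕ) :
    density h η y ≤ 1 :=
  le_hasSum (hasSum_density hh hη) y fun z _ => density_nonneg hh η z

lemma mgf_eq (hh : IsBase h) (η : ℝ) :
    ProbabilityTheory.mgf natVar (baseMeasure h) η = ∑' y : ℕ, Real.exp (η * y) * h y := by
  rw [ProbabilityTheory.mgf, integral_baseMeasure hh]

lemma hasSum_mul_density (hh : IsBase h) {η : ℝ} (hη : η ∈ natParam h) :
    HasSum (fun y : ℕ => (y : ℝ) * density h η y) (meanFun h η) := by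
  have hη' := hη
  rw [natParam_eq hh] at hη'
  have hint := ProbabilityTheory.integrable_pow_mul_exp_of_mem_interior_integrableExpSet hη' 1
  have hs := ((integrable_baseMeasure_iff hh).1 hint).hasSum
  rw [← integral_baseMeasure hh] at hs
  have := hs.div_const (∑' y : ℕ, Real.exp (η * y) * h y)
  rw [meanFun, cumulant_eq hh, ProbabilityTheory.deriv_cgf hη', mgf_eq hh]
  simp only [pow_one] at this
  refine this.congr_fun fun y => ?_
  rw [density_eq hh hη]
  ring

lemma analyticAt_cumulant (hh : IsBase h) {η : ℝ} (hη : η ∈ natParam h) :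
    AnalyticAt ℝ (cumulant h) η := by
  rw [natParam_eq hh] at hη
  rw [cumulant_eq hh]
  exact ProbabilityTheory.analyticAt_cgf hη

lemma analyticAt_meanFun (hh : IsBase h) {η : ℝ} (hη : η ∈ natParam h) :
    AnalyticAt ℝ (meanFun h) η := (analyticAt_cumulant hh hη).deriv

lemma analyticAt_varFun (hh : IsBase h) {η : ℝ} (hη : η ∈ natParam h) :
    AnalyticAt ℝ (varFun h) η := (analyticAt_meanFun hh hη).deriv

lemma hasDerivAt_cumulant (hh : IsBase h) {η : ℝ} (hη : η ∈ natParam h) :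
    HasDerivAt (cumulant h) (meanFun h η) η :=
  (analyticAt_cumulant hh hη).differentiableAt.hasDerivAt

lemma hasDerivAt_meanFun (hh : IsBase h) {η : ℝ} (hη : η ∈ natParam h) :
    HasDerivAt (meanFun h) (varFun h η) η :=
  (analyticAt_meanFun hh hη).differentiableAt.hasDerivAt

/-- The second derivative of the cumulant function is the variance of the tilted law. At most one of
the two atoms equals the mean, so the other one contributes a positive term. -/
lemma varFun_pos (hh : IsBase h) {η : ℝ} (hη : η ∈ natParam h) : 0 < varFun h η := by
  have hη' := hη
  rw [natParam_eq hh] at hη'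
  have key : varFun h η = (∫ y : ℕ, ((y : ℝ) - meanFun h η) ^ 2 * Real.exp (η * y) ∂(baseMeasure h))
      / ∑' y : ℕ, Real.exp (η * y) * h y := by
    have := ProbabilityTheory.iteratedDeriv_two_cgf_eq_integral hη'
    rw [iteratedDeriv_succ, iteratedDeriv_one, mgf_eq hh, ← cumulant_eq hh] at this
    exact this
  rw [key, integral_baseMeasure hh]
  refine div_pos ?_ (tsum_exp_pos hh hη)
  have hint : Integrable (fun y : ℕ => ((y : ℝ) - meanFun h η) ^ 2 * Real.exp (η * y))
      (baseMeasure h) := by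
    have h2 := ProbabilityTheory.integrable_pow_mul_exp_of_mem_interior_integrableExpSet hη' 2
    have h1 := ProbabilityTheory.integrable_pow_mul_exp_of_mem_interior_integrableExpSet hη' 1
    have h0 := ProbabilityTheory.integrable_pow_mul_exp_of_mem_interior_integrableExpSet hη' 0
    refine ((h2.sub (h1.const_mul (2 * meanFun h η))).add
      (h0.const_mul (meanFun h η ^ 2))).congr (ae_of_all _ fun y => ?_)
    simp only [Pi.add_apply, Pi.sub_apply, natVar]
    ring
  have hs := (integrable_baseMeasure_iff hh).1 hint
  have hnn : ∀ y : ℕ, 0 ≤ ((y : ℝ) - meanFun h η) ^ 2 * Real.exp (η * y) * h y := fun y =>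
    mul_nonneg (mul_nonneg (sq_nonneg _) (Real.exp_nonneg _)) (hh.nonneg y)
  obtain ⟨a, b, hab, ha, hb⟩ := hh.two_atoms
  by_cases hma : (a : ℝ) = meanFun h η
  · have hmb : (b : ℝ) - meanFun h η ≠ 0 := by
      intro hmb
      exact hab (by exact_mod_cast hma.trans (sub_eq_zero.1 hmb).symm)
    exact hs.tsum_pos hnn b (by positivity)
  · have hma : (a : ℝ) - meanFun h η ≠ 0 := sub_ne_zero.2 hma
    exact hs.tsum_pos hnn a (by positivity)

lemma strictMonoOn_meanFun (hh : IsBase h) : StrictMonoOn (meanFun h) (natParam h) := by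
  refine strictMonoOn_of_deriv_pos (convex_natParam hh)
    (fun η hη => (analyticAt_meanFun hh hη).continuousAt.continuousWithinAt) fun η hη => ?_
  exact varFun_pos hh (interior_subset hη)

lemma meanInv_mem {x : ℝ} (hx : x ∈ meanRange h) : meanInv h x ∈ natParam h :=
  Function.invFunOn_mem hx

lemma meanFun_meanInv {x : ℝ} (hx : x ∈ meanRange h) : meanFun h (meanInv h x) = x :=
  Function.invFunOn_eq hx

lemma meanInv_meanFun (hh : IsBase h) {η : ℝ} (hη : η ∈ natParam h) :
    meanInv h (meanFun h η) = η :=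
  (strictMonoOn_meanFun hh).injOn (meanInv_mem ⟨η, hη, rfl⟩) hη
    (meanFun_meanInv ⟨η, hη, rfl⟩)

lemma strictMonoOn_meanInv (hh : IsBase h) : StrictMonoOn (meanInv h) (meanRange h) := by
  intro x hx y hy hxy
  by_contra hcon
  have := (strictMonoOn_meanFun hh).monotoneOn (meanInv_mem hy) (meanInv_mem hx) (not_lt.1 hcon)
  rw [meanFun_meanInv hx, meanFun_meanInv hy] at this
  exact absurd hxy (not_lt.2 this)

lemma meanRange_mem_nhds (hh : IsBase h) {x : ℝ} (hx : x ∈ meanRange h) : meanRange h ∈ 𝓝 x := by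
  obtain ⟨η, hη, rfl⟩ := hx
  have hs := (analyticAt_meanFun hh hη).hasStrictDerivAt
  rw [← hs.map_nhds_eq (varFun_pos hh hη).ne']
  exact image_mem_map (isOpen_natParam.mem_nhds hη)

lemma isOpen_meanRange (hh : IsBase h) : IsOpen (meanRange h) :=
  isOpen_iff_mem_nhds.2 fun _ hx => meanRange_mem_nhds hh hx

/-- The inverse function theorem gives a smooth local inverse. It agrees with `meanInv` because near
the point its values stay in `natParam h`, where `meanFun` is injective. -/
lemma contDiffAt_meanInv (hh : IsBase h) {x : ℝ} (hx : x ∈ meanRange h) {n : WithTop ℕ∞}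
    (hn : n ≠ 0) : ContDiffAt ℝ n (meanInv h) x := by
  obtain ⟨η, hη, rfl⟩ := hx
  have hc : ContDiffAt ℝ n (meanFun h) η := (analyticAt_meanFun hh hη).contDiffAt
  have hv := (varFun_pos hh hη).ne'
  have hd : HasFDerivAt (meanFun h)
      ((ContinuousLinearEquiv.unitsEquivAut ℝ (Units.mk0 _ hv) : ℝ ≃L[ℝ] ℝ) : ℝ →L[ℝ] ℝ) η := by
    refine (hasDerivAt_meanFun hh hη).hasFDerivAt.congr_fderiv ?_
    ext
    simp
  refine (hc.to_localInverse hd hn).congr_of_eventuallyEq ?_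
  have h1 : ∀ᶠ x in 𝓝 (meanFun h η), meanFun h (hc.localInverse hd hn x) = x :=
    (hc.hasStrictFDerivAt' hd hn).eventually_right_inverse
  have h2 : ∀ᶠ x in 𝓝 (meanFun h η), hc.localInverse hd hn x ∈ natParam h := by
    refine (hc.to_localInverse hd hn).continuousAt.eventually_mem ?_
    rw [hc.localInverse_apply_image]
    exact isOpen_natParam.mem_nhds hη
  filter_upwards [h1, h2] with x hx1 hx2
  conv_lhs => rw [← hx1]
  exact meanInv_meanFun hh hx2

lemma meanRange_nonneg (hh : IsBase h) {x : ℝ} (hx : x ∈ meanRange h) : 0 ≤ x := by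
  obtain ⟨η, hη, rfl⟩ := hx
  exact (hasSum_mul_density hh hη).nonneg fun y =>
    mul_nonneg (Nat.cast_nonneg y) (density_nonneg hh η y)

/-- The law with mean `x` in the exponential family. -/
def law (h : ℕ → ℝ) (x : ℝ) (y : ℕ) : ℝ := density h (meanInv h x) y

lemma law_nonneg (hh : IsBase h) (x : ℝ) (y : ℕ) : 0 ≤ law h x y := density_nonneg hh _ y

lemma law_pos {x : ℝ} {y : ℕ} (hy : 0 < h y) : 0 < law h x y := density_pos hy

lemma law_eq_zero {x : ℝ} {y : ℕ} (hy : h y = 0) : law h x y = 0 := density_eq_zero hy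

lemma hasSum_law (hh : IsBase h) {x : ℝ} (hx : x ∈ meanRange h) : HasSum (law h x) 1 :=
  hasSum_density hh (meanInv_mem hx)

lemma hasSum_mul_law (hh : IsBase h) {x : ℝ} (hx : x ∈ meanRange h) :
    HasSum (fun y : ℕ => (y : ℝ) * law h x y) x := by
  have := hasSum_mul_density hh (meanInv_mem hx)
  rwa [meanFun_meanInv hx] at this

lemma law_le_one (hh : IsBase h) {x : ℝ} (hx : x ∈ meanRange h) (y : ℕ) : law h x y ≤ 1 :=
  density_le_one hh (meanInv_mem hx) y

lemma continuousOn_law (hh : IsBase h) (y : ℕ) :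
    ContinuousOn (fun x => law h x y) (meanRange h) := by
  intro x hx
  have h1 : ContinuousAt (meanInv h) x := (contDiffAt_meanInv hh hx one_ne_zero).continuousAt
  have h2 : ContinuousAt (cumulant h) (meanInv h x) :=
    (analyticAt_cumulant hh (meanInv_mem hx)).continuousAt
  have h3 : ContinuousAt (fun x => cumulant h (meanInv h x)) x := h2.comp h1
  unfold law density
  exact (((h1.mul_const _).sub h3).rexp.mul_const _).continuousWithinAt

lemma summable_law_mul (hh : IsBase h) {x : ℝ} (hx : x ∈ meanRange h) {g : ℕ → ℝ} {L : ℝ}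
    (hL : 0 ≤ L) (hg : ∀ y y', 0 < h y → 0 < h y' → |g y - g y'| ≤ L * |(y : ℝ) - y'|) :
    Summable fun y => law h x y * g y := by
  obtain ⟨a, -, -, ha, -⟩ := hh.two_atoms
  have hs : Summable fun y : ℕ => (|g a| + L * a) * law h x y + L * ((y : ℝ) * law h x y) :=
    ((hasSum_law hh hx).summable.mul_left _).add ((hasSum_mul_law hh hx).summable.mul_left _)
  refine Summable.of_norm_bounded hs fun y => ?_
  rcases (hh.nonneg y).eq_or_lt with hy | hy
  · simp [law_eq_zero hy.symm]
  · rw [norm_mul, Real.norm_eq_abs, Real.norm_eq_abs, abs_of_nonneg (law_nonneg hh x y)]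
    have h1 := hg y a hy ha
    have h2 : |g y| ≤ |g a| + |g y - g a| := by
      have := abs_add_le (g a) (g y - g a); simpa using this
    have h3 : |(y : ℝ) - a| ≤ y + a := by
      rw [abs_le]; constructor <;> linarith [Nat.cast_nonneg (α := ℝ) y, Nat.cast_nonneg (α := ℝ) a]
    have h4 : |g y| ≤ |g a| + L * (y + a) := by
      have := mul_le_mul_of_nonneg_left h3 hL
      linarith
    have := mul_le_mul_of_nonneg_left h4 (law_nonneg hh x y)
    linarith

/-- The likelihood ratio of the laws with means x < x' is increasing, so the difference of the laws
changes sign once. Centred at the crossing, |g y - g y₁| ≤ L |y - y₁| makes every term at most a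
term whose sign is known, and these bounds add up to exactly L times the difference of the means. -/
lemma tsum_law_mul_sub_le (hh : IsBase h) {x x' : ℝ} (hx : x ∈ meanRange h)
    (hx' : x' ∈ meanRange h) (hxx : x < x') {g : ℕ → ℝ} {L : ℝ}
    (hL : 0 ≤ L) (hg : ∀ y y', 0 < h y → 0 < h y' → |g y - g y'| ≤ L * |(y : ℝ) - y'|) :
    |∑' y, law h x y * g y - ∑' y, law h x' y * g y| ≤ L * (x' - x) := by
  set η := meanInv h x
  set η' := meanInv h x'
  have hηη : η < η' := strictMonoOn_meanInv hh hx hx' hxx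
  -- The point at which the likelihood ratio of the two laws equals one.
  set c : ℝ := (cumulant h η' - cumulant h η) / (η' - η) with hc
  have hpos : 0 < η' - η := sub_pos.2 hηη
  have hle : ∀ y : ℕ, (y : ℝ) < c → law h x' y ≤ law h x y := by
    intro y hy
    refine mul_le_mul_of_nonneg_right (Real.exp_le_exp.2 ?_) (hh.nonneg y)
    rw [hc, lt_div_iff₀ hpos] at hy
    linarith
  have hlt : ∀ y : ℕ, (y : ℝ) < c → 0 < h y → law h x' y < law h x y := by
    intro y hy hhy
    refine mul_lt_mul_of_pos_right (Real.exp_lt_exp.2 ?_) hhy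
    rw [hc, lt_div_iff₀ hpos] at hy
    linarith
  have hge : ∀ y : ℕ, c ≤ (y : ℝ) → law h x y ≤ law h x' y := by
    intro y hy
    refine mul_le_mul_of_nonneg_right (Real.exp_le_exp.2 ?_) (hh.nonneg y)
    rw [hc, div_le_iff₀ hpos] at hy
    linarith
  have hs := hasSum_law hh hx
  have hs' := hasSum_law hh hx'
  -- The centre must be an atom, since g is controlled only there. If all atoms were below c, one
  -- law would be strictly smaller than the other at every atom, yet both have mass one.
  have hex : ∃ y : ℕ, 0 < h y ∧ c ≤ (y : ℝ) := by
    by_contra! hcon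
    obtain ⟨a, -, -, ha, -⟩ := hh.two_atoms
    have : (1 : ℝ) < 1 := by
      refine hasSum_lt (i := a) (fun y => ?_) (hlt a (hcon a ha) ha) hs' hs
      rcases (hh.nonneg y).eq_or_lt with hy | hy
      · simp [law_eq_zero hy.symm]
      · exact hle y (hcon y hy)
    exact lt_irrefl _ this
  classical
  set y₁ := Nat.find hex with hy₁
  obtain ⟨hy₁h, hy₁c⟩ : 0 < h y₁ ∧ c ≤ (y₁ : ℝ) := Nat.find_spec hex
  have hmin : ∀ y, 0 < h y → y < y₁ → (y : ℝ) < c := by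
    intro y hy hlt
    by_contra hcon
    exact Nat.find_min hex hlt ⟨hy, not_lt.1 hcon⟩
  have hsm := hasSum_mul_law hh hx
  have hsm' := hasSum_mul_law hh hx'
  have hg1 := (summable_law_mul hh hx hL hg).hasSum
  have hg1' := (summable_law_mul hh hx' hL hg).hasSum
  -- Subtracting the constant g y₁ changes nothing, because both laws have total mass one; the same
  -- applies to y₁ in `hb`.
  have hd : HasSum (fun y => (law h x y - law h x' y) * (g y - g y₁))
      (∑' y, law h x y * g y - ∑' y, law h x' y * g y) := by
    have := (hg1.sub hg1').sub ((hs.sub hs').mul_right (g y₁))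
    simp only [sub_self, zero_mul, sub_zero] at this
    exact this.congr_fun fun y => by ring
  have hb : HasSum (fun y : ℕ => L * ((law h x' y - law h x y) * ((y : ℝ) - y₁)))
      (L * (x' - x)) := by
    have := ((hsm'.sub hsm).sub ((hs'.sub hs).mul_right (y₁ : ℝ))).mul_left L
    simp only [sub_self, zero_mul, sub_zero] at this
    exact this.congr_fun fun y => by ring
  have hterm : ∀ y : ℕ, |(law h x y - law h x' y) * (g y - g y₁)| ≤
      L * ((law h x' y - law h x y) * ((y : ℝ) - y₁)) := by
    intro y
    rcases (hh.nonneg y).eq_or_lt with hy | hy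
    · simp [law_eq_zero hy.symm]
    · have h1 := hg y y₁ hy hy₁h
      have h2 : |law h x y - law h x' y| * |(y : ℝ) - y₁| =
          (law h x' y - law h x y) * ((y : ℝ) - y₁) := by
        rcases lt_or_ge y y₁ with hlt | hge'
        · have h3 := hle y (hmin y hy hlt)
          have h4 : (y : ℝ) - y₁ ≤ 0 := by
            have : (y : ℝ) < y₁ := by exact_mod_cast hlt
            linarith
          rw [abs_of_nonneg (by linarith), abs_of_nonpos h4]
          ring
        · have h4 : (y₁ : ℝ) ≤ y := by exact_mod_cast hge'
          have h3 := hge y (hy₁c.trans h4)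
          rw [abs_of_nonpos (by linarith), abs_of_nonneg (by linarith)]
          ring
      rw [abs_mul, ← h2]
      calc |law h x y - law h x' y| * |g y - g y₁|
          ≤ |law h x y - law h x' y| * (L * |(y : ℝ) - y₁|) :=
            mul_le_mul_of_nonneg_left h1 (abs_nonneg _)
        _ = _ := by ring
  rw [abs_le]
  constructor
  · have := hasSum_le (fun y => (abs_le.1 (hterm y)).1) hb.neg hd
    exact this
  · exact hasSum_le (fun y => (abs_le.1 (hterm y)).2) hd hb

/-- Stochastic monotonicity in the mean: expectations of `L`-Lipschitz functions are `L`-Lipschitz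
functions of the mean. -/
lemma abs_tsum_law_mul_sub_le (hh : IsBase h) {x x' : ℝ} (hx : x ∈ meanRange h)
    (hx' : x' ∈ meanRange h) {g : ℕ → ℝ} {L : ℝ}
    (hL : 0 ≤ L) (hg : ∀ y y', 0 < h y → 0 < h y' → |g y - g y'| ≤ L * |(y : ℝ) - y'|) :
    |∑' y, law h x y * g y - ∑' y, law h x' y * g y| ≤ L * |x - x'| := by
  rcases lt_trichotomy x x' with hlt | rfl | hlt
  · rw [abs_sub_comm x, abs_of_pos (sub_pos.2 hlt)]
    exact tsum_law_mul_sub_le hh hx hx' hlt hL hg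
  · simp
  · rw [abs_of_pos (sub_pos.2 hlt), abs_sub_comm]
    exact tsum_law_mul_sub_le hh hx' hx hlt hL hg

/-- The indicator of a point is 1-Lipschitz on the integers. -/
lemma abs_law_sub_le (hh : IsBase h) {x x' : ℝ} (hx : x ∈ meanRange h)
    (hx' : x' ∈ meanRange h) (k : ℕ) : |law h x k - law h x' k| ≤ |x - x'| := by
  classical
  have := abs_tsum_law_mul_sub_le hh hx hx' (g := fun y => if y = k then 1 else 0) zero_le_one
    (fun y y' _ _ => by
      rcases eq_or_ne y y' with rfl | hne
      · simp
      · have h1 : (1 : ℝ) ≤ |(y : ℝ) - y'| := by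
          have : (1 : ℤ) ≤ |(y : ℤ) - y'| := Int.one_le_abs (by omega)
          exact_mod_cast this
        rw [one_mul]
        refine le_trans ?_ h1
        split_ifs <;> simp)
  simpa using this

lemma law_injective (hh : IsBase h) {x x' : ℝ} (hx : x ∈ meanRange h)
    (hx' : x' ∈ meanRange h) (he : ∀ y, 0 < h y → law h x y = law h x' y) : x = x' := by
  have h1 := hasSum_mul_law hh hx
  have h2 := hasSum_mul_law hh hx'
  refine h1.unique (h2.congr_fun fun y => ?_)
  rcases (hh.nonneg y).eq_or_lt with hy | hy
  · simp [law_eq_zero hy.symm]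
  · rw [he y hy]

end CountSeries
end

noncomputable section

namespace CountSeries

/-! ### Contractive recursions run through the past -/

/-- The recursions `f θ`, `θ ∈ Θ`, are non-negative and contractive with constants `δ₁`, `δ₂`. -/
structure IsContractive {d : ℕ} (f : Param d → ℝ → ℕ → ℝ) (Θ : Set (Param d)) (δ₁ δ₂ : ℝ) :
    Prop where
  nonneg : ∀ θ ∈ Θ, ∀ x : ℝ, 0 ≤ x → ∀ y : ℕ, 0 ≤ f θ x y
  fst_nonneg : 0 ≤ δ₁
  snd_nonneg : 0 ≤ δ₂
  add_lt_one : δ₁ + δ₂ < 1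
  lip : ∀ θ ∈ Θ, ∀ x x' : ℝ, 0 ≤ x → 0 ≤ x' → ∀ y y' : ℕ,
      |f θ x y - f θ x' y'| ≤ δ₁ * |x - x'| + δ₂ * |(y : ℝ) - (y' : ℝ)|

/-- Prepend an observation to a past. -/
def cons (a : ℕ) (p : ℕ → ℕ) : ℕ → ℕ
  | 0 => a
  | k + 1 => p k

@[simp] lemma cons_zero (a : ℕ) (p : ℕ → ℕ) : cons a p 0 = a := rfl

@[simp] lemma cons_succ (a : ℕ) (p : ℕ → ℕ) (k : ℕ) : cons a p (k + 1) = p k := rfl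

lemma measurable_cons (a : ℕ) : Measurable (cons a) := by
  refine measurable_pi_lambda _ fun k => ?_
  cases k with
  | zero => exact measurable_const
  | succ k => exact measurable_pi_apply k

lemma admissible_cons {h : ℕ → ℝ} {a : ℕ} {p : ℕ → ℕ} (ha : 0 < h a) (hp : p ∈ admissible h) :
    cons a p ∈ admissible h := by
  refine ⟨fun k => ?_, fun r hr0 hr1 => ?_⟩
  · cases k with
    | zero => exact ha
    | succ k => exact hp.1 k
  · rw [← summable_nat_add_iff 1]
    refine ((hp.2 r hr0 hr1).mul_left r).congr fun k => ?_
    rw [cons_succ, pow_succ]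
    ring

section

variable {d : ℕ} {f : Param d → ℝ → ℕ → ℝ} {Θ : Set (Param d)} {δ₁ δ₂ : ℝ} {h : ℕ → ℝ}

lemma IsContractive.fst_lt_one (hc : IsContractive f Θ δ₁ δ₂) : δ₁ < 1 := by
  linarith [hc.add_lt_one, hc.snd_nonneg]

lemma IsContractive.snd_lt_one (hc : IsContractive f Θ δ₁ δ₂) : δ₂ < 1 := by
  linarith [hc.add_lt_one, hc.fst_nonneg]

/-- The discounted sum of a past. -/
def discount (r : ℝ) (p : ℕ → ℕ) : ℝ := ∑' k, r ^ k * (p k : ℝ)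

lemma discount_nonneg {r : ℝ} (hr : 0 ≤ r) (p : ℕ → ℕ) : 0 ≤ discount r p :=
  tsum_nonneg fun k => mul_nonneg (pow_nonneg hr k) (Nat.cast_nonneg _)

lemma backIter_nonneg (hc : IsContractive f Θ δ₁ δ₂) {θ : Param d} (hθ : θ ∈ Θ) (k : ℕ)
    (p : ℕ → ℕ) : 0 ≤ backIter f θ k p := by
  induction k generalizing p with
  | zero => exact le_rfl
  | succ k ih => exact hc.nonneg θ hθ _ (ih _) _

/-- One more old observation changes only the starting value of the innermost step, and each of the
k outer steps contracts this change by δ₁. -/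
lemma backIter_succ_sub_le (hc : IsContractive f Θ δ₁ δ₂) {θ : Param d} (hθ : θ ∈ Θ) (k : ℕ)
    (p : ℕ → ℕ) :
    |backIter f θ (k + 1) p - backIter f θ k p| ≤ δ₁ ^ k * (f θ 0 0 + p k) := by
  induction k generalizing p with
  | zero =>
    have h1 := hc.lip θ hθ 0 0 le_rfl le_rfl (p 0) 0
    have h2 := hc.nonneg θ hθ 0 le_rfl (p 0)
    have h3 : δ₂ * (p 0 : ℝ) ≤ p 0 :=
      mul_le_of_le_one_left (Nat.cast_nonneg _) hc.snd_lt_one.le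
    simp only [backIter, sub_zero, abs_zero, mul_zero, zero_add, Nat.cast_zero, Nat.abs_cast,
      pow_zero, one_mul] at h1 ⊢
    rw [abs_of_nonneg h2]
    linarith [(abs_le.1 h1).2]
  | succ k ih =>
    have h1 := hc.lip θ hθ _ _ (backIter_nonneg hc hθ (k + 1) fun i => p (i + 1))
      (backIter_nonneg hc hθ k fun i => p (i + 1)) (p 0) (p 0)
    rw [sub_self, abs_zero, mul_zero, add_zero] at h1
    refine h1.trans ?_
    have := mul_le_mul_of_nonneg_left (ih fun i => p (i + 1)) hc.fst_nonneg
    refine this.trans_eq ?_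
    rw [pow_succ]
    ring

lemma tendsto_backIter (hc : IsContractive f Θ δ₁ δ₂) {θ : Param d} (hθ : θ ∈ Θ)
    {p : ℕ → ℕ} (hp : p ∈ admissible h) :
    Tendsto (fun k => backIter f θ k p) atTop (𝓝 (fInf f θ p)) := by
  have hcau : CauchySeq fun k => backIter f θ k p := by
    refine cauchySeq_of_summable_dist ?_
    have hs : Summable fun k => δ₁ ^ k * (f θ 0 0 + p k) := by
      have := ((summable_geometric_of_lt_one hc.fst_nonneg hc.fst_lt_one).mul_right (f θ 0 0)).add
        (hp.2 δ₁ hc.fst_nonneg hc.fst_lt_one)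
      exact this.congr fun k => by ring
    refine Summable.of_nonneg_of_le (fun _ => dist_nonneg) (fun k => ?_) hs
    rw [dist_comm, Real.dist_eq]
    exact backIter_succ_sub_le hc hθ k p
  exact hcau.tendsto_limUnder

lemma fInf_nonneg (hc : IsContractive f Θ δ₁ δ₂) {θ : Param d} (hθ : θ ∈ Θ)
    {p : ℕ → ℕ} (hp : p ∈ admissible h) : 0 ≤ fInf f θ p :=
  ge_of_tendsto' (tendsto_backIter hc hθ hp) fun k => backIter_nonneg hc hθ k p

lemma fInf_cons (hc : IsContractive f Θ δ₁ δ₂) {θ : Param d} (hθ : θ ∈ Θ)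
    {a : ℕ} {p : ℕ → ℕ} (ha : 0 < h a) (hp : p ∈ admissible h) :
    fInf f θ (cons a p) = f θ (fInf f θ p) a := by
  have h1 := (tendsto_backIter hc hθ (admissible_cons ha hp)).comp (tendsto_add_atTop_nat 1)
  have h2 : Tendsto (fun k => f θ (backIter f θ k p) a) atTop (𝓝 (f θ (fInf f θ p) a)) := by
    rw [tendsto_iff_dist_tendsto_zero]
    have h3 := (tendsto_iff_dist_tendsto_zero.1 (tendsto_backIter hc hθ hp)).const_mul δ₁
    rw [mul_zero] at h3
    refine squeeze_zero (fun _ => dist_nonneg) (fun k => ?_) h3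
    have := hc.lip θ hθ _ _ (backIter_nonneg hc hθ k p) (fInf_nonneg hc hθ hp) a a
    rwa [sub_self, abs_zero, mul_zero, add_zero] at this
  exact tendsto_nhds_unique h1 h2

lemma abs_backIter_sub_le (hc : IsContractive f Θ δ₁ δ₂) {θ : Param d} (hθ : θ ∈ Θ) (k : ℕ)
    (p p' : ℕ → ℕ) :
    |backIter f θ k p - backIter f θ k p'| ≤
      ∑ i ∈ Finset.range k, (δ₁ ^ i * (p i : ℝ) + δ₁ ^ i * (p' i : ℝ)) := by
  induction k generalizing p p' with
  | zero => simp [backIter]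
  | succ k ih =>
    rw [Finset.sum_range_succ']
    have h1 := hc.lip θ hθ _ _ (backIter_nonneg hc hθ k fun i => p (i + 1))
      (backIter_nonneg hc hθ k fun i => p' (i + 1)) (p 0) (p' 0)
    have h2 := mul_le_mul_of_nonneg_left (ih (fun i => p (i + 1)) fun i => p' (i + 1))
      hc.fst_nonneg
    rw [Finset.mul_sum] at h2
    have h3 : δ₂ * |(p 0 : ℝ) - p' 0| ≤ p 0 + p' 0 := by
      refine (mul_le_of_le_one_left (abs_nonneg _) hc.snd_lt_one.le).trans ?_
      rw [abs_le]
      constructor <;> linarith [Nat.cast_nonneg (α := ℝ) (p 0), Nat.cast_nonneg (α := ℝ) (p' 0)]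
    have h4 : ∑ i ∈ Finset.range k, δ₁ * (δ₁ ^ i * (p (i + 1) : ℝ) + δ₁ ^ i * (p' (i + 1) : ℝ)) =
        ∑ i ∈ Finset.range k, (δ₁ ^ (i + 1) * (p (i + 1) : ℝ) + δ₁ ^ (i + 1) * (p' (i + 1) : ℝ)) :=
      Finset.sum_congr rfl fun i _ => by rw [pow_succ]; ring
    rw [h4] at h2
    simp only [backIter, pow_zero, one_mul]
    linarith

/-- The bound is free of θ, so that one error sequence serves all parameters when the past is
replaced by another one. -/
lemma abs_fInf_sub_le (hc : IsContractive f Θ δ₁ δ₂) {θ : Param d} (hθ : θ ∈ Θ)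
    {p p' : ℕ → ℕ} (hp : p ∈ admissible h) (hp' : p' ∈ admissible h) :
    |fInf f θ p - fInf f θ p'| ≤ discount δ₁ p + discount δ₁ p' := by
  have h1 := ((tendsto_backIter hc hθ hp).sub (tendsto_backIter hc hθ hp')).abs
  have hs := hp.2 δ₁ hc.fst_nonneg hc.fst_lt_one
  have hs' := hp'.2 δ₁ hc.fst_nonneg hc.fst_lt_one
  refine le_of_tendsto' h1 fun k => (abs_backIter_sub_le hc hθ k p p').trans ?_
  rw [discount, discount, ← hs.tsum_add hs']
  refine (hs.add hs').sum_le_tsum _ fun i _ => ?_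
  have := pow_nonneg hc.fst_nonneg i
  positivity

/-- Dependence on finitely many integers makes the iterate measurable without any measurability of
f. -/
lemma exists_backIter_eq (θ : Param d) (k : ℕ) :
    ∃ g : (Fin k → ℕ) → ℝ, ∀ p : ℕ → ℕ, backIter f θ k p = g fun i => p i := by
  induction k with
  | zero => exact ⟨fun _ => 0, fun _ => rfl⟩
  | succ k ih =>
    obtain ⟨g, hg⟩ := ih
    refine ⟨fun q => f θ (g fun i => q i.succ) (q 0), fun p => ?_⟩
    rw [backIter, hg]
    rfl

lemma measurable_backIter (f : Param d → ℝ → ℕ → ℝ) (θ : Param d) (k : ℕ) :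
    Measurable (backIter f θ k) := by
  obtain ⟨g, hg⟩ := exists_backIter_eq (f := f) θ k
  have : backIter f θ k = g ∘ fun (p : ℕ → ℕ) (i : Fin k) => p i := funext hg
  rw [this]
  exact (measurable_of_countable g).comp (by fun_prop)

lemma measurable_fInf (f : Param d → ℝ → ℕ → ℝ) (θ : Param d) : Measurable (fInf f θ) :=
  (StronglyMeasurable.limUnder fun k => (measurable_backIter f θ k).stronglyMeasurable).measurable

end

/-! ### Path space -/

/-- The paths of the observed process. -/
abbrev Path := ℤ → ℕ

/-- The time shift of paths. -/
def shift (y : Path) : Path := fun t => y (t + 1)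

/-- The past of a path strictly before time `0`, the most recent observation first. -/
def past (y : Path) : ℕ → ℕ := fun k => y (-1 - k)

lemma measurable_shift : Measurable shift :=
  measurable_pi_lambda _ fun t => measurable_pi_apply (t + 1)

lemma measurable_past : Measurable past :=
  measurable_pi_lambda _ fun k => measurable_pi_apply (-1 - (k : ℤ))

lemma iterate_shift_apply (n : ℕ) (y : Path) (t : ℤ) : shift^[n] y t = y (t + n) := by
  induction n generalizing y with
  | zero => simp
  | succ n ih =>
    rw [Function.iterate_succ_apply, ih, shift]
    congr 1
    push_cast
    ring

lemma past_shift (y : Path) : past (shift y) = cons (y 0) (past y) := by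
  ext k
  cases k with
  | zero => simp [past, shift]
  | succ k =>
    simp only [past, shift, cons_succ]
    congr 1
    push_cast
    ring

lemma past_iterate_shift (n : ℕ) (y : Path) :
    past (shift^[n] y) = fun k : ℕ => y ((n : ℤ) - 1 - k) := by
  ext k
  rw [past, iterate_shift_apply]
  congr 1
  ring

lemma fitted_eq {d : ℕ} (f : Param d → ℝ → ℕ → ℝ) (y : Path) (n : ℕ) :
    fitted f y n = fun θ => fInf f θ (past (shift^[n] y)) := by
  ext θ
  rw [past_iterate_shift, fitted]

lemma eta_eq {d : ℕ} (h : ℕ → ℝ) (f : Param d → ℝ → ℕ → ℝ) (y : Path) (n : ℕ) :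
    eta h f y n = fun θ => meanInv h (fInf f θ (past (shift^[n] y))) := by
  ext θ
  rw [eta, fitted_eq]

end CountSeries
end

noncomputable section

namespace CountSeries

/-! ### The pointwise ergodic theorem -/

section Birkhoff

variable {α : Type*} {T : α → α} {G : α → ℝ}

/-- The running maxima of the Birkhoff sums, over the times `1, …, n + 1`. -/
def runMax (T : α → α) (G : α → ℝ) : ℕ → α → ℝ
  | 0 => G
  | n + 1 => fun x => G x + max 0 (runMax T G n (T x))

lemma runMax_le_succ (n : ℕ) (x : α) : runMax T G n x ≤ runMax T G (n + 1) x := by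
  induction n generalizing x with
  | zero => simp [runMax]
  | succ n ih =>
    have := max_le_max_left 0 (ih (T x))
    simp only [runMax] at this ⊢
    linarith

lemma birkhoffSum_le_runMax (n : ℕ) (x : α) : birkhoffSum T G (n + 1) x ≤ runMax T G n x := by
  induction n generalizing x with
  | zero => simp [runMax]
  | succ n ih =>
    rw [birkhoffSum_succ']
    have := (ih (T x)).trans (le_max_right 0 _)
    simp only [runMax]
    linarith

lemma birkhoffSum_sub_const (G : α → ℝ) (c : ℝ) (n : ℕ) (x : α) :
    birkhoffSum T (fun x => G x - c) n x = birkhoffSum T G n x - n * c := by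
  simp [birkhoffSum, Finset.sum_sub_distrib]

/-- Birkhoff sums start at time 0 while the observation windows start after `a`, hence the shifts by
one. -/
lemma sum_Ioc_eq_birkhoffSum_sub {a b : ℕ} (hab : a ≤ b) (x : α) :
    ∑ t ∈ Finset.Ioc a b, G (T^[t] x) = birkhoffSum T G (b + 1) x - birkhoffSum T G (a + 1) x := by
  rw [birkhoffSum, birkhoffSum, ← Finset.sum_Ico_eq_sub _ (by omega : a + 1 ≤ b + 1)]
  refine Finset.sum_congr ?_ fun _ _ => rfl
  ext t
  simp only [Finset.mem_Ioc, Finset.mem_Ico]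
  omega

variable [MeasurableSpace α] {μ : Measure α}

lemma integrable_runMax (hT : MeasurePreserving T μ μ) (hG : Integrable G μ) (n : ℕ) :
    Integrable (runMax T G n) μ := by
  induction n with
  | zero => exact hG
  | succ n ih =>
    have h1 : Integrable (fun x => runMax T G n (T x)) μ := hT.integrable_comp_of_integrable ih
    have h2 : Integrable (fun x => max 0 (runMax T G n (T x))) μ := by
      refine h1.pos_part.congr (ae_of_all _ fun x => max_comm _ _)
    exact hG.add h2

/-- The maximal ergodic inequality, when the Birkhoff sums are almost surely unbounded above. -/
lemma integral_nonneg_of_unbounded (hT : MeasurePreserving T μ μ) (hG : Integrable G μ)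
    (hu : ∀ᵐ x ∂μ, ∀ K : ℕ, ∃ n, (K : ℝ) < birkhoffSum T G n x) : 0 ≤ ∫ x, G x ∂μ := by
  have hM := integrable_runMax hT hG
  have hMT : ∀ n, Integrable (fun x => runMax T G n (T x)) μ := fun n =>
    hT.integrable_comp_of_integrable (hM n)
  -- Composition with T preserves the integral, and the running maxima increase with n.
  have h1 : ∀ n, 0 ≤ ∫ x, (runMax T G (n + 1) x - runMax T G n (T x)) ∂μ := by
    intro n
    rw [integral_sub (hM _) (hMT _)]
    have h2 : ∫ x, runMax T G n (T x) ∂μ = ∫ x, runMax T G n x ∂μ := by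
      have := integral_map (μ := μ) hT.aemeasurable (f := runMax T G n)
        (by rw [hT.map_eq]; exact (hM n).aestronglyMeasurable)
      rw [← this, hT.map_eq]
    rw [h2, sub_nonneg]
    exact integral_mono (hM _) (hM _) fun x => runMax_le_succ n x
  -- The integrand is G plus the negative part of the running maximum at T x. That part is dominated
  -- by |G ∘ T| and vanishes once some Birkhoff sum started at T x is positive.
  have h3 : Tendsto (fun n => ∫ x, (runMax T G (n + 1) x - runMax T G n (T x)) ∂μ) atTop
      (𝓝 (∫ x, G x ∂μ)) := by
    have hGT : Integrable (fun x => G (T x)) μ := hT.integrable_comp_of_integrable hG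
    refine tendsto_integral_of_dominated_convergence (fun x => |G x| + |G (T x)|)
      (fun n => ((hM _).sub (hMT _)).aestronglyMeasurable) (hG.abs.add hGT.abs)
      (fun n => ae_of_all _ fun x => ?_) ?_
    · have h4 : G (T x) ≤ runMax T G n (T x) := by
        induction n with
        | zero => exact le_rfl
        | succ n ih => exact ih.trans (runMax_le_succ n _)
      simp only [runMax, Real.norm_eq_abs]
      have h5 : |max 0 (runMax T G n (T x)) - runMax T G n (T x)| ≤ |G (T x)| := by
        rcases le_total 0 (runMax T G n (T x)) with h0 | h0
        · rw [max_eq_right h0]; simp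
        · rw [max_eq_left h0, zero_sub, abs_neg, abs_of_nonpos h0,
            abs_of_nonpos (h4.trans h0)]
          linarith
      rw [add_sub_assoc]
      exact (abs_add_le _ _).trans (by linarith)
    · have hu' : ∀ᵐ x ∂μ, ∀ K : ℕ, ∃ n, (K : ℝ) < birkhoffSum T G n (T x) :=
        hT.quasiMeasurePreserving.ae hu
      filter_upwards [hu'] with x hx
      obtain ⟨n, hn⟩ := hx 0
      rw [Nat.cast_zero] at hn
      cases n with
      | zero => simp at hn
      | succ n =>
        refine tendsto_const_nhds.congr' ?_
        filter_upwards [eventually_ge_atTop n] with m hm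
        have h4 : runMax T G n (T x) ≤ runMax T G m (T x) :=
          monotone_nat_of_le_succ (fun k => runMax_le_succ k (T x)) hm
        have h5 : 0 ≤ runMax T G m (T x) := by
          linarith [birkhoffSum_le_runMax (T := T) (G := G) n (T x)]
        simp only [runMax]
        rw [max_eq_right h5]
        ring
  exact ge_of_tendsto' h3 h1

lemma measurable_birkhoffSum (hT : Measurable T) (hG : Measurable G) (n : ℕ) :
    Measurable (birkhoffSum T G n) :=
  Finset.measurable_sum _ fun k _ => hG.comp (hT.iterate k)

/-- The set where the sums are unbounded above is invariant, hence null or of full measure; full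
measure would contradict the maximal inequality. -/
lemma ae_bddAbove_birkhoffSum_of_measurable (hT : Ergodic T μ) (hGm : Measurable G)
    (hG : Integrable G μ) (hneg : ∫ x, G x ∂μ < 0) :
    ∀ᵐ x ∂μ, ∃ K : ℕ, ∀ n, birkhoffSum T G n x ≤ K := by
  set s : Set α := {x | ∀ K : ℕ, ∃ n, (K : ℝ) < birkhoffSum T G n x} with hs
  have hsm : MeasurableSet s := by
    rw [hs]
    simp only [Set.ofPred_forall, Set.ofPred_exists]
    exact MeasurableSet.iInter fun K => MeasurableSet.iUnion fun n =>
      measurableSet_lt measurable_const (measurable_birkhoffSum hT.measurable hGm n)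
  have hinv : T ⁻¹' s = s := by
    ext x
    simp only [hs, Set.mem_preimage, Set.mem_ofPred_eq]
    constructor
    · intro hx K
      obtain ⟨m, hm⟩ := exists_nat_ge ((K : ℝ) - G x)
      obtain ⟨n, hn⟩ := hx m
      exact ⟨n + 1, by rw [birkhoffSum_succ']; linarith⟩
    · intro hx K
      obtain ⟨m, hm⟩ := exists_nat_ge ((K : ℝ) + G x)
      obtain ⟨n, hn⟩ := hx m
      cases n with
      | zero =>
        rw [birkhoffSum_zero] at hn
        exact absurd hn (not_lt.2 (Nat.cast_nonneg m))
      | succ n => exact ⟨n, by rw [birkhoffSum_succ'] at hn; linarith⟩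
  rcases hT.ae_mem_or_ae_notMem hsm hinv with h1 | h1
  · exact absurd (integral_nonneg_of_unbounded hT.toMeasurePreserving hG h1) (not_le.2 hneg)
  · filter_upwards [h1] with x hx
    simpa only [hs, Set.mem_ofPred_eq, not_forall, not_exists, not_lt] using hx

lemma ae_bddAbove_birkhoffSum (hT : Ergodic T μ)
    (hG : Integrable G μ) (hneg : ∫ x, G x ∂μ < 0) :
    ∀ᵐ x ∂μ, ∃ K : ℕ, ∀ n, birkhoffSum T G n x ≤ K := by
  have hae := hG.aestronglyMeasurable.ae_eq_mk
  have h1 := ae_bddAbove_birkhoffSum_of_measurable hT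
    hG.aestronglyMeasurable.stronglyMeasurable_mk.measurable (hG.congr hae)
    (by rwa [integral_congr_ae hae] at hneg)
  have h2 := ae_all_iff.2 fun n =>
    hT.toMeasurePreserving.quasiMeasurePreserving.birkhoffSum_ae_eq_of_ae_eq hae n
  filter_upwards [h1, h2] with x ⟨K, hK⟩ hx2
  exact ⟨K, fun n => by rw [hx2 n]; exact hK n⟩

/-- One-sided control of the Birkhoff sums. -/
lemma ae_birkhoffSum_le [IsProbabilityMeasure μ] (hT : Ergodic T μ) (hG : Integrable G μ) :
    ∀ᵐ x ∂μ, ∀ ε > (0 : ℝ), ∃ K : ℝ, ∀ n : ℕ,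
      birkhoffSum T G n x ≤ n * (∫ x, G x ∂μ + ε) + K := by
  have h1 : ∀ m : ℕ, ∀ᵐ x ∂μ, ∃ K : ℕ, ∀ n : ℕ,
      birkhoffSum T (fun x => G x - (∫ x, G x ∂μ + 1 / ((m : ℝ) + 1))) n x ≤ K := by
    intro m
    refine ae_bddAbove_birkhoffSum hT (hG.sub (integrable_const _)) ?_
    rw [integral_sub hG (integrable_const _)]
    simp only [integral_const, probReal_univ, one_smul]
    have : (0 : ℝ) < 1 / ((m : ℝ) + 1) := by positivity
    linarith
  filter_upwards [ae_all_iff.2 h1] with x hx ε hε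
  obtain ⟨m, hm⟩ := exists_nat_one_div_lt hε
  obtain ⟨K, hK⟩ := hx m
  refine ⟨K, fun n => ?_⟩
  have h2 := hK n
  rw [birkhoffSum_sub_const] at h2
  have h3 : (n : ℝ) * (∫ x, G x ∂μ + 1 / ((m : ℝ) + 1)) ≤ n * (∫ x, G x ∂μ + ε) := by gcongr
  linarith

/-- Two-sided control of the Birkhoff sums: the pointwise ergodic theorem. -/
lemma ae_abs_birkhoffSum_sub_le [IsProbabilityMeasure μ] (hT : Ergodic T μ)
    (hG : Integrable G μ) :
    ∀ᵐ x ∂μ, ∀ ε > (0 : ℝ), ∃ K : ℝ, ∀ n : ℕ,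
      |birkhoffSum T G n x - n * ∫ x, G x ∂μ| ≤ n * ε + K := by
  filter_upwards [ae_birkhoffSum_le hT hG, ae_birkhoffSum_le hT hG.neg] with x h1 h2 ε hε
  obtain ⟨K₁, hK₁⟩ := h1 ε hε
  obtain ⟨K₂, hK₂⟩ := h2 ε hε
  refine ⟨max K₁ K₂, fun n => abs_le.2 ⟨?_, ?_⟩⟩
  · have h3 := hK₂ n
    rw [birkhoffSum_neg] at h3
    simp only [Pi.neg_apply, integral_neg] at h3
    have := le_max_right K₁ K₂
    linarith
  · have h3 := hK₁ n
    have := le_max_left K₁ K₂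
    linarith

/-- Averages over windows `(a n, b n]` whose lengths are comparable with their endpoints. -/
structure IsWindow (a b : ℕ → ℕ) (C : ℝ) : Prop where
  le : ∀ n, a n ≤ b n
  tendsto : Tendsto (fun n => b n - a n) atTop atTop
  le_mul : ∀ᶠ n in atTop, (b n : ℝ) ≤ C * ((b n : ℝ) - a n)

lemma IsWindow.tendsto_real {a b : ℕ → ℕ} {C : ℝ} (hw : IsWindow a b C) :
    Tendsto (fun n => (b n : ℝ) - a n) atTop atTop := by
  refine (tendsto_natCast_atTop_atTop.comp hw.tendsto).congr fun n => ?_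
  simp [Nat.cast_sub (hw.le n)]

/-- A window sum is a difference of two Birkhoff sums, each with an error of small slope in b n, and
b n is comparable with the window length. The null set is fixed before the windows are chosen. -/
lemma ae_window_average [IsProbabilityMeasure μ] (hT : Ergodic T μ) (hG : Integrable G μ) :
    ∀ᵐ x ∂μ, ∀ (a b : ℕ → ℕ) (C : ℝ), IsWindow a b C → ∀ ε > (0 : ℝ), ∀ᶠ n in atTop,
      |∑ t ∈ Finset.Ioc (a n) (b n), G (T^[t] x) - ((b n : ℝ) - a n) * ∫ x, G x ∂μ| ≤
        ((b n : ℝ) - a n) * ε := by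
  filter_upwards [ae_abs_birkhoffSum_sub_le hT hG] with x hx a b C hw ε hε
  set C' := max C 1
  have hC' : 0 < C' := lt_of_lt_of_le one_pos (le_max_right _ _)
  -- The two endpoints together use ε / 2 of the slope. The other half absorbs the constant `D`,
  -- once the window is long enough.
  obtain ⟨K, hK⟩ := hx (ε / (4 * C')) (by positivity)
  set D := 2 * (ε / (4 * C') + K)
  filter_upwards [hw.le_mul, hw.tendsto_real.eventually_ge_atTop (2 * D / ε)] with n h1 h2
  rw [sum_Ioc_eq_birkhoffSum_sub (hw.le n)]
  have h3 := hK (b n + 1)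
  have h4 := hK (a n + 1)
  push_cast at h3 h4
  have hab : (a n : ℝ) ≤ b n := by exact_mod_cast hw.le n
  have h5 : (b n : ℝ) ≤ C' * ((b n : ℝ) - a n) :=
    h1.trans (mul_le_mul_of_nonneg_right (le_max_left _ _) (by linarith))
  set m := (b n : ℝ) - a n
  set κ := ε / (4 * C') with hκ
  have hκ0 : 0 < κ := by positivity
  have h6 : (b n : ℝ) * κ ≤ m * (ε / 4) := by
    calc (b n : ℝ) * κ ≤ C' * m * κ := by gcongr
      _ = m * (ε / 4) := by rw [hκ]; field_simp
  have h7 : (a n : ℝ) * κ ≤ (b n : ℝ) * κ := by gcongr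
  have h8 : 2 * D ≤ m * ε := by rwa [div_le_iff₀ hε] at h2
  rw [abs_le] at h3 h4 ⊢
  have hm : m = (b n : ℝ) - a n := rfl
  rw [hm] at h6 h8 ⊢
  constructor <;> nlinarith [h3.1, h3.2, h4.1, h4.2]

/-- G along the orbit is the increment of the Birkhoff sums, whose deviation from a line has
arbitrarily small slope. -/
lemma ae_abs_iterate_le [IsProbabilityMeasure μ] (hT : Ergodic T μ) (hG : Integrable G μ) :
    ∀ᵐ x ∂μ, ∀ ε > (0 : ℝ), ∃ K : ℝ, ∀ n : ℕ, |G (T^[n] x)| ≤ n * ε + K := by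
  filter_upwards [ae_abs_birkhoffSum_sub_le hT hG] with x hx ε hε
  obtain ⟨K, hK⟩ := hx (ε / 2) (by positivity)
  refine ⟨2 * K + ε / 2 + |∫ x, G x ∂μ|, fun n => ?_⟩
  have h1 := hK (n + 1)
  have h2 := hK n
  rw [birkhoffSum_succ] at h1
  push_cast at h1
  rw [abs_le] at h1 h2 ⊢
  have h3 := le_abs_self (∫ x, G x ∂μ)
  have h4 := neg_abs_le (∫ x, G x ∂μ)
  constructor <;> nlinarith [h1.1, h1.2, h2.1, h2.2]

end Birkhoff

end CountSeries
end

noncomputable section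

namespace CountSeries

/-! ### From a stationary solution to the law of its observed path -/

lemma measurable_meanInv {h : ℕ → ℝ} (hh : IsBase h) : Measurable (meanInv h) := by
  classical
  -- Off the range of the mean function, `Function.invFunOn` returns one fixed default value.
  have : meanInv h = (meanRange h).piecewise (meanInv h) fun _ => Classical.choice ⟨0⟩ := by
    ext x
    by_cases hx : x ∈ meanRange h
    · rw [Set.piecewise_eq_of_mem _ _ _ hx]
    · rw [Set.piecewise_eq_of_notMem _ _ _ hx]
      exact Function.invFunOn_neg hx
  rw [this]
  exact ContinuousOn.measurable_piecewise
    (fun x hx => (contDiffAt_meanInv hh hx one_ne_zero).continuousAt.continuousWithinAt)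
    continuousOn_const (isOpen_meanRange hh).measurableSet

lemma measurable_law {h : ℕ → ℝ} (hh : IsBase h) (k : ℕ) : Measurable fun x => law h x k := by
  classical
  have : (fun x => law h x k) = (meanRange h).piecewise (fun x => law h x k)
      fun _ => density h (Classical.choice ⟨0⟩) k := by
    ext x
    by_cases hx : x ∈ meanRange h
    · rw [Set.piecewise_eq_of_mem _ _ _ hx]
    · rw [Set.piecewise_eq_of_notMem _ _ _ hx, law, meanInv, Function.invFunOn_neg hx]
  rw [this]
  exact ContinuousOn.measurable_piecewise (continuousOn_law hh k)
    continuousOn_const (isOpen_meanRange hh).measurableSet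

lemma measurable_coord (t : ℤ) : Measurable fun y : Path => (y t : ℝ) :=
  (measurable_from_nat (f := fun k : ℕ => (k : ℝ))).comp
    (measurable_pi_apply (X := fun _ : ℤ => ℕ) t)

/-- The law of the observed process under a stationary solution with parameter `θ₀`: it is
shift invariant, its paths have admissible pasts, and given the past the next observation has the
law of the exponential family with mean `fInf f θ₀` of the past. -/
structure IsRegime {d : ℕ} (h : ℕ → ℝ) (f : Param d → ℝ → ℕ → ℝ) (θ₀ : Param d)
    (μ : Measure Path) : Prop where
  prob : IsProbabilityMeasure μ
  shift : MeasurePreserving shift μ μ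
  admissible : ∀ᵐ y ∂μ, past y ∈ admissible h
  integrable : Integrable (fun y : Path => (y 0 : ℝ)) μ
  disintegration : ∀ (k : ℕ) (w : (ℕ → ℕ) → ENNReal), Measurable w →
    ∫⁻ y in {y : Path | y 0 = k}, w (past y) ∂μ =
      ∫⁻ y, ENNReal.ofReal (law h (fInf f θ₀ (past y)) k) * w (past y) ∂μ

section Extraction

variable {Ω : Type*} [MeasurableSpace Ω] {P : Measure Ω}

/-- By Tonelli the sum has expectation at most a convergent geometric series, so it is almost surely
finite. -/
lemma ae_summable_geometric_mul {Z : ℕ → Ω → ℝ} (hZ : ∀ k, AEMeasurable (Z k) P)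
    (hZ0 : ∀ k, ∀ᵐ ω ∂P, 0 ≤ Z k ω) {c : ENNReal} (hc : c ≠ ⊤)
    (hZc : ∀ k, ∫⁻ ω, ENNReal.ofReal (Z k ω) ∂P ≤ c) {r : ℝ} (hr0 : 0 ≤ r) (hr1 : r < 1) :
    ∀ᵐ ω ∂P, Summable fun k => r ^ k * Z k ω := by
  have h1 : ∫⁻ ω, ∑' k, ENNReal.ofReal (r ^ k * Z k ω) ∂P ≠ ⊤ := by
    rw [lintegral_tsum fun k => ((hZ k).const_mul _).ennreal_ofReal]
    have h2 : ∀ k, ∫⁻ ω, ENNReal.ofReal (r ^ k * Z k ω) ∂P ≤ ENNReal.ofReal r ^ k * c := by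
      intro k
      simp_rw [ENNReal.ofReal_mul (pow_nonneg hr0 k), ENNReal.ofReal_pow hr0]
      rw [lintegral_const_mul'' _ (hZ k).ennreal_ofReal]
      gcongr
      exact hZc k
    refine ne_top_of_le_ne_top ?_ (ENNReal.tsum_le_tsum h2)
    rw [ENNReal.tsum_mul_right, ENNReal.tsum_geometric]
    refine ENNReal.mul_ne_top (ENNReal.inv_ne_top.2 ?_) hc
    rw [ne_eq, tsub_eq_zero_iff_le, not_le]
    exact ENNReal.ofReal_lt_one.2 hr1
  have h3 := ae_lt_top' (AEMeasurable.tsum fun k => ((hZ k).const_mul _).ennreal_ofReal) h1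
  filter_upwards [h3, ae_all_iff.2 hZ0] with ω h4 h5
  have h6 := ENNReal.summable_toReal h4.ne
  refine h6.congr fun k => ?_
  rw [ENNReal.toReal_ofReal (mul_nonneg (pow_nonneg hr0 k) (h5 k))]

/-- The observed path. -/
def pathOf (Y : ℤ → Ω → ℕ) (ω : Ω) : Path := fun t => Y t ω

variable {d : ℕ} {h : ℕ → ℝ} {f : Param d → ℝ → ℕ → ℝ} {Θ : Set (Param d)} {δ₁ δ₂ : ℝ}
  {θ₀ : Param d} {X : ℤ → Ω → ℝ} {Y : ℤ → Ω → ℕ}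

lemma IsStationarySolution.measurable_pathOf (hs : IsStationarySolution P h f θ₀ X Y) :
    Measurable (pathOf Y) := measurable_pi_lambda _ hs.measurable_Y

lemma IsStationarySolution.map_shift (hs : IsStationarySolution P h f θ₀ X Y) :
    (P.map (pathOf Y)).map CountSeries.shift = P.map (pathOf Y) := by
  rw [Measure.map_map measurable_shift hs.measurable_pathOf]
  have hm : Measurable fun (z : ℤ → ℝ × ℕ) (t : ℤ) => (z t).2 := by fun_prop
  have h1 : Measurable fun ω (t : ℤ) => (X t ω, Y t ω) :=
    measurable_pi_lambda _ fun t => (hs.measurable_X t).prodMk (hs.measurable_Y t)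
  have h2 : Measurable fun ω (t : ℤ) => (X (t + 1) ω, Y (t + 1) ω) :=
    measurable_pi_lambda _ fun t => (hs.measurable_X _).prodMk (hs.measurable_Y _)
  have := congrArg (Measure.map fun (z : ℤ → ℝ × ℕ) (t : ℤ) => (z t).2) hs.stationary
  rw [Measure.map_map hm h1, Measure.map_map hm h2] at this
  exact this

lemma IsStationarySolution.lintegral_eq (hs : IsStationarySolution P h f θ₀ X Y) (k : ℕ) :
    ∫⁻ ω, ENNReal.ofReal (Y (-k) ω) ∂P = ∫⁻ ω, ENNReal.ofReal (Y 0 ω) ∂P := by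
  have h1 : ∀ t : ℤ, ∫⁻ ω, ENNReal.ofReal (Y t ω) ∂P =
      ∫⁻ y, ENNReal.ofReal (y t) ∂(P.map (pathOf Y)) := by
    intro t
    rw [lintegral_map (by fun_prop) hs.measurable_pathOf]
    rfl
  have h2 : ∀ t : ℤ, ∫⁻ y, ENNReal.ofReal (y t) ∂(P.map (pathOf Y)) =
      ∫⁻ y, ENNReal.ofReal (y (t + 1)) ∂(P.map (pathOf Y)) := by
    intro t
    conv_lhs => rw [← hs.map_shift]
    rw [lintegral_map (by fun_prop) measurable_shift]
    rfl
  induction k with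
  | zero => simp
  | succ k ih =>
    rw [← ih, h1, h1, h2]
    congr! 5
    push_cast
    ring

lemma pastSigma_le (hs : IsStationarySolution P h f θ₀ X Y) (t : ℤ) :
    pastSigma X Y t ≤ ‹MeasurableSpace Ω› :=
  iSup_le fun s => sup_le (hs.measurable_X s).comap_le (hs.measurable_Y s).comap_le

variable [IsProbabilityMeasure P]

lemma IsStationarySolution.measure_inter (hs : IsStationarySolution P h f θ₀ X Y) (t : ℤ) (k : ℕ)
    {F : Set Ω} (hF : MeasurableSet[pastSigma X Y t] F) :
    P ({ω | Y t ω = k} ∩ F) = ∫⁻ ω in F, ENNReal.ofReal (law h (X t ω) k) ∂P := by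
  have hm := pastSigma_le hs t
  have hA : MeasurableSet {ω | Y t ω = k} := hs.measurable_Y t (measurableSet_singleton k)
  have hi : Integrable (Set.indicator {ω | Y t ω = k} fun _ => (1 : ℝ)) P :=
    (integrable_const 1).indicator hA
  have hl : Integrable (fun ω => law h (X t ω) k) P :=
    (integrable_condExp (m := pastSigma X Y t)).congr (hs.condLaw t k)
  have h1 := setIntegral_condExp hm hi hF
  rw [setIntegral_congr_ae (hm F hF) ((hs.condLaw t k).mono fun ω hω _ => hω),
    integral_indicator hA, Measure.restrict_restrict hA] at h1
  simp only [integral_const, smul_eq_mul, mul_one] at h1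
  have hn : 0 ≤ᵐ[P] fun ω => law h (X t ω) k := by
    have := condExp_nonneg (μ := P) (m := pastSigma X Y t)
      (f := Set.indicator {ω | Y t ω = k} fun _ => (1 : ℝ))
      (ae_of_all _ fun ω => Set.indicator_nonneg (fun _ _ => zero_le_one) ω)
    filter_upwards [this, hs.condLaw t k] with ω h1 h2
    rw [h2] at h1
    exact h1
  rw [← ofReal_integral_eq_lintegral_ofReal hl.integrableOn (ae_restrict_of_ae hn)]
  have h2 : ∫ ω in F, law h (X t ω) k ∂P =
      (P.restrict ({ω | Y t ω = k} ∩ F)).real Set.univ := h1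
  rw [h2, Measure.real, ENNReal.ofReal_toReal (measure_ne_top _ _), Measure.restrict_apply_univ]

lemma IsStationarySolution.ae_pos (hh : IsBase h) (hs : IsStationarySolution P h f θ₀ X Y) (t : ℤ) :
    ∀ᵐ ω ∂P, 0 < h (Y t ω) := by
  have h1 : ∀ k : ℕ, ∀ᵐ ω ∂P, h k = 0 → Y t ω ≠ k := by
    intro k
    by_cases hk : h k = 0
    · have := hs.measure_inter t k MeasurableSet.univ
      simp only [law_eq_zero hk, ENNReal.ofReal_zero, lintegral_zero, Set.inter_univ] at this
      filter_upwards [measure_eq_zero_iff_ae_notMem.1 this] with ω hω _ using hω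
    · exact ae_of_all _ fun ω h2 => absurd h2 hk
  filter_upwards [ae_all_iff.2 h1] with ω hω
  exact (hh.nonneg _).lt_of_ne fun h2 => hω _ h2.symm rfl

lemma IsStationarySolution.ae_admissible (hh : IsBase h)
    (hs : IsStationarySolution P h f θ₀ X Y) :
    ∀ᵐ ω ∂P, past (pathOf Y ω) ∈ admissible h := by
  -- Countably many rates suffice, since summability at one rate implies it at every smaller rate.
  have h1 : ∀ m : ℕ, ∀ᵐ ω ∂P, Summable fun k : ℕ =>
      ((m : ℝ) / (m + 1)) ^ k * (Y (-1 - k) ω : ℝ) := by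
    intro m
    refine ae_summable_geometric_mul (c := ∫⁻ ω, ENNReal.ofReal (Y 0 ω) ∂P)
      (fun k => ?_) (fun k => ae_of_all _ fun ω => Nat.cast_nonneg _) ?_ (fun k => ?_)
      (by positivity) ?_
    · exact (measurable_from_nat.comp (hs.measurable_Y _)).aemeasurable
    · exact (hs.integrable 0).lintegral_lt_top.ne
    · refine ((hs.lintegral_eq (k + 1)).le.trans_eq' ?_)
      congr! 5
      push_cast
      ring
    · rw [div_lt_one (by positivity)]
      linarith
  filter_upwards [ae_all_iff.2 h1, ae_all_iff.2 fun k : ℕ => hs.ae_pos hh (-1 - k)] with ω h2 h3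
  refine ⟨h3, fun r hr0 hr1 => ?_⟩
  obtain ⟨m, hm⟩ := exists_nat_one_div_lt (sub_pos.2 hr1)
  refine Summable.of_nonneg_of_le
    (fun k => mul_nonneg (pow_nonneg hr0 k) (Nat.cast_nonneg _)) (fun k => ?_) (h2 m)
  refine mul_le_mul_of_nonneg_right (pow_le_pow_left₀ hr0 ?_ k) (Nat.cast_nonneg _)
  have : (m : ℝ) / (m + 1) = 1 - 1 / (m + 1) := by field_simp; ring
  linarith

/-- Running the recursion k steps from 0 instead of from the true value costs at most δ₁ ^ k times
the conditional mean k steps back. These conditional means all have expectation E Y₀, so the errors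
are almost surely summable. -/
lemma IsStationarySolution.ae_eq_fInf (hh : IsBase h) (hc : IsContractive f Θ δ₁ δ₂)
    (hθ : θ₀ ∈ Θ) (hs : IsStationarySolution P h f θ₀ X Y) :
    ∀ᵐ ω ∂P, X 0 ω = fInf f θ₀ (past (pathOf Y ω)) := by
  have hX0 : ∀ t, ∀ᵐ ω ∂P, 0 ≤ X t ω := fun t =>
    (hs.mem_range t).mono fun ω hω => meanRange_nonneg hh hω
  have h1 : ∀ᵐ ω ∂P, Summable fun k : ℕ => δ₁ ^ k * X (-k) ω := by
    refine ae_summable_geometric_mul (c := ∫⁻ ω, ENNReal.ofReal (Y 0 ω) ∂P)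
      (fun k => (hs.measurable_X _).aemeasurable) (fun k => hX0 _) ?_ (fun k => ?_)
      hc.fst_nonneg hc.fst_lt_one
    · exact (hs.integrable 0).lintegral_lt_top.ne
    · have hXi : Integrable (X (-k)) P :=
        (integrable_condExp (m := pastSigma X Y (-k))).congr (hs.condMean (-k))
      rw [← hs.lintegral_eq k, ← ofReal_integral_eq_lintegral_ofReal hXi (hX0 _),
        ← ofReal_integral_eq_lintegral_ofReal (hs.integrable _)
          (ae_of_all _ fun ω => Nat.cast_nonneg _),
        ← integral_congr_ae (hs.condMean (-k)), integral_condExp (pastSigma_le hs (-k))]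
  filter_upwards [h1, hs.ae_admissible hh, ae_all_iff.2 hX0, ae_all_iff.2 hs.recursion]
    with ω h2 hadm hX hrec
  have h3 : ∀ (k : ℕ) (t : ℤ),
      |X t ω - backIter f θ₀ k fun i => Y (t - 1 - i) ω| ≤ δ₁ ^ k * X (t - k) ω := by
    intro k
    induction k with
    | zero => intro t; simp [backIter, abs_of_nonneg (hX t)]
    | succ k ih =>
      intro t
      have h4 := ih (t - 1)
      have h5 := hc.lip θ₀ hθ (X (t - 1) ω) _ (hX _)
        (backIter_nonneg hc hθ k fun i => Y (t - 1 - 1 - i) ω) (Y (t - 1) ω) (Y (t - 1) ω)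
      rw [sub_self, abs_zero, mul_zero, add_zero, ← hrec t] at h5
      have h6 := mul_le_mul_of_nonneg_left h4 hc.fst_nonneg
      have h7 : backIter f θ₀ (k + 1) (fun i : ℕ => Y (t - 1 - i) ω) =
          f θ₀ (backIter f θ₀ k fun i : ℕ => Y (t - 1 - 1 - i) ω) (Y (t - 1) ω) := by
        rw [backIter]
        congr 1
        · congr 1
          ext i
          congr 1
          push_cast
          ring
        · simp
      rw [h7]
      refine h5.trans (h6.trans_eq ?_)
      rw [pow_succ]
      push_cast
      rw [show t - 1 - (k : ℤ) = t - (k + 1) by ring]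
      ring
  have h8 : Tendsto (fun k => backIter f θ₀ k (past (pathOf Y ω))) atTop (𝓝 (X 0 ω)) := by
    rw [tendsto_iff_dist_tendsto_zero]
    refine squeeze_zero (fun _ => dist_nonneg) (fun k => ?_) h2.tendsto_atTop_zero
    have := h3 k 0
    rw [dist_comm, Real.dist_eq]
    have h9 : past (pathOf Y ω) = fun i : ℕ => Y (0 - 1 - (i : ℤ)) ω := by
      ext i; simp [past, pathOf]
    rw [h9, ← zero_sub]
    exact this
  exact tendsto_nhds_unique h8 (tendsto_backIter hc hθ hadm)

/-- From here on everything depends only on the law of the observations: the latent mean has become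
a function of the observed past. -/
lemma IsStationarySolution.isRegime (hh : IsBase h) (hc : IsContractive f Θ δ₁ δ₂)
    (hθ : θ₀ ∈ Θ) (hs : IsStationarySolution P h f θ₀ X Y) :
    IsRegime h f θ₀ (P.map (pathOf Y)) := by
  have hY := hs.measurable_pathOf
  have hset : ∀ k : ℕ, MeasurableSet {y : Path | y 0 = k} := fun k =>
    measurable_pi_apply (X := fun _ : ℤ => ℕ) 0 (measurableSet_singleton k)
  refine ⟨Measure.isProbabilityMeasure_map hY.aemeasurable, ⟨measurable_shift, hs.map_shift⟩,
    ?_, ?_, ?_⟩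
  · have h1 := hs.ae_admissible hh
    have hm : MeasurableSet {y : Path | past y ∈ CountSeries.admissible h} := by
      refine measurable_past ?_
      have : CountSeries.admissible h = (⋂ k, {p : ℕ → ℕ | 0 < h (p k)}) ∩
          ⋂ m : ℕ, {p : ℕ → ℕ | ∑' k, ENNReal.ofReal (((m : ℝ) / (m + 1)) ^ k * (p k : ℝ)) < ⊤} := by
        ext p
        simp only [CountSeries.admissible, Set.mem_inter_iff, Set.mem_iInter, Set.mem_ofPred_eq]
        refine and_congr_right fun _ => ⟨fun hp m => ?_, fun hp r hr0 hr1 => ?_⟩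
        · refine Summable.tsum_ofReal_lt_top (hp _ (by positivity) ?_)
          rw [div_lt_one (by positivity)]
          linarith
        · obtain ⟨m, hm⟩ := exists_nat_one_div_lt (sub_pos.2 hr1)
          have h3 := ENNReal.summable_toReal (hp m).ne
          refine Summable.of_nonneg_of_le
            (fun k => mul_nonneg (pow_nonneg hr0 k) (Nat.cast_nonneg _)) (fun k => ?_) h3
          rw [ENNReal.toReal_ofReal (by positivity)]
          refine mul_le_mul_of_nonneg_right (pow_le_pow_left₀ hr0 ?_ k) (Nat.cast_nonneg _)
          have : (m : ℝ) / (m + 1) = 1 - 1 / (m + 1) := by field_simp; ring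
          linarith
      rw [this]
      refine (MeasurableSet.iInter fun k => ?_).inter (MeasurableSet.iInter fun m => ?_)
      · exact measurableSet_lt measurable_const
          ((measurable_from_nat (f := h)).comp (measurable_pi_apply k))
      · exact measurableSet_lt (by fun_prop) measurable_const
    exact (ae_map_iff hY.aemeasurable hm).2 h1
  · exact (integrable_map_measure (measurable_coord 0).aestronglyMeasurable hY.aemeasurable).2
      (hs.integrable 0)
  · intro k w hw
    have hm := pastSigma_le hs 0
    have hwm : Measurable[pastSigma X Y 0] fun ω => w (past (pathOf Y ω)) := by
      refine hw.comp (@measurable_pi_lambda _ _ _ (pastSigma X Y 0) _ _ fun i => ?_)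
      have h1 : MeasurableSpace.comap (Y (-1 - (i : ℤ))) inferInstance ≤ pastSigma X Y 0 :=
        le_sup_right.trans (le_iSup (fun s : {s : ℤ // s < 0} =>
          (MeasurableSpace.comap (X s) inferInstance ⊔ MeasurableSpace.comap (Y s) inferInstance))
          ⟨-1 - (i : ℤ), by omega⟩)
      exact (comap_measurable (Y (-1 - (i : ℤ)))).mono h1 le_rfl
    have hlaw : Measurable fun ω => ENNReal.ofReal (law h (X 0 ω) k) :=
      ((measurable_law hh k).comp (hs.measurable_X 0)).ennreal_ofReal
    have hA : MeasurableSet {ω | Y 0 ω = k} := hs.measurable_Y 0 (measurableSet_singleton k)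
    -- The conditional law, integrated over past events, says that two measures agree on the past
    -- σ-field. Integrating a function measurable for that field passes from events to weights.
    have htrim : (P.restrict {ω | Y 0 ω = k}).trim hm =
        (P.withDensity fun ω => ENNReal.ofReal (law h (X 0 ω) k)).trim hm := by
      refine @Measure.ext _ (pastSigma X Y 0) _ _ fun F hF => ?_
      rw [trim_measurableSet_eq hm hF, trim_measurableSet_eq hm hF,
        withDensity_apply _ (hm F hF), ← hs.measure_inter 0 k hF,
        Measure.restrict_apply (hm F hF), Set.inter_comm]
    have h1 : ∫⁻ ω in {ω | Y 0 ω = k}, w (past (pathOf Y ω)) ∂P =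
        ∫⁻ ω, ENNReal.ofReal (law h (X 0 ω) k) * w (past (pathOf Y ω)) ∂P := by
      rw [← lintegral_trim hm hwm, htrim, lintegral_trim hm hwm,
        lintegral_withDensity_eq_lintegral_mul _ hlaw (hwm.mono hm le_rfl)]
      rfl
    have h2 : ∫⁻ y in {y : Path | y 0 = k}, w (past y) ∂(P.map (pathOf Y)) =
        ∫⁻ ω in {ω | Y 0 ω = k}, w (past (pathOf Y ω)) ∂P :=
      setLIntegral_map (hset k) (hw.comp measurable_past) hY
    rw [h2, lintegral_map _ hY]
    · refine Eq.trans h1 (lintegral_congr_ae ?_)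
      filter_upwards [hs.ae_eq_fInf hh hc hθ] with ω hω
      rw [hω]
    · exact (((measurable_law hh k).comp ((measurable_fInf f θ₀).comp
        measurable_past)).ennreal_ofReal).mul (hw.comp measurable_past)

end Extraction

end CountSeries
end

noncomputable section

namespace CountSeries

/-! ### Ergodicity -/

section Ergodicity

variable {d : ℕ} {h : ℕ → ℝ} {f : Param d → ℝ → ℕ → ℝ} {Θ : Set (Param d)} {δ₁ δ₂ : ℝ}
  {θ₀ : Param d} {μ : Measure Path}

/-- The conditional probability, given the past, that the next `n` observations lie in
`B 0, …, B (n - 1)`. -/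
def cylProb (h : ℕ → ℝ) (f : Param d → ℝ → ℕ → ℝ) (θ₀ : Param d) :
    ℕ → (ℕ → Set ℕ) → (ℕ → ℕ) → ℝ
  | 0, _, _ => 1
  | n + 1, B, p => ∑' k, law h (fInf f θ₀ p) k *
      ((B 0).indicator 1 k * cylProb h f θ₀ n (fun i => B (i + 1)) (cons k p))

lemma measurable_cylProb (hh : IsBase h) (n : ℕ) (B : ℕ → Set ℕ) :
    Measurable (cylProb h f θ₀ n B) := by
  induction n generalizing B with
  | zero => exact measurable_const
  | succ n ih =>
    refine Measurable.tsum fun k => ?_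
    exact ((measurable_law hh k).comp (measurable_fInf f θ₀)).mul
      (measurable_const.mul ((ih _).comp (measurable_cons k)))

/-- Distinct integers are at distance at least one, so a jump of the indicator costs at most one
Lipschitz unit. An unconstrained step costs nothing and allows β = 0. -/
lemma abs_indicator_mul_sub_le {B : Set ℕ} {c c' L β : ℝ} {k k' : ℕ} (hc0 : 0 ≤ c) (hc1 : c ≤ 1)
    (hc0' : 0 ≤ c') (hc1' : c' ≤ 1) (hcc : |c - c'| ≤ L * |(k : ℝ) - k'|) (hβ : 0 ≤ β)
    (hB : B = Set.univ ∨ 1 ≤ β) :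
    |B.indicator 1 k * c - B.indicator 1 k' * c'| ≤ (L + β) * |(k : ℝ) - k'| := by
  rcases eq_or_ne k k' with rfl | hne
  · simp only [sub_self, abs_zero, mul_zero] at hcc ⊢
    have : c = c' := sub_eq_zero.1 (abs_nonpos_iff.1 hcc)
    simp [this]
  have h1 : (1 : ℝ) ≤ |(k : ℝ) - k'| := by
    have : (1 : ℤ) ≤ |(k : ℤ) - k'| := Int.one_le_abs (by omega)
    exact_mod_cast this
  have h2 : 0 ≤ L * |(k : ℝ) - k'| := (abs_nonneg _).trans hcc
  have h3 : |B.indicator 1 k * c - B.indicator 1 k' * c'| ≤ L * |(k : ℝ) - k'| ∨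
      (1 ≤ β ∧ |B.indicator 1 k * c - B.indicator 1 k' * c'| ≤ 1) := by
    by_cases hk : k ∈ B <;> by_cases hk' : k' ∈ B
    · left; simpa [hk, hk'] using hcc
    · right
      refine ⟨hB.resolve_left fun hu => hk' (hu ▸ Set.mem_univ _), ?_⟩
      simpa [hk, hk', abs_of_nonneg hc0] using hc1
    · right
      refine ⟨hB.resolve_left fun hu => hk (hu ▸ Set.mem_univ _), ?_⟩
      simpa [hk, hk', abs_of_nonneg hc0'] using hc1'
    · left; simpa [hk, hk'] using h2
  rcases h3 with h3 | ⟨h4, h3⟩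
  · nlinarith
  · nlinarith

lemma cylProb_mem (hh : IsBase h)
    (hA : ∀ p ∈ admissible h, fInf f θ₀ p ∈ meanRange h) (n : ℕ) (B : ℕ → Set ℕ)
    {p : ℕ → ℕ} (hp : p ∈ admissible h) : cylProb h f θ₀ n B p ∈ Set.Icc (0 : ℝ) 1 := by
  induction n generalizing B p with
  | zero => simp [cylProb]
  | succ n ih =>
    have h1 : ∀ k, law h (fInf f θ₀ p) k *
        ((B 0).indicator 1 k * cylProb h f θ₀ n (fun i => B (i + 1)) (cons k p)) ∈
        Set.Icc 0 (law h (fInf f θ₀ p) k) := by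
      intro k
      rcases (hh.nonneg k).eq_or_lt with hk | hk
      · simp [law_eq_zero hk.symm]
      · have h2 := ih (fun i => B (i + 1)) (admissible_cons hk hp)
        have h3 := law_nonneg hh (fInf f θ₀ p) k
        by_cases hkB : k ∈ B 0
        · simp only [hkB, Set.indicator_of_mem, Pi.one_apply, one_mul]
          exact ⟨mul_nonneg h3 h2.1, mul_le_of_le_one_right h3 h2.2⟩
        · simpa [hkB] using h3
    have hs := hasSum_law hh (hA p hp)
    refine ⟨tsum_nonneg fun k => (h1 k).1, ?_⟩
    exact (Summable.tsum_le_tsum (fun k => (h1 k).2)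
      (Summable.of_nonneg_of_le (fun k => (h1 k).1) (fun k => (h1 k).2) hs.summable)
      hs.summable).trans hs.tsum_eq.le

/-- The past acts in two ways. It changes the law of the next observation, on which the continuation
depends with constant L δ₂ + β; and for a fixed next observation it changes the following mean, with
constant L δ₁. -/
lemma cylProb_succ_lipschitz (hh : IsBase h) (hc : IsContractive f Θ δ₁ δ₂) (hθ : θ₀ ∈ Θ)
    (hA : ∀ p ∈ admissible h, fInf f θ₀ p ∈ meanRange h) {n : ℕ} {B : ℕ → Set ℕ} {L β : ℝ}
    (hL : 0 ≤ L) (hβ : 0 ≤ β) (hB : B 0 = Set.univ ∨ 1 ≤ β)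
    (hn : ∀ p ∈ admissible h, ∀ p' ∈ admissible h,
      |cylProb h f θ₀ n (fun i => B (i + 1)) p - cylProb h f θ₀ n (fun i => B (i + 1)) p'| ≤
        L * |fInf f θ₀ p - fInf f θ₀ p'|) :
    ∀ p ∈ admissible h, ∀ p' ∈ admissible h,
      |cylProb h f θ₀ (n + 1) B p - cylProb h f θ₀ (n + 1) B p'| ≤
        (L * (δ₁ + δ₂) + β) * |fInf f θ₀ p - fInf f θ₀ p'| := by
  intro p hp p' hp'
  set B' : ℕ → Set ℕ := fun i => B (i + 1)
  set g : (ℕ → ℕ) → ℕ → ℝ := fun p k => (B 0).indicator 1 k * cylProb h f θ₀ n B' (cons k p)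
    with hg
  have hmem : ∀ p ∈ admissible h, ∀ k, 0 < h k →
      cylProb h f θ₀ n B' (cons k p) ∈ Set.Icc (0 : ℝ) 1 := fun p hp k hk =>
    cylProb_mem hh hA n B' (admissible_cons hk hp)
  have hlip : ∀ p ∈ admissible h, ∀ k k' : ℕ, 0 < h k → 0 < h k' →
      |g p k - g p k'| ≤ (L * δ₂ + β) * |(k : ℝ) - k'| := by
    intro p hp k k' hk hk'
    refine abs_indicator_mul_sub_le (hmem p hp k hk).1 (hmem p hp k hk).2 (hmem p hp k' hk').1
      (hmem p hp k' hk').2 ?_ hβ hB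
    refine (hn _ (admissible_cons hk hp) _ (admissible_cons hk' hp)).trans ?_
    rw [fInf_cons hc hθ hk hp, fInf_cons hc hθ hk' hp, mul_assoc]
    refine mul_le_mul_of_nonneg_left ?_ hL
    have := hc.lip θ₀ hθ _ _ (fInf_nonneg hc hθ hp) (fInf_nonneg hc hθ hp) k k'
    rwa [sub_self, abs_zero, mul_zero, zero_add] at this
  have hx := hA p hp
  have hx' := hA p' hp'
  have hM : 0 ≤ L * δ₂ + β := add_nonneg (mul_nonneg hL hc.snd_nonneg) hβ
  -- The integrand is kept and the law of the next observation is changed; `h2` changes the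
  -- integrand under a fixed law.
  have h1 := abs_tsum_law_mul_sub_le hh hx hx' hM (hlip p' hp')
  have hs1 := summable_law_mul hh hx hM (hlip p hp)
  have hs2 := summable_law_mul hh hx hM (hlip p' hp')
  have h2 : |∑' k, law h (fInf f θ₀ p) k * g p k - ∑' k, law h (fInf f θ₀ p) k * g p' k| ≤
      L * δ₁ * |fInf f θ₀ p - fInf f θ₀ p'| := by
    have hlaw := (hasSum_law hh hx).mul_left (L * δ₁ * |fInf f θ₀ p - fInf f θ₀ p'|)
    rw [mul_one] at hlaw
    have hterm : ∀ k, |law h (fInf f θ₀ p) k * g p k - law h (fInf f θ₀ p) k * g p' k| ≤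
        L * δ₁ * |fInf f θ₀ p - fInf f θ₀ p'| * law h (fInf f θ₀ p) k := by
      intro k
      rcases (hh.nonneg k).eq_or_lt with hk | hk
      · simp [law_eq_zero hk.symm]
      rw [← mul_sub, abs_mul, abs_of_nonneg (law_nonneg hh _ _), mul_comm]
      refine mul_le_mul_of_nonneg_right ?_ (law_nonneg hh _ _)
      have h3 : |g p k - g p' k| ≤
          |cylProb h f θ₀ n B' (cons k p) - cylProb h f θ₀ n B' (cons k p')| := by
        simp only [hg]
        by_cases hkB : k ∈ B 0 <;> simp [hkB]
      refine h3.trans ((hn _ (admissible_cons hk hp) _ (admissible_cons hk hp')).trans ?_)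
      rw [fInf_cons hc hθ hk hp, fInf_cons hc hθ hk hp', mul_assoc]
      refine mul_le_mul_of_nonneg_left ?_ hL
      have := hc.lip θ₀ hθ _ _ (fInf_nonneg hc hθ hp) (fInf_nonneg hc hθ hp') k k
      rwa [sub_self, abs_zero, mul_zero, add_zero] at this
    rw [← hs1.tsum_sub hs2, abs_le]
    have hd := (hs1.sub hs2).hasSum
    exact ⟨hasSum_le (fun k => (abs_le.1 (hterm k)).1) hlaw.neg hd,
      hasSum_le (fun k => (abs_le.1 (hterm k)).2) hd hlaw⟩
  have h3 := abs_sub_le (∑' k, law h (fInf f θ₀ p) k * g p k)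
    (∑' k, law h (fInf f θ₀ p) k * g p' k) (∑' k, law h (fInf f θ₀ p') k * g p' k)
  simp only [cylProb]
  linarith

lemma cylProb_lipschitz (hh : IsBase h) (hc : IsContractive f Θ δ₁ δ₂) (hθ : θ₀ ∈ Θ)
    (hA : ∀ p ∈ admissible h, fInf f θ₀ p ∈ meanRange h) (n : ℕ) (B : ℕ → Set ℕ) :
    ∀ p ∈ admissible h, ∀ p' ∈ admissible h,
      |cylProb h f θ₀ n B p - cylProb h f θ₀ n B p'| ≤ n * |fInf f θ₀ p - fInf f θ₀ p'| := by
  induction n generalizing B with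
  | zero => intro p _ p' _; simp [cylProb]
  | succ n ih =>
    intro p hp p' hp'
    refine (cylProb_succ_lipschitz hh hc hθ hA (Nat.cast_nonneg n) zero_le_one (Or.inr le_rfl)
      (ih _) p hp p' hp').trans (mul_le_mul_of_nonneg_right ?_ (abs_nonneg _))
    push_cast
    have := mul_le_of_le_one_right (Nat.cast_nonneg (α := ℝ) n) hc.add_lt_one.le
    linarith

/-- Delay a cylinder by `m` unconstrained steps. -/
def delay (m : ℕ) (B : ℕ → Set ℕ) : ℕ → Set ℕ := fun i => if i < m then Set.univ else B (i - m)

lemma delay_zero (B : ℕ → Set ℕ) : delay 0 B = B := by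
  ext i
  simp [delay]

lemma delay_succ (m : ℕ) (B : ℕ → Set ℕ) : (fun i => delay (m + 1) B (i + 1)) = delay m B := by
  ext i
  simp [delay]

/-- With β = 0 at each unconstrained step only the factor δ₁ + δ₂ < 1 remains: probabilities of far
future events forget the past geometrically. -/
lemma cylProb_delay_lipschitz (hh : IsBase h) (hc : IsContractive f Θ δ₁ δ₂) (hθ : θ₀ ∈ Θ)
    (hA : ∀ p ∈ admissible h, fInf f θ₀ p ∈ meanRange h) (n : ℕ) (B : ℕ → Set ℕ) (m : ℕ) :
    ∀ p ∈ admissible h, ∀ p' ∈ admissible h,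
      |cylProb h f θ₀ (n + m) (delay m B) p - cylProb h f θ₀ (n + m) (delay m B) p'| ≤
        n * (δ₁ + δ₂) ^ m * |fInf f θ₀ p - fInf f θ₀ p'| := by
  have hρ : 0 ≤ δ₁ + δ₂ := add_nonneg hc.fst_nonneg hc.snd_nonneg
  induction m with
  | zero => simpa [delay_zero] using cylProb_lipschitz hh hc hθ hA n B
  | succ m ih =>
    intro p hp p' hp'
    refine (cylProb_succ_lipschitz (n := n + m) (B := delay (m + 1) B) hh hc hθ hA
      (L := n * (δ₁ + δ₂) ^ m) (β := 0) (by positivity) le_rfl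
      (Or.inl (by simp [delay])) (by rw [delay_succ]; exact ih) p hp p' hp').trans_eq ?_
    rw [pow_succ]
    ring

lemma measurableSet_cylinder (n : ℕ) (B : ℕ → Set ℕ) :
    MeasurableSet {y : Path | ∀ i < n, y i ∈ B i} := by
  have : {y : Path | ∀ i < n, y i ∈ B i} = ⋂ i, ⋂ (_ : i < n), {y : Path | y (i : ℤ) ∈ B i} := by
    ext y
    simp
  rw [this]
  exact MeasurableSet.iInter fun i => MeasurableSet.iInter fun _ =>
    measurable_pi_apply (X := fun _ : ℤ => ℕ) (i : ℤ) (MeasurableSet.of_discrete (s := B i))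

lemma IsRegime.ae_admissible (hr : IsRegime h f θ₀ μ) :
    ∀ᵐ y ∂μ, ∀ n : ℕ, past (CountSeries.shift^[n] y) ∈ CountSeries.admissible h :=
  ae_all_iff.2 fun n => (hr.shift.iterate n).quasiMeasurePreserving.ae hr.admissible

lemma IsRegime.ae_pos (hr : IsRegime h f θ₀ μ) :
    ∀ᵐ y ∂μ, ∀ n : ℕ, 0 < h (y n) := by
  filter_upwards [hr.ae_admissible] with y hy n
  have := (hy (n + 1)).1 0
  rw [past_iterate_shift] at this
  convert this using 3
  push_cast
  ring

/-- Sum of the disintegration over the value of the next observation. -/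
lemma IsRegime.lintegral_next (hh : IsBase h) (hr : IsRegime h f θ₀ μ)
    {w : ℕ → (ℕ → ℕ) → ENNReal} (hw : ∀ k, Measurable (w k)) :
    ∫⁻ y, w (y 0) (past y) ∂μ =
      ∫⁻ y, ∑' k, ENNReal.ofReal (law h (fInf f θ₀ (past y)) k) * w k (past y) ∂μ := by
  have hset : ∀ k : ℕ, MeasurableSet {y : Path | y 0 = k} := fun k =>
    measurable_pi_apply (X := fun _ : ℤ => ℕ) 0 (measurableSet_singleton k)
  have h1 : ∀ k, Measurable fun y => ENNReal.ofReal (law h (fInf f θ₀ (past y)) k) * w k (past y) :=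
    fun k => (((measurable_law hh k).comp ((measurable_fInf f θ₀).comp
        measurable_past)).ennreal_ofReal).mul ((hw k).comp measurable_past)
  rw [lintegral_tsum fun k => (h1 k).aemeasurable]
  simp_rw [← hr.disintegration _ _ (hw _)]
  have h2 : (⋃ k : ℕ, {y : Path | y 0 = k}) = Set.univ := by
    ext y
    simp
  rw [← setLIntegral_univ, ← h2, lintegral_iUnion hset]
  · refine tsum_congr fun k => setLIntegral_congr_fun (hset k) fun y hy => ?_
    have : y 0 = k := hy
    simp only [this]
  · intro i j hij
    refine Set.disjoint_left.2 fun y hy hy' => hij ?_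
    have h3 : y 0 = i := hy
    have h4 : y 0 = j := hy'
    exact h3.symm.trans h4

/-- This shows that `cylProb` is the conditional probability given the past. In the induction the
path is shifted, so that the first observation joins the past and its constraint moves into the
weight. -/
lemma IsRegime.lintegral_cylinder (hh : IsBase h)
    (hA : ∀ p ∈ CountSeries.admissible h, fInf f θ₀ p ∈ meanRange h)
    (hr : IsRegime h f θ₀ μ) (n : ℕ) (B : ℕ → Set ℕ) (w : (ℕ → ℕ) → ENNReal) (hw : Measurable w) :
    ∫⁻ y in {y : Path | ∀ i < n, y i ∈ B i}, w (past y) ∂μ =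
      ∫⁻ y, ENNReal.ofReal (cylProb h f θ₀ n B (past y)) * w (past y) ∂μ := by
  induction n generalizing B w with
  | zero => simp [cylProb]
  | succ n ih =>
    set B' : ℕ → Set ℕ := fun i => B (i + 1)
    set w' : (ℕ → ℕ) → ENNReal := fun p => (B 0).indicator 1 (p 0) * w fun i => p (i + 1) with hw'
    have hwm' : Measurable w' := by
      refine Measurable.mul ?_ (hw.comp (by fun_prop))
      exact (measurable_from_nat (f := (B 0).indicator 1)).comp (measurable_pi_apply 0)
    have hw'c : ∀ y, w' (past (CountSeries.shift y)) = (B 0).indicator 1 (y 0) * w (past y) := by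
      intro y
      simp [hw', past_shift]
    have hcyl := measurableSet_cylinder n B'
    have h1 : ∫⁻ y in {y : Path | ∀ i < n + 1, y i ∈ B i}, w (past y) ∂μ =
        ∫⁻ y in {y : Path | ∀ i < n, y i ∈ B' i}, w' (past y) ∂μ := by
      rw [← lintegral_indicator (measurableSet_cylinder _ _), ← lintegral_indicator hcyl]
      refine Eq.trans ?_
        (hr.shift.lintegral_comp ((hwm'.comp measurable_past).indicator hcyl))
      refine lintegral_congr fun y => ?_
      have h2 : y ∈ {y : Path | ∀ i < n + 1, y i ∈ B i} ↔
          y 0 ∈ B 0 ∧ CountSeries.shift y ∈ {y : Path | ∀ i < n, y i ∈ B' i} := by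
        simp only [Set.mem_ofPred_eq, CountSeries.shift, B']
        refine ⟨fun hy => ⟨by simpa using hy 0 (by omega), fun i hi => ?_⟩, fun hy i hi => ?_⟩
        · simpa using hy (i + 1) (by omega)
        · cases i with
          | zero => simpa using hy.1
          | succ i => simpa using hy.2 i (by omega)
      have h3 := hw'c y
      by_cases h4 : y 0 ∈ B 0 <;>
        by_cases h5 : CountSeries.shift y ∈ {y : Path | ∀ i < n, y i ∈ B' i}
      · rw [Set.indicator_of_mem (h2.2 ⟨h4, h5⟩), Set.indicator_of_mem h5, h3]
        simp [h4]
      · rw [Set.indicator_of_notMem (fun hcon => h5 (h2.1 hcon).2), Set.indicator_of_notMem h5]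
      · rw [Set.indicator_of_notMem (fun hcon => h4 (h2.1 hcon).1), Set.indicator_of_mem h5,
          h3]
        simp [h4]
      · rw [Set.indicator_of_notMem (fun hcon => h5 (h2.1 hcon).2), Set.indicator_of_notMem h5]
    rw [h1, ih B' w' hwm']
    have hm1 : Measurable fun p => ENNReal.ofReal (cylProb h f θ₀ n B' p) * w' p :=
      ((measurable_cylProb hh n B').ennreal_ofReal).mul hwm'
    refine (hr.shift.lintegral_comp (hm1.comp measurable_past)).symm.trans ?_
    simp only [Function.comp_apply]
    have h6 : ∀ y, ENNReal.ofReal (cylProb h f θ₀ n B' (past (CountSeries.shift y))) *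
        w' (past (CountSeries.shift y)) =
        (fun k p => ENNReal.ofReal (cylProb h f θ₀ n B' (cons k p)) *
          ((B 0).indicator 1 k * w p)) (y 0) (past y) := by
      intro y
      rw [hw'c, past_shift]
    simp_rw [h6]
    refine (hr.lintegral_next hh (w := fun k p => ENNReal.ofReal (cylProb h f θ₀ n B' (cons k p)) *
      ((B 0).indicator 1 k * w p)) fun k => (((measurable_cylProb hh n B').comp
      (measurable_cons k)).ennreal_ofReal).mul (measurable_const.mul hw)).trans ?_
    refine lintegral_congr_ae ?_
    filter_upwards [hr.admissible] with y hy
    have hnn : ∀ k, 0 ≤ law h (fInf f θ₀ (past y)) k *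
        ((B 0).indicator 1 k * cylProb h f θ₀ n B' (cons k (past y))) ∧
        law h (fInf f θ₀ (past y)) k *
        ((B 0).indicator 1 k * cylProb h f θ₀ n B' (cons k (past y))) ≤
          law h (fInf f θ₀ (past y)) k := by
      intro k
      rcases (hh.nonneg k).eq_or_lt with hk | hk
      · simp [law_eq_zero hk.symm]
      · have h2 := cylProb_mem hh hA n B' (admissible_cons hk hy)
        have h3 := law_nonneg hh (fInf f θ₀ (past y)) k
        by_cases hkB : k ∈ B 0
        · simp only [hkB, Set.indicator_of_mem, Pi.one_apply, one_mul]
          exact ⟨mul_nonneg h3 h2.1, mul_le_of_le_one_right h3 h2.2⟩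
        · simpa [hkB] using h3
    have hs := (hasSum_law hh (hA _ hy)).summable
    rw [cylProb, ENNReal.ofReal_tsum_of_nonneg (fun k => (hnn k).1)
      (Summable.of_nonneg_of_le (fun k => (hnn k).1) (fun k => (hnn k).2) hs),
      ← ENNReal.tsum_mul_right]
    refine tsum_congr fun k => ?_
    by_cases hkB : k ∈ B 0
    · simp only [hkB, Set.indicator_of_mem, Pi.one_apply, one_mul]
      rw [ENNReal.ofReal_mul (law_nonneg hh _ _), mul_assoc]
    · simp [hkB]

/-- By the disintegration its integral is that of the observation at time 0. -/
lemma IsRegime.integrable_fInf (hh : IsBase h)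
    (hA : ∀ p ∈ CountSeries.admissible h, fInf f θ₀ p ∈ meanRange h)
    (hr : IsRegime h f θ₀ μ) : Integrable (fun y => fInf f θ₀ (past y)) μ := by
  refine ⟨((measurable_fInf f θ₀).comp measurable_past).aestronglyMeasurable, ?_⟩
  have h1 := hr.lintegral_next hh (w := fun k _ => (k : ENNReal)) fun k => measurable_const
  have h2 : ∫⁻ y, ‖fInf f θ₀ (past y)‖ₑ ∂μ =
      ∫⁻ y, ∑' k : ℕ, ENNReal.ofReal (law h (fInf f θ₀ (past y)) k) * (k : ENNReal) ∂μ := by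
    refine lintegral_congr_ae ?_
    filter_upwards [hr.admissible] with y hy
    have h3 := hasSum_mul_law hh (hA _ hy)
    rw [Real.enorm_of_nonneg (meanRange_nonneg hh (hA _ hy))]
    conv_lhs => rw [← h3.tsum_eq]
    rw [ENNReal.ofReal_tsum_of_nonneg
      (fun k => mul_nonneg (Nat.cast_nonneg _) (law_nonneg hh _ _)) h3.summable]
    refine tsum_congr fun k => ?_
    rw [ENNReal.ofReal_mul (Nat.cast_nonneg _), ENNReal.ofReal_natCast, mul_comm]
  rw [hasFiniteIntegral_iff_enorm, h2, ← h1]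
  have h4 := hr.integrable.2
  rw [hasFiniteIntegral_iff_enorm] at h4
  refine (lintegral_congr fun y => ?_).trans_lt h4
  rw [Real.enorm_of_nonneg (Nat.cast_nonneg _), ENNReal.ofReal_natCast]

/-- Given the past, the delayed cylinder has a conditional probability that differs from its value
at one reference past by a term with mean tending to 0. A constant conditional probability means
independence of the past. -/
lemma IsRegime.tendsto_delay (hh : IsBase h) (hc : IsContractive f Θ δ₁ δ₂) (hθ : θ₀ ∈ Θ)
    (hA : ∀ p ∈ CountSeries.admissible h, fInf f θ₀ p ∈ meanRange h)
    (hr : IsRegime h f θ₀ μ) {F : Set (ℕ → ℕ)} (hF : MeasurableSet F) (n : ℕ) (B : ℕ → Set ℕ) :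
    Tendsto (fun m => μ.real (past ⁻¹' F ∩ CountSeries.shift^[m] ⁻¹' {y | ∀ i < n, y i ∈ B i}))
      atTop (𝓝 (μ.real (past ⁻¹' F) * μ.real {y | ∀ i < n, y i ∈ B i})) := by
  have hprob := hr.prob
  set c : ℕ → Path → ℝ := fun m y => cylProb h f θ₀ (n + m) (delay m B) (past y) with hcdef
  have hcm : ∀ m, Measurable (c m) := fun m => (measurable_cylProb hh _ _).comp measurable_past
  have hc01 : ∀ m, ∀ᵐ y ∂μ, c m y ∈ Set.Icc (0 : ℝ) 1 := fun m =>
    hr.admissible.mono fun y hy => cylProb_mem hh hA _ _ hy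
  have hci : ∀ m, Integrable (c m) μ := fun m =>
    Integrable.of_bound (hcm m).aestronglyMeasurable 1 ((hc01 m).mono fun y hy => by
      rw [Real.norm_eq_abs, abs_of_nonneg hy.1]; exact hy.2)
  have hpre : ∀ m, CountSeries.shift^[m] ⁻¹' {y | ∀ i < n, y i ∈ B i} =
      {y : Path | ∀ i < n + m, y i ∈ delay m B i} := by
    intro m
    ext y
    simp only [Set.mem_preimage, Set.mem_ofPred_eq, iterate_shift_apply, delay]
    refine ⟨fun hy i hi => ?_, fun hy i hi => ?_⟩
    · split_ifs with him
      · exact Set.mem_univ _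
      · have := hy (i - m) (by omega)
        rwa [show ((i - m : ℕ) : ℤ) + m = i by omega] at this
    · have := hy (i + m) (by omega)
      rw [if_neg (by omega), Nat.add_sub_cancel] at this
      exact_mod_cast this
  have hFm := measurable_past hF
  have hint : ∀ (m : ℕ) (F : Set (ℕ → ℕ)), MeasurableSet F →
      μ.real (past ⁻¹' F ∩ CountSeries.shift^[m] ⁻¹' {y | ∀ i < n, y i ∈ B i}) =
        ∫ y in past ⁻¹' F, c m y ∂μ := by
    intro m F hF
    have h1 := hr.lintegral_cylinder hh hA (n + m) (delay m B) (F.indicator 1)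
      (measurable_one.indicator hF)
    have hcm' := measurableSet_cylinder (n + m) (delay m B)
    have h2 : ∀ y, F.indicator (1 : (ℕ → ℕ) → ENNReal) (past y) =
        (past ⁻¹' F).indicator 1 y := fun y => rfl
    have hFm := measurable_past hF
    simp_rw [h2] at h1
    rw [lintegral_indicator_one hFm, Measure.restrict_apply hFm] at h1
    rw [hpre, Measure.real, h1, integral_eq_lintegral_of_nonneg_ae
      (ae_restrict_of_ae ((hc01 m).mono fun y hy => hy.1))
      (hcm m).aestronglyMeasurable, ← lintegral_indicator hFm]
    congr 1
    refine lintegral_congr fun y => ?_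
    by_cases hy : y ∈ past ⁻¹' F
    · rw [Set.indicator_of_mem hy, Set.indicator_of_mem hy, Pi.one_apply, mul_one]
    · rw [Set.indicator_of_notMem hy, Set.indicator_of_notMem hy, mul_zero]
  have htot : ∀ m, μ.real {y : Path | ∀ i < n, y i ∈ B i} = ∫ y, c m y ∂μ := by
    intro m
    have h1 := hint m Set.univ MeasurableSet.univ
    rw [Set.preimage_univ, Set.univ_inter, setIntegral_univ] at h1
    rw [← h1, measureReal_def, measureReal_def,
      (hr.shift.iterate m).measure_preimage (measurableSet_cylinder n B).nullMeasurableSet]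
  obtain ⟨y₀, hy₀⟩ : ∃ y₀, past y₀ ∈ CountSeries.admissible h := hr.admissible.exists
  set x₀ := fInf f θ₀ (past y₀)
  set e : Path → ℝ := fun y => |fInf f θ₀ (past y) - x₀|
  have hei : Integrable e μ := ((hr.integrable_fInf hh hA).sub (integrable_const _)).abs
  have hρ : 0 ≤ δ₁ + δ₂ := add_nonneg hc.fst_nonneg hc.snd_nonneg
  have hlip : ∀ m, ∀ᵐ y ∂μ, |c m y - c m y₀| ≤ n * (δ₁ + δ₂) ^ m * e y := fun m =>
    hr.admissible.mono fun y hy =>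
      cylProb_delay_lipschitz hh hc hθ hA n B m _ hy _ hy₀
  rw [tendsto_iff_dist_tendsto_zero]
  have hlim : Tendsto (fun m : ℕ => 2 * (n * (δ₁ + δ₂) ^ m * ∫ y, e y ∂μ)) atTop (𝓝 0) := by
    have := (((tendsto_pow_atTop_nhds_zero_of_lt_one hρ hc.add_lt_one).const_mul (n : ℝ)).mul_const
      (∫ y, e y ∂μ)).const_mul 2
    simpa using this
  refine squeeze_zero (fun _ => dist_nonneg) (fun m => ?_) hlim
  rw [hint m F hF, htot m, Real.dist_eq]
  have hci' : Integrable (fun y => c m y - c m y₀) μ := (hci m).sub (integrable_const _)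
  have h1 : ∫ y in past ⁻¹' F, c m y ∂μ =
      ∫ y in past ⁻¹' F, (c m y - c m y₀) ∂μ + μ.real (past ⁻¹' F) * c m y₀ := by
    rw [integral_sub (hci m).integrableOn (integrable_const _).integrableOn, setIntegral_const,
      smul_eq_mul]
    ring
  have h2 : ∫ y, c m y ∂μ = ∫ y, (c m y - c m y₀) ∂μ + c m y₀ := by
    rw [integral_sub (hci m) (integrable_const _), integral_const, probReal_univ, one_smul]
    ring
  have h3 : |∫ y, (c m y - c m y₀) ∂μ| ≤ n * (δ₁ + δ₂) ^ m * ∫ y, e y ∂μ := by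
    rw [← integral_const_mul]
    exact (abs_integral_le_integral_abs).trans
      (integral_mono_ae hci'.abs (hei.const_mul _) (hlip m))
  have h4 : |∫ y in past ⁻¹' F, (c m y - c m y₀) ∂μ| ≤ n * (δ₁ + δ₂) ^ m * ∫ y, e y ∂μ := by
    rw [← integral_const_mul]
    refine (abs_integral_le_integral_abs).trans ((integral_mono_ae hci'.abs.integrableOn
      (hei.const_mul _).integrableOn (ae_restrict_of_ae (hlip m))).trans ?_)
    refine setIntegral_le_integral (hei.const_mul _) (ae_of_all _ fun y => ?_)
    exact mul_nonneg (by positivity) (abs_nonneg _)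
  have h5 : μ.real (past ⁻¹' F) ≤ 1 := measureReal_le_one
  have h6 : 0 ≤ μ.real (past ⁻¹' F) := measureReal_nonneg
  have h7 : |μ.real (past ⁻¹' F) * ∫ y, (c m y - c m y₀) ∂μ| ≤
      n * (δ₁ + δ₂) ^ m * ∫ y, e y ∂μ := by
    rw [abs_mul, abs_of_nonneg h6]
    exact (mul_le_of_le_one_left (abs_nonneg _) h5).trans h3
  rw [h1, h2]
  have h8 : ∫ y in past ⁻¹' F, (c m y - c m y₀) ∂μ + μ.real (past ⁻¹' F) * c m y₀ -
      μ.real (past ⁻¹' F) * (∫ y, (c m y - c m y₀) ∂μ + c m y₀) =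
      ∫ y in past ⁻¹' F, (c m y - c m y₀) ∂μ -
        μ.real (past ⁻¹' F) * ∫ y, (c m y - c m y₀) ∂μ := by ring
  rw [h8]
  refine (abs_sub _ _).trans ?_
  linarith

lemma measurableSet_squareCylinder (S : Finset ℤ) (B : ℤ → Set ℕ) :
    MeasurableSet {y : Path | ∀ s ∈ S, y s ∈ B s} := by
  have : {y : Path | ∀ s ∈ S, y s ∈ B s} = ⋂ s ∈ S, {y : Path | y s ∈ B s} := by
    ext y
    simp
  rw [this]
  exact Finset.measurableSet_biInter S fun s _ =>
    measurable_pi_apply (X := fun _ : ℤ => ℕ) s (MeasurableSet.of_discrete (s := B s))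

/-- The finite-dimensional events of path space. -/
def pathCylinders : Set (Set Path) :=
  {G | ∃ (S : Finset ℤ) (B : ℤ → Set ℕ), G = {y | ∀ s ∈ S, y s ∈ B s}}

lemma isPiSystem_pathCylinders : IsPiSystem pathCylinders := by
  classical
  rintro _ ⟨S, B, rfl⟩ _ ⟨S', B', rfl⟩ -
  refine ⟨S ∪ S', fun s => {k | (s ∈ S → k ∈ B s) ∧ (s ∈ S' → k ∈ B' s)}, ?_⟩
  ext y
  simp only [Set.mem_inter_iff, Set.mem_ofPred_eq, Finset.mem_union]
  exact ⟨fun hy s _ => ⟨hy.1 s, hy.2 s⟩,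
    fun hy => ⟨fun s hs => (hy s (Or.inl hs)).1 hs, fun s hs => (hy s (Or.inr hs)).2 hs⟩⟩

lemma generateFrom_pathCylinders :
    (inferInstance : MeasurableSpace Path) = MeasurableSpace.generateFrom pathCylinders := by
  refine le_antisymm ?_ (MeasurableSpace.generateFrom_le ?_)
  · refine iSup_le fun s => ?_
    rw [MeasurableSpace.comap_le_iff_le_map]
    intro A _
    refine MeasurableSpace.measurableSet_generateFrom ⟨{s}, fun _ => A, ?_⟩
    ext y
    simp
  · rintro _ ⟨S, B, rfl⟩
    exact measurableSet_squareCylinder S B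

lemma exists_bound (S : Finset ℤ) : ∃ N : ℕ, ∀ s ∈ S, -(N : ℤ) ≤ s ∧ s ≤ N := by
  refine ⟨S.sup Int.natAbs, fun s hs => ?_⟩
  have : s.natAbs ≤ S.sup Int.natAbs := Finset.le_sup (f := Int.natAbs) hs
  omega

/-- The past and the far future are asymptotically independent. -/
lemma IsRegime.tendsto_preimage_inter (hh : IsBase h) (hc : IsContractive f Θ δ₁ δ₂) (hθ : θ₀ ∈ Θ)
    (hA : ∀ p ∈ CountSeries.admissible h, fInf f θ₀ p ∈ meanRange h)
    (hr : IsRegime h f θ₀ μ) {F : Set (ℕ → ℕ)} (hF : MeasurableSet F) {G : Set Path}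
    (hG : MeasurableSet G) :
    Tendsto (fun m => μ.real (past ⁻¹' F ∩ CountSeries.shift^[m] ⁻¹' G))
      atTop (𝓝 (μ.real (past ⁻¹' F) * μ.real G)) := by
  classical
  have hprob := hr.prob
  have hT : ∀ m, Measurable (CountSeries.shift^[m]) := fun m => measurable_shift.iterate m
  induction G, hG using MeasurableSpace.induction_on_inter generateFrom_pathCylinders
    isPiSystem_pathCylinders with
  | empty => simp
  | basic G hG =>
    obtain ⟨S, B, rfl⟩ := hG
    obtain ⟨N, hN⟩ := exists_bound S
    -- A shift by N moves constraints on times in [-N, N] to the times 0, …, 2N.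
    set B' : ℕ → Set ℕ := fun i => if (i : ℤ) - N ∈ S then B (i - N) else Set.univ with hB'
    have h1 : CountSeries.shift^[N] ⁻¹' {y | ∀ s ∈ S, y s ∈ B s} =
        {y : Path | ∀ i < 2 * N + 1, y i ∈ B' i} := by
      ext y
      simp only [Set.mem_preimage, Set.mem_ofPred_eq, iterate_shift_apply, hB']
      refine ⟨fun hy i hi => ?_, fun hy s hs => ?_⟩
      · split_ifs with hiS
        · have := hy _ hiS
          rwa [sub_add_cancel] at this
        · exact Set.mem_univ _
      · have h2 := hN s hs
        have h3 := hy (s + N).toNat (by omega)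
        have h4 : ((s + N).toNat : ℤ) = s + N := by omega
        rw [h4, add_sub_cancel_right, if_pos hs] at h3
        exact h3
    have h2 := hr.tendsto_delay hh hc hθ hA hF (2 * N + 1) B'
    rw [← h1] at h2
    have h3 : μ.real (CountSeries.shift^[N] ⁻¹' {y | ∀ s ∈ S, y s ∈ B s}) =
        μ.real {y | ∀ s ∈ S, y s ∈ B s} := by
      rw [measureReal_def, measureReal_def, (hr.shift.iterate N).measure_preimage
        (measurableSet_squareCylinder S B).nullMeasurableSet]
    rw [h3] at h2
    refine (tendsto_add_atTop_iff_nat N).1 (h2.congr fun m => ?_)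
    rw [← Set.preimage_comp, ← Function.iterate_add, add_comm N m]
  | compl G hG ih =>
    have h1 : ∀ m, μ.real (past ⁻¹' F ∩ CountSeries.shift^[m] ⁻¹' Gᶜ) =
        μ.real (past ⁻¹' F) - μ.real (past ⁻¹' F ∩ CountSeries.shift^[m] ⁻¹' G) := by
      intro m
      rw [Set.preimage_compl, ← Set.sdiff_eq,
        ← measureReal_inter_add_sdiff (s := past ⁻¹' F) (hT m hG)]
      ring
    simp_rw [h1]
    rw [probReal_compl_eq_one_sub hG, mul_sub, mul_one]
    exact ih.const_sub _
  | iUnion G hdisj hG ih =>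
    have hsum : ∀ (A : Set Path) (H : ℕ → Set Path), MeasurableSet A → (∀ i, MeasurableSet (H i)) →
        Pairwise (Function.onFun Disjoint H) →
        HasSum (fun i => μ.real (A ∩ H i)) (μ.real (A ∩ ⋃ i, H i)) := by
      intro A H hA hH hd
      rw [Set.inter_iUnion]
      have hi := measure_iUnion (μ := μ) (fun i j hij => (hd hij).mono Set.inter_subset_right
        Set.inter_subset_right) fun i => hA.inter (hH i)
      rw [measureReal_def, hi, ENNReal.tsum_toReal_eq fun i => measure_ne_top _ _]
      exact ENNReal.hasSum_toReal (hi ▸ measure_ne_top _ _)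
    have h1 : ∀ m, HasSum (fun i => μ.real (past ⁻¹' F ∩ CountSeries.shift^[m] ⁻¹' G i))
        (μ.real (past ⁻¹' F ∩ CountSeries.shift^[m] ⁻¹' ⋃ i, G i)) := by
      intro m
      rw [Set.preimage_iUnion]
      exact hsum _ _ (measurable_past hF) (fun i => hT m (hG i))
        fun i j hij => (hdisj hij).preimage _
    have h2 := hsum Set.univ G MeasurableSet.univ hG hdisj
    simp only [Set.univ_inter] at h2
    have h3 := h2.mul_left (μ.real (past ⁻¹' F))
    rw [← h3.tsum_eq]
    simp_rw [← (h1 _).tsum_eq]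
    -- The terms are dominated by the measures of the pieces, by shift invariance, uniformly in m.
    refine tendsto_tsum_of_dominated_convergence h2.summable ih
      (Eventually.of_forall fun m i => ?_)
    rw [Real.norm_of_nonneg measureReal_nonneg]
    refine (measureReal_mono Set.inter_subset_right).trans_eq ?_
    rw [measureReal_def, measureReal_def,
      (hr.shift.iterate m).measure_preimage (hG i).nullMeasurableSet]

/-- The observed process is ergodic. -/
lemma IsRegime.ergodic (hh : IsBase h) (hc : IsContractive f Θ δ₁ δ₂) (hθ : θ₀ ∈ Θ)
    (hA : ∀ p ∈ CountSeries.admissible h, fInf f θ₀ p ∈ meanRange h)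
    (hr : IsRegime h f θ₀ μ) : Ergodic CountSeries.shift μ := by
  have hprob := hr.prob
  refine ⟨hr.shift, ⟨fun A hAm hinv => ?_⟩⟩
  have hinvn : ∀ m, CountSeries.shift^[m] ⁻¹' A = A := by
    intro m
    induction m with
    | zero => rfl
    | succ m ih => rw [Function.iterate_succ, Set.preimage_comp, ih, hinv]
  have h1 : ∀ F : Set (ℕ → ℕ), MeasurableSet F →
      μ.real (past ⁻¹' F ∩ A) = μ.real (past ⁻¹' F) * μ.real A := by
    intro F hF
    have := hr.tendsto_preimage_inter hh hc hθ hA hF hAm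
    simp_rw [hinvn] at this
    exact tendsto_nhds_unique tendsto_const_nhds this
  -- A cylinder on [-N, N] is the preimage of a past event under N + 1 shifts, and A is its own
  -- preimage, so `h1` applies. Independence of A from all cylinders then gives independence of A
  -- from itself.
  have h2 : ProbabilityTheory.IndepSets pathCylinders {A} μ := by
    rw [ProbabilityTheory.IndepSets_iff]
    rintro _ _ ⟨S, B, rfl⟩ hAA
    rw [Set.mem_singleton_iff.1 hAA]
    obtain ⟨N, hN⟩ := exists_bound S
    set F : Set (ℕ → ℕ) := {p | ∀ s ∈ S, p (N - s).toNat ∈ B s}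
    have hF : MeasurableSet F := by
      have : F = ⋂ s ∈ S, {p : ℕ → ℕ | p (N - s).toNat ∈ B s} := by
        ext y
        simp [F]
      rw [this]
      exact Finset.measurableSet_biInter S fun s _ =>
        measurable_pi_apply (X := fun _ : ℕ => ℕ) _ (MeasurableSet.of_discrete (s := B s))
    have h3 : CountSeries.shift^[N + 1] ⁻¹' (past ⁻¹' F) = {y | ∀ s ∈ S, y s ∈ B s} := by
      ext y
      simp only [Set.mem_preimage, Set.mem_ofPred_eq, past_iterate_shift, F]
      refine forall₂_congr fun s hs => ?_
      have h4 := hN s hs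
      have : ((N + 1 : ℕ) : ℤ) - 1 - ((N - s).toNat : ℤ) = s := by omega
      rw [this]
    have hmp := hr.shift.iterate (N + 1)
    have h5 := h1 F hF
    have h6 : CountSeries.shift^[N + 1] ⁻¹' (past ⁻¹' F) ∩ A =
        CountSeries.shift^[N + 1] ⁻¹' (past ⁻¹' F ∩ A) := by
      rw [Set.preimage_inter, hinvn]
    rw [← h3, h6, hmp.measure_preimage ((measurable_past hF).inter hAm).nullMeasurableSet,
      hmp.measure_preimage (measurable_past hF).nullMeasurableSet]
    rw [measureReal_def, measureReal_def, measureReal_def, ← ENNReal.toReal_mul] at h5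
    exact (ENNReal.toReal_eq_toReal_iff' (measure_ne_top _ _)
      (ENNReal.mul_ne_top (measure_ne_top _ _) (measure_ne_top _ _))).1 h5
  have h3 := ProbabilityTheory.IndepSets.indep'
    (by rintro _ ⟨S, B, rfl⟩; exact measurableSet_squareCylinder S B)
    (by rintro _ rfl; exact hAm) isPiSystem_pathCylinders (IsPiSystem.singleton A) h2
  have h4 : ProbabilityTheory.IndepSet A A μ := by
    refine (ProbabilityTheory.indepSet_iff_measure_inter_eq_mul hAm hAm μ).2 ?_
    rw [ProbabilityTheory.Indep_iff] at h3
    refine h3 A A ?_ (MeasurableSpace.measurableSet_generateFrom rfl)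
    rw [← generateFrom_pathCylinders]
    exact hAm
  rw [Filter.eventuallyConst_set']
  rcases ProbabilityTheory.measure_eq_zero_or_one_of_indepSet_self h4 with h5 | h5
  · exact Or.inl (ae_eq_empty.2 h5)
  · exact Or.inr ((ae_eq_univ_iff_measure_eq hAm.nullMeasurableSet).2 (h5.trans measure_univ.symm))

end Ergodicity

end CountSeries
end

noncomputable section

namespace CountSeries

/-! ### The loss function and its mean -/

section Loss

variable {d : ℕ} {h : ℕ → ℝ} {f : Param d → ℝ → ℕ → ℝ} {Θ : Set (Param d)} {δ₁ δ₂ : ℝ}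
  {θ θ₀ : Param d} {μ : Measure Path}

/-- The predictive probability of the observation at time `0`. -/
def pred (h : ℕ → ℝ) (f : Param d → ℝ → ℕ → ℝ) (θ : Param d) (y : Path) : ℝ :=
  law h (fInf f θ (past y)) (y 0)

/-- The logarithmic loss at time `0`. -/
def loss (h : ℕ → ℝ) (f : Param d → ℝ → ℕ → ℝ) (θ : Param d) (y : Path) : ℝ :=
  -Real.log (pred h f θ y)

lemma measurable_pred (hh : IsBase h) (f : Param d → ℝ → ℕ → ℝ) (θ : Param d) :
    Measurable (pred h f θ) := by
  have h1 : Measurable fun p : ℝ × ℕ => law h p.1 p.2 :=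
    measurable_from_prod_countable_left fun k => measurable_law hh k
  exact h1.comp (((measurable_fInf f θ).comp measurable_past).prodMk
    (measurable_pi_apply (X := fun _ : ℤ => ℕ) 0))

lemma measurable_loss (hh : IsBase h) (f : Param d → ℝ → ℕ → ℝ) (θ : Param d) :
    Measurable (loss h f θ) := (measurable_pred hh f θ).log.neg

/-- The paths on which the model makes sense at time `0`. -/
def goodPaths (h : ℕ → ℝ) : Set Path := {y | past y ∈ admissible h ∧ 0 < h (y 0)}

lemma IsRegime.ae_good (hr : IsRegime h f θ₀ μ) :
    ∀ᵐ y ∂μ, ∀ n : ℕ, CountSeries.shift^[n] y ∈ goodPaths h := by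
  filter_upwards [hr.ae_admissible, hr.ae_pos] with y h1 h2 n
  refine ⟨h1 n, ?_⟩
  rw [iterate_shift_apply, zero_add]
  exact h2 n

lemma pred_pos {y : Path} (hy : y ∈ goodPaths h) : 0 < pred h f θ y := law_pos hy.2

lemma pred_le_one (hh : IsBase h) (hA : ∀ p ∈ admissible h, fInf f θ p ∈ meanRange h)
    {y : Path} (hy : y ∈ goodPaths h) : pred h f θ y ≤ 1 := law_le_one hh (hA _ hy.1) _

lemma loss_nonneg (hh : IsBase h) (hA : ∀ p ∈ admissible h, fInf f θ p ∈ meanRange h)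
    {y : Path} (hy : y ∈ goodPaths h) : 0 ≤ loss h f θ y :=
  neg_nonneg.2 (Real.log_nonpos (pred_pos hy).le (pred_le_one hh hA hy))

/-- The last term is free of θ, so likelihood maximisers are exactly minimisers of the total loss,
which is non-negative. -/
lemma logLik_eq {y : Path} {n : ℕ} (hy : shift^[n] y ∈ goodPaths h) :
    logLik h f y n θ = -loss h f θ (shift^[n] y) - Real.log (h (y n)) := by
  have h1 : 0 < h (y n) := by
    have := hy.2
    rwa [iterate_shift_apply, zero_add] at this
  rw [loss, pred, law, density, logLik, eta_eq, iterate_shift_apply, zero_add,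
    Real.log_mul (Real.exp_pos _).ne' h1.ne', Real.log_exp]
  ring

/-- A law on ℕ with finite mean has finite entropy. The ratio `u` of the geometric weights to the
predictive probability has mean at most one, and log u ≤ u - 1 bounds the loss by u plus a multiple
of the observation plus one. -/
lemma IsRegime.integrable_loss (hh : IsBase h)
    (hA : ∀ p ∈ CountSeries.admissible h, fInf f θ₀ p ∈ meanRange h)
    (hr : IsRegime h f θ₀ μ) : Integrable (loss h f θ₀) μ := by
  have hprob := hr.prob
  set u : Path → ℝ := fun y => (pred h f θ₀ y * 2 ^ (y 0 + 1))⁻¹ with hu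
  have hum : Measurable u := by
    refine ((measurable_pred hh f θ₀).mul ?_).inv
    exact (measurable_from_nat (f := fun k : ℕ => (2 : ℝ) ^ (k + 1))).comp
      (measurable_pi_apply (X := fun _ : ℤ => ℕ) 0)
  have hui : Integrable u μ := by
    refine ⟨hum.aestronglyMeasurable, ?_⟩
    have h1 : ∀ᵐ y ∂μ, ‖u y‖ₑ = (fun (k : ℕ) (p : ℕ → ℕ) =>
        ENNReal.ofReal ((law h (fInf f θ₀ p) k * 2 ^ (k + 1))⁻¹)) (y 0) (past y) := by
      filter_upwards [hr.ae_good] with y hy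
      have := pred_pos (f := f) (θ := θ₀) (hy 0)
      rw [Real.enorm_of_nonneg]
      · rfl
      · simp only [Function.iterate_zero, id] at this
        positivity
    rw [hasFiniteIntegral_iff_enorm, lintegral_congr_ae h1, hr.lintegral_next hh
      (w := fun (k : ℕ) (p : ℕ → ℕ) =>
        ENNReal.ofReal ((law h (fInf f θ₀ p) k * 2 ^ (k + 1))⁻¹)) fun k =>
      ((((measurable_law hh k).comp (measurable_fInf f θ₀)).mul_const _).inv).ennreal_ofReal]
    refine (lintegral_mono (g := fun _ => ∑' k : ℕ, (2⁻¹ : ENNReal) ^ (k + 1)) fun y =>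
      ENNReal.tsum_le_tsum fun k => ?_).trans_lt ?_
    · rw [← ENNReal.ofReal_mul (law_nonneg hh _ _)]
      have h2 : (2⁻¹ : ENNReal) ^ (k + 1) = ENNReal.ofReal ((2⁻¹ : ℝ) ^ (k + 1)) := by
        rw [ENNReal.ofReal_pow (by norm_num), ENNReal.ofReal_inv_of_pos (by norm_num),
          ENNReal.ofReal_ofNat]
      rw [h2]
      refine ENNReal.ofReal_le_ofReal ?_
      rw [mul_inv, ← mul_assoc, inv_pow]
      refine mul_le_of_le_one_left (by positivity) ?_
      exact mul_inv_le_one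
    · rw [lintegral_const, measure_univ, mul_one, ENNReal.tsum_geometric_add_one]
      refine ENNReal.mul_lt_top (by simp) ?_
      rw [ENNReal.one_sub_inv_two]
      simp
  have hb : Integrable (fun y : Path => u y + ((y 0 : ℝ) + 1) * Real.log 2) μ :=
    hui.add ((hr.integrable.add (integrable_const 1)).mul_const _)
  refine hb.mono' (measurable_loss hh f θ₀).aestronglyMeasurable ?_
  filter_upwards [hr.ae_good] with y hy
  have hy0 := hy 0
  simp only [Function.iterate_zero, id] at hy0
  have hp := pred_pos (f := f) (θ := θ₀) hy0
  rw [Real.norm_of_nonneg (loss_nonneg hh hA hy0)]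
  have hup : 0 < u y := by simp only [hu]; positivity
  have h1 := Real.log_le_sub_one_of_pos hup
  have h2 : Real.log (u y) = loss h f θ₀ y - ((y 0 : ℝ) + 1) * Real.log 2 := by
    simp only [hu]
    rw [Real.log_inv, Real.log_mul hp.ne' (by positivity), Real.log_pow, loss]
    push_cast
    ring
  linarith

/-- The likelihood ratio has mean one. -/
lemma IsRegime.lintegral_ratio (hh : IsBase h)
    (hA : ∀ p ∈ CountSeries.admissible h, fInf f θ p ∈ meanRange h)
    (hr : IsRegime h f θ₀ μ) :
    ∫⁻ y, ENNReal.ofReal (pred h f θ y / pred h f θ₀ y) ∂μ = 1 := by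
  have hprob := hr.prob
  have h1 := hr.lintegral_next hh (w := fun (k : ℕ) (p : ℕ → ℕ) =>
    ENNReal.ofReal (law h (fInf f θ p) k / law h (fInf f θ₀ p) k)) fun k =>
      (((measurable_law hh k).comp (measurable_fInf f θ)).div
        ((measurable_law hh k).comp (measurable_fInf f θ₀))).ennreal_ofReal
  have h2 : ∫⁻ y, ∑' k, ENNReal.ofReal (law h (fInf f θ₀ (past y)) k) *
      ENNReal.ofReal (law h (fInf f θ (past y)) k / law h (fInf f θ₀ (past y)) k) ∂μ =
      ∫⁻ _, 1 ∂μ := by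
    refine lintegral_congr_ae ?_
    filter_upwards [hr.admissible] with y hy
    have h3 := hasSum_law hh (hA _ hy)
    rw [← ENNReal.ofReal_one, ← h3.tsum_eq,
      ENNReal.ofReal_tsum_of_nonneg (fun k => law_nonneg hh _ _) h3.summable]
    refine tsum_congr fun k => ?_
    rw [← ENNReal.ofReal_mul (law_nonneg hh _ _)]
    rcases (hh.nonneg k).eq_or_lt with hk | hk
    · simp [law_eq_zero hk.symm]
    · rw [mul_div_cancel₀ _ (law_pos hk).ne']
  rw [h2, lintegral_const, measure_univ, mul_one] at h1
  exact h1

/-- The true parameter has the strictly smallest mean loss. -/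
lemma IsRegime.integral_loss_lt (hh : IsBase h)
    (hA : ∀ p ∈ CountSeries.admissible h, fInf f θ p ∈ meanRange h)
    (hA₀ : ∀ p ∈ CountSeries.admissible h, fInf f θ₀ p ∈ meanRange h)
    (hr : IsRegime h f θ₀ μ)
    (hne : ¬ ∀ᵐ y ∂μ, fInf f θ (past y) = fInf f θ₀ (past y)) :
    ENNReal.ofReal (∫ y, loss h f θ₀ y ∂μ) < ∫⁻ y, ENNReal.ofReal (loss h f θ y) ∂μ := by
  have hprob := hr.prob
  have hgood : ∀ᵐ y ∂μ, y ∈ goodPaths h := hr.ae_good.mono fun y hy => hy 0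
  have hi₀ := hr.integrable_loss hh hA₀
  have hnn : 0 ≤ᵐ[μ] loss h f θ := hgood.mono fun y hy => loss_nonneg hh hA hy
  -- The mean loss at θ may be infinite; the negated claim makes it finite, so that the difference
  -- of the losses can be integrated.
  by_contra! hcon
  have hi : Integrable (loss h f θ) μ := by
    refine ⟨(measurable_loss hh f θ).aestronglyMeasurable, ?_⟩
    rw [hasFiniteIntegral_iff_ofReal hnn]
    exact hcon.trans_lt ENNReal.ofReal_lt_top
  rw [← ofReal_integral_eq_lintegral_ofReal hi hnn, ENNReal.ofReal_le_ofReal_iff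
    (integral_nonneg_of_ae (hgood.mono fun y hy => loss_nonneg hh hA₀ hy))] at hcon
  set u : Path → ℝ := fun y => pred h f θ y / pred h f θ₀ y with hu
  have hupos : ∀ᵐ y ∂μ, 0 < u y := hgood.mono fun y hy => div_pos (pred_pos hy) (pred_pos hy)
  have hum : Measurable u := (measurable_pred hh f θ).div (measurable_pred hh f θ₀)
  have hul := hr.lintegral_ratio (θ := θ) hh hA
  have hui : Integrable u μ := by
    refine ⟨hum.aestronglyMeasurable, ?_⟩
    rw [hasFiniteIntegral_iff_ofReal (hupos.mono fun y hy => hy.le), hul]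
    exact ENNReal.one_lt_top
  have hu1 : ∫ y, u y ∂μ = 1 := by
    rw [integral_eq_lintegral_of_nonneg_ae (hupos.mono fun y hy => hy.le)
      hum.aestronglyMeasurable, hul, ENNReal.toReal_one]
  have hvi : Integrable (fun y => (u y - 1) - (loss h f θ₀ y - loss h f θ y)) μ :=
    (hui.sub (integrable_const 1)).sub (hi₀.sub hi)
  have hlog : ∀ᵐ y ∂μ, Real.log (u y) = loss h f θ₀ y - loss h f θ y := by
    filter_upwards [hgood] with y hy
    simp only [hu, loss]
    rw [Real.log_div (pred_pos hy).ne' (pred_pos hy).ne']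
    ring
  -- Gibbs' inequality: u has mean one and log u ≤ u - 1, with equality only at u = 1. Equality of
  -- means therefore forces u = 1 almost surely.
  have hv0 : 0 ≤ᵐ[μ] fun y => (u y - 1) - (loss h f θ₀ y - loss h f θ y) := by
    filter_upwards [hlog, hupos] with y h1 h2
    rw [Pi.zero_apply, ← h1]
    linarith [Real.log_le_sub_one_of_pos h2]
  have hvint : ∫ y, ((u y - 1) - (loss h f θ₀ y - loss h f θ y)) ∂μ = 0 := by
    refine le_antisymm ?_ (integral_nonneg_of_ae hv0)
    have h1 : ∫ y, (u y - 1) ∂μ = 0 := by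
      rw [integral_sub hui (integrable_const 1), hu1, integral_const, probReal_univ, one_smul,
        sub_self]
    have h2 := integral_sub (f := fun y => u y - 1)
      (g := fun y => loss h f θ₀ y - loss h f θ y)
      (hui.sub (integrable_const 1)) (hi₀.sub hi)
    rw [h2, h1, integral_sub hi₀ hi]
    linarith
  have hv := (integral_eq_zero_iff_of_nonneg_ae hv0 hvi).1 hvint
  have hpe : ∀ᵐ y ∂μ, pred h f θ y = pred h f θ₀ y := by
    filter_upwards [hv, hlog, hupos, hgood] with y h1 h2 h3 h4
    rw [← h2, Pi.zero_apply] at h1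
    have h5 : u y = 1 := by
      by_contra h6
      linarith [Real.log_lt_sub_one_of_pos h3 h6]
    exact (div_eq_one_iff_eq (pred_pos h4).ne').1 h5
  refine hne ?_
  have hset : ∀ k, MeasurableSet {p : ℕ → ℕ | law h (fInf f θ p) k = law h (fInf f θ₀ p) k} :=
    fun k => measurableSet_eq_fun ((measurable_law hh k).comp (measurable_fInf f θ))
      ((measurable_law hh k).comp (measurable_fInf f θ₀))
  -- So far the predictive probabilities agree at the realised observation. Since every atom has
  -- positive probability given the past, they agree at all atoms, and the law determines the mean.
  have h1 := hr.lintegral_next hh (w := fun (k : ℕ) =>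
    {p : ℕ → ℕ | law h (fInf f θ p) k = law h (fInf f θ₀ p) k}ᶜ.indicator 1) fun k =>
      measurable_one.indicator (hset k).compl
  have h2 : ∫⁻ y : Path, (fun (k : ℕ) =>
      {p : ℕ → ℕ | law h (fInf f θ p) k = law h (fInf f θ₀ p) k}ᶜ.indicator (1 : (ℕ → ℕ) → ENNReal))
        (y 0) (past y) ∂μ = 0 := by
    rw [← lintegral_zero (μ := μ)]
    refine lintegral_congr_ae ?_
    filter_upwards [hpe] with y hy
    refine Set.indicator_of_notMem ?_ _
    rw [Set.mem_compl_iff, not_not]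
    exact hy
  rw [h2] at h1
  have h3 := (lintegral_eq_zero_iff (Measurable.tsum fun k =>
    (((measurable_law hh k).comp ((measurable_fInf f θ₀).comp measurable_past)).ennreal_ofReal).mul
      ((measurable_one.indicator (hset k).compl).comp measurable_past))).1 h1.symm
  filter_upwards [h3, hr.admissible] with y hy hadm
  refine law_injective hh (hA _ hadm) (hA₀ _ hadm) fun k hk => ?_
  rw [Pi.zero_apply, ENNReal.tsum_eq_zero] at hy
  rcases mul_eq_zero.1 (hy k) with h4 | h4
  · exact absurd h4 (ENNReal.ofReal_pos.2 (law_pos hk)).ne'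
  · by_contra h5
    have h6 : past y ∈ {p : ℕ → ℕ | law h (fInf f θ p) k = law h (fInf f θ₀ p) k}ᶜ := h5
    simp [Set.indicator_of_mem h6] at h4

end Loss

end CountSeries
end

noncomputable section

namespace CountSeries

/-! ### Suprema and derivatives of random functions of the parameter -/

section RandomFunctions

variable {α E : Type*} [MeasurableSpace α] {μ : Measure α}

/-- By continuity the supremum is attained along a countable dense subset. -/
lemma aemeasurable_biSup_enorm [TopologicalSpace E] [SecondCountableTopology E]
    {F : α → E → ℝ} {U : Set E}
    (hF : ∀ θ ∈ U, AEMeasurable (fun a => F a θ) μ) (hc : ∀ᵐ a ∂μ, ContinuousOn (F a) U) :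
    AEMeasurable (fun a => ⨆ θ ∈ U, ‖F a θ‖ₑ) μ := by
  obtain ⟨D, hD, hDd⟩ := TopologicalSpace.exists_countable_dense U
  set D' : Set E := Subtype.val '' D with hD'
  have hDU : D' ⊆ U := by rintro _ ⟨x, -, rfl⟩; exact x.2
  have hD'c : D'.Countable := hD.image _
  have hcl : U ⊆ closure D' := by
    intro x hx
    have := hDd ⟨x, hx⟩
    exact image_closure_subset_closure_image continuous_subtype_val ⟨_, this, rfl⟩
  have h1 : AEMeasurable (fun a => ⨆ θ ∈ D', ‖F a θ‖ₑ) μ :=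
    AEMeasurable.biSup D' hD'c fun θ hθ => (hF θ (hDU hθ)).enorm
  refine h1.congr ?_
  filter_upwards [hc] with a ha
  refine le_antisymm (biSup_mono hDU) (iSup₂_le fun θ hθ => ?_)
  have h2 : Tendsto (fun θ' => ‖F a θ'‖ₑ) (𝓝[D'] θ) (𝓝 ‖F a θ‖ₑ) :=
    ((ha θ hθ).mono hDU).enorm
  have : (𝓝[D'] θ).NeBot := mem_closure_iff_nhdsWithin_neBot.1 (hcl hθ)
  refine le_of_tendsto h2 ?_
  filter_upwards [self_mem_nhdsWithin] with θ' hθ'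
  exact le_iSup₂ (f := fun θ _ => ‖F a θ‖ₑ) θ' hθ'

lemma aemeasurable_fderiv_apply [NormedAddCommGroup E] [NormedSpace ℝ E]
    {F : α → E → ℝ} {U : Set E} (hU : IsOpen U)
    (hF : ∀ θ ∈ U, AEMeasurable (fun a => F a θ) μ) {θ : E} (hθ : θ ∈ U)
    (hd : ∀ᵐ a ∂μ, DifferentiableAt ℝ (F a) θ) (v : E) :
    AEMeasurable (fun a => fderiv ℝ (F a) θ v) μ := by
  have h1 : Tendsto (fun n : ℕ => θ + ((n : ℝ))⁻¹ • v) atTop (𝓝 θ) := by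
    have := (tendsto_inv_atTop_nhds_zero_nat (𝕜 := ℝ)).smul_const v
    simpa using this.const_add θ
  -- The derivative is a limit of difference quotients; starting from index N keeps their base
  -- points in U, where measurability is known.
  obtain ⟨N, hN⟩ := eventually_atTop.1 (h1.eventually_mem (hU.mem_nhds hθ))
  refine aemeasurable_of_tendsto_metrizable_ae atTop
    (f := fun (n : ℕ) a => ((n + N : ℕ) : ℝ) • (F a (θ + (((n + N : ℕ) : ℝ))⁻¹ • v) - F a θ))
    (fun n => ((hF _ (hN (n + N) (Nat.le_add_left N n))).sub (hF θ hθ)).const_smul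
      (((n + N : ℕ) : ℝ))) ?_
  filter_upwards [hd] with a ha
  refine ha.hasFDerivAt.lim v (c := fun n : ℕ => ((n + N : ℕ) : ℝ)) ?_
  refine (tendsto_natCast_atTop_atTop.comp (tendsto_add_atTop_nat N)).congr fun n => ?_
  simp only [Function.comp_apply, Real.norm_natCast]

/-- A non-negative function whose second derivative is at most `K` grows slowly. -/
lemma le_of_second_deriv_le {φ φ' φ'' : ℝ → ℝ} {K : ℝ}
    (hKnn : 0 ≤ K) (h0 : ∀ s ∈ Set.Icc (-1 : ℝ) 1, 0 ≤ φ s)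
    (h1 : ∀ s ∈ Set.Icc (-1 : ℝ) 1, HasDerivAt φ (φ' s) s)
    (h2 : ∀ s ∈ Set.Icc (-1 : ℝ) 1, HasDerivAt φ' (φ'' s) s)
    (hK : ∀ s ∈ Set.Icc (-1 : ℝ) 1, φ'' s ≤ K) {s : ℝ} (hs : s ∈ Set.Icc (0 : ℝ) 1) :
    φ s ≤ (1 + s) * φ 0 + s * K := by
  -- Writing 0 as a convex combination of s and -1, concavity bounds φ s from above, and φ (-1) ≥ 0
  -- takes the place of a bound on the first derivative at 0.
  have hK0 : ConcaveOn ℝ (Set.Icc (-1 : ℝ) 1) fun s => φ s - K / 2 * s ^ 2 := by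
    refine concaveOn_of_hasDerivWithinAt2_nonpos (f' := fun s => φ' s - K * s)
      (f'' := fun s => φ'' s - K) (convex_Icc _ _) ?_ ?_ ?_ ?_
    · intro s hs
      exact ((h1 s hs).continuousAt.sub (by fun_prop)).continuousWithinAt
    · intro s hs
      have h3 := (h1 s (interior_subset hs)).sub
        (((hasDerivAt_id s).pow 2).const_mul (K / 2))
      refine (h3.congr_deriv ?_).hasDerivWithinAt
      simp
      ring
    · intro s hs
      have h3 := (h2 s (interior_subset hs)).sub ((hasDerivAt_id s).const_mul K)
      refine (h3.congr_deriv ?_).hasDerivWithinAt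
      simp
    · intro s hs
      have := hK s (interior_subset hs)
      linarith
  have hs1 : (0 : ℝ) < 1 + s := by linarith [hs.1]
  obtain ⟨-, hK2⟩ := hK0
  have h3 := hK2 (show s ∈ Set.Icc (-1 : ℝ) 1 from ⟨by linarith [hs.1], hs.2⟩)
    (show (-1 : ℝ) ∈ Set.Icc (-1 : ℝ) 1 from ⟨le_rfl, by norm_num⟩)
    (one_div_pos.2 hs1).le (div_nonneg hs.1 hs1.le) (by field_simp)
  simp only [smul_eq_mul] at h3
  have h4 : 1 / (1 + s) * s + s / (1 + s) * -1 = 0 := by field_simp; try ring_nf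
  rw [h4] at h3
  have h5 := mul_le_mul_of_nonneg_left h3 hs1.le
  have h6 : (1 + s) * (1 / (1 + s) * (φ s - K / 2 * s ^ 2) +
      s / (1 + s) * (φ (-1) - K / 2 * (-1) ^ 2)) =
      (φ s - K / 2 * s ^ 2) + s * (φ (-1) - K / 2) := by field_simp; try ring_nf
  rw [h6] at h5
  have h7 := mul_nonneg hs.1 (h0 (-1) ⟨le_rfl, by norm_num⟩)
  nlinarith [mul_nonneg hKnn (mul_nonneg hs.1 (sub_nonneg.2 hs.2))]

end RandomFunctions

/-! ### Smoothness of the model in the parameter -/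

section Smooth

variable {d : ℕ} {h : ℕ → ℝ} {f : Param d → ℝ → ℕ → ℝ} {Θ : Set (Param d)} {δ₁ δ₂ : ℝ}
  {θ θ₀ : Param d} {μ : Measure Path}

/-- The natural parameter as a function of the past. -/
def pastEta (h : ℕ → ℝ) (f : Param d → ℝ → ℕ → ℝ) (p : ℕ → ℕ) (θ : Param d) : ℝ :=
  meanInv h (fInf f θ p)

lemma eta_eq_pastEta (y : Path) (n : ℕ) :
    eta h f y n = pastEta h f (past (shift^[n] y)) := eta_eq h f y n

lemma eta_zero (y : Path) : eta h f y 0 = pastEta h f (past y) := by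
  have := eta_eq_pastEta (h := h) (f := f) y 0
  simpa using this

lemma measurable_pastEta (hh : IsBase h) (θ : Param d) :
    Measurable fun y : Path => pastEta h f (past y) θ :=
  (measurable_meanInv hh).comp ((measurable_fInf f θ).comp measurable_past)

lemma measurable_meanFun (h : ℕ → ℝ) : Measurable (meanFun h) := measurable_deriv _

lemma measurable_varFun (h : ℕ → ℝ) : Measurable (varFun h) := measurable_deriv _

lemma contDiffAt_pastEta (hh : IsBase h)
    (hA : ∀ θ ∈ Θ, ∀ p ∈ admissible h, fInf f θ p ∈ meanRange h)
    (hA5 : AssumptionA5 h f Θ) {p : ℕ → ℕ} (hp : p ∈ admissible h) (hθ : θ ∈ interior Θ) :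
    ContDiffAt ℝ 2 (pastEta h f p) θ := by
  have h1 : ContDiffAt ℝ 2 (fun θ => fInf f θ p) θ :=
    (hA5 p hp).contDiffAt (mem_interior_iff_mem_nhds.1 hθ)
  exact (contDiffAt_meanInv hh (hA θ (interior_subset hθ) p hp) two_ne_zero).comp θ h1

lemma partialD_eq {F : Param d → ℝ} (hθ : θ ∈ interior Θ) (i : Fin d) :
    partialD Θ i F θ = fderiv ℝ F θ (EuclideanSpace.single i 1) := by
  rw [partialD, fderivWithin_of_mem_nhds (mem_interior_iff_mem_nhds.1 hθ)]

lemma partialD_partialD_eq {F : Param d → ℝ} (hθ : θ ∈ interior Θ) (i j : Fin d) :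
    partialD Θ i (partialD Θ j F) θ =
      fderiv ℝ (fun θ => fderiv ℝ F θ (EuclideanSpace.single j 1)) θ
        (EuclideanSpace.single i 1) := by
  rw [partialD_eq hθ]
  congr 1
  refine Filter.EventuallyEq.fderiv_eq ?_
  filter_upwards [isOpen_interior.mem_nhds hθ] with θ' hθ'
  exact partialD_eq hθ' j

lemma sum_smul_single (v : Param d) : v = ∑ i, v i • EuclideanSpace.single i (1 : ℝ) := by
  ext j
  simp [Pi.single_apply]

lemma fderiv_apply_eq_sum {F : Param d → ℝ} (v : Param d) :
    fderiv ℝ F θ v = ∑ i, v i * fderiv ℝ F θ (EuclideanSpace.single i 1) := by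
  conv_lhs => rw [sum_smul_single v]
  simp

lemma contDiffAt_fderiv_apply {F : Param d → ℝ} (hF : ContDiffAt ℝ 2 F θ) (v : Param d) :
    ContDiffAt ℝ 1 (fun θ => fderiv ℝ F θ v) θ :=
  (hF.fderiv_right (m := 1) (by norm_num)).clm_apply contDiffAt_const

lemma continuousAt_fderiv_fderiv_apply {F : Param d → ℝ} (hF : ContDiffAt ℝ 2 F θ)
    (v w : Param d) :
    ContinuousAt (fun θ => fderiv ℝ (fun θ => fderiv ℝ F θ v) θ w) θ :=
  (((contDiffAt_fderiv_apply hF v).fderiv_right (m := 0) (by norm_num)).clm_apply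
    contDiffAt_const).continuousAt

lemma fderiv_fderiv_apply_eq_sum {F : Param d → ℝ} (hF : ContDiffAt ℝ 2 F θ) (v : Param d) :
    fderiv ℝ (fun θ => fderiv ℝ F θ v) θ v = ∑ i, ∑ j, v i * v j *
      fderiv ℝ (fun θ => fderiv ℝ F θ (EuclideanSpace.single j 1)) θ
        (EuclideanSpace.single i 1) := by
  rw [fderiv_apply_eq_sum]
  refine Finset.sum_congr rfl fun i _ => ?_
  have h1 : (fun θ => fderiv ℝ F θ v) =
      fun θ => ∑ j, v j * fderiv ℝ F θ (EuclideanSpace.single j 1) := by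
    ext θ
    exact fderiv_apply_eq_sum v
  have h2 : ∀ j : Fin d, DifferentiableAt ℝ
      (fun θ => fderiv ℝ F θ (EuclideanSpace.single j 1)) θ := fun j =>
    (contDiffAt_fderiv_apply hF _).differentiableAt one_ne_zero
  rw [h1, fderiv_fun_sum fun j _ => (h2 j).const_mul _, sum_apply,
    Finset.mul_sum]
  refine Finset.sum_congr rfl fun j _ => ?_
  rw [fderiv_const_mul (h2 j)]
  simp
  ring

/-- The entries of the information term, as functions of the past. -/
def infoEntry (h : ℕ → ℝ) (f : Param d → ℝ → ℕ → ℝ) (Θ : Set (Param d)) (i j : Fin d)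
    (y : Path) (θ : Param d) : ℝ :=
  varFun h (pastEta h f (past y) θ) * partialD Θ i (pastEta h f (past y)) θ *
    partialD Θ j (pastEta h f (past y)) θ

/-- The score-weighted second derivatives of the natural parameter. -/
def curvEntry (h : ℕ → ℝ) (f : Param d → ℝ → ℕ → ℝ) (Θ : Set (Param d)) (i j : Fin d)
    (y : Path) (θ : Param d) : ℝ :=
  ((y 0 : ℝ) - meanFun h (pastEta h f (past y) θ)) *
    partialD Θ i (partialD Θ j (pastEta h f (past y))) θ

lemma continuousAt_infoEntry (hh : IsBase h)
    (hA : ∀ θ ∈ Θ, ∀ p ∈ admissible h, fInf f θ p ∈ meanRange h) (hA5 : AssumptionA5 h f Θ)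
    {y : Path} (hy : past y ∈ admissible h) (hθ : θ ∈ interior Θ) (i j : Fin d) :
    ContinuousAt (infoEntry h f Θ i j y) θ := by
  have hs := contDiffAt_pastEta hh hA hA5 hy hθ
  have h1 : ContinuousAt (fun θ => varFun h (pastEta h f (past y) θ)) θ :=
    ContinuousAt.comp (f := pastEta h f (past y)) (g := varFun h) (analyticAt_varFun hh
      (meanInv_mem (hA θ (interior_subset hθ) _ hy))).continuousAt hs.continuousAt
  have h2 : ∀ i, ContinuousAt (fun θ => partialD Θ i (pastEta h f (past y)) θ) θ := fun i => by
    refine (contDiffAt_fderiv_apply hs (EuclideanSpace.single i 1)).continuousAt.congr ?_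
    filter_upwards [isOpen_interior.mem_nhds hθ] with θ' hθ'
    exact (partialD_eq hθ' i).symm
  exact (h1.mul (h2 i)).mul (h2 j)

lemma continuousAt_curvEntry (hh : IsBase h)
    (hA : ∀ θ ∈ Θ, ∀ p ∈ admissible h, fInf f θ p ∈ meanRange h) (hA5 : AssumptionA5 h f Θ)
    {y : Path} (hy : past y ∈ admissible h) (hθ : θ ∈ interior Θ) (i j : Fin d) :
    ContinuousAt (curvEntry h f Θ i j y) θ := by
  have hs := contDiffAt_pastEta hh hA hA5 hy hθ
  have h1 : ContinuousAt (fun θ => meanFun h (pastEta h f (past y) θ)) θ :=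
    ContinuousAt.comp (f := pastEta h f (past y)) (g := meanFun h) (analyticAt_meanFun hh
      (meanInv_mem (hA θ (interior_subset hθ) _ hy))).continuousAt hs.continuousAt
  have h2 : ContinuousAt (fun θ => partialD Θ i (partialD Θ j (pastEta h f (past y))) θ) θ := by
    refine (continuousAt_fderiv_fderiv_apply hs (EuclideanSpace.single j 1)
      (EuclideanSpace.single i 1)).congr ?_
    filter_upwards [isOpen_interior.mem_nhds hθ] with θ' hθ'
    exact (partialD_partialD_eq hθ' i j).symm
  exact (continuousAt_const.sub h1).mul h2

lemma aemeasurable_partialD (hh : IsBase h)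
    (hA : ∀ θ ∈ Θ, ∀ p ∈ admissible h, fInf f θ p ∈ meanRange h) (hA5 : AssumptionA5 h f Θ)
    (hadm : ∀ᵐ y ∂μ, past y ∈ admissible h) (hθ : θ ∈ interior Θ) (i : Fin d) :
    AEMeasurable (fun y => partialD Θ i (pastEta h f (past y)) θ) μ := by
  simp_rw [partialD_eq hθ]
  exact aemeasurable_fderiv_apply isOpen_interior
    (fun θ _ => (measurable_pastEta hh θ).aemeasurable) hθ
    (hadm.mono fun y hy => (contDiffAt_pastEta hh hA hA5 hy hθ).differentiableAt two_ne_zero) _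

lemma aemeasurable_partialD_partialD (hh : IsBase h)
    (hA : ∀ θ ∈ Θ, ∀ p ∈ admissible h, fInf f θ p ∈ meanRange h) (hA5 : AssumptionA5 h f Θ)
    (hadm : ∀ᵐ y ∂μ, past y ∈ admissible h) (hθ : θ ∈ interior Θ) (i j : Fin d) :
    AEMeasurable (fun y => partialD Θ i (partialD Θ j (pastEta h f (past y))) θ) μ := by
  simp_rw [partialD_partialD_eq hθ]
  refine aemeasurable_fderiv_apply
    (F := fun y θ => fderiv ℝ (pastEta h f (past y)) θ (EuclideanSpace.single j 1))
    isOpen_interior (fun θ hθ => ?_) hθ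
    (hadm.mono fun y hy => (contDiffAt_fderiv_apply
      (contDiffAt_pastEta hh hA hA5 hy hθ) _).differentiableAt one_ne_zero) _
  have := aemeasurable_partialD (μ := μ) hh hA hA5 hadm hθ j
  simp_rw [partialD_eq hθ] at this
  exact this

lemma aemeasurable_infoEntry (hh : IsBase h)
    (hA : ∀ θ ∈ Θ, ∀ p ∈ admissible h, fInf f θ p ∈ meanRange h) (hA5 : AssumptionA5 h f Θ)
    (hadm : ∀ᵐ y ∂μ, past y ∈ admissible h) (hθ : θ ∈ interior Θ) (i j : Fin d) :
    AEMeasurable (fun y => infoEntry h f Θ i j y θ) μ :=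
  ((((measurable_varFun h).comp (measurable_pastEta hh θ)).aemeasurable).mul
    (aemeasurable_partialD hh hA hA5 hadm hθ i)).mul (aemeasurable_partialD hh hA hA5 hadm hθ j)

lemma aemeasurable_curvEntry (hh : IsBase h)
    (hA : ∀ θ ∈ Θ, ∀ p ∈ admissible h, fInf f θ p ∈ meanRange h) (hA5 : AssumptionA5 h f Θ)
    (hadm : ∀ᵐ y ∂μ, past y ∈ admissible h) (hθ : θ ∈ interior Θ) (i j : Fin d) :
    AEMeasurable (fun y => curvEntry h f Θ i j y θ) μ :=
  ((((measurable_coord 0).sub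
    ((measurable_meanFun h).comp (measurable_pastEta hh θ))).aemeasurable).mul
    (aemeasurable_partialD_partialD hh hA hA5 hadm hθ i j))

lemma aemeasurable_biSup_infoEntry (hh : IsBase h)
    (hA : ∀ θ ∈ Θ, ∀ p ∈ admissible h, fInf f θ p ∈ meanRange h) (hA5 : AssumptionA5 h f Θ)
    (hadm : ∀ᵐ y ∂μ, past y ∈ admissible h) {U : Set (Param d)} (hU : U ⊆ interior Θ)
    (i j : Fin d) : AEMeasurable (fun y => ⨆ θ ∈ U, ‖infoEntry h f Θ i j y θ‖ₑ) μ :=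
  aemeasurable_biSup_enorm
    (fun _ hθ => aemeasurable_infoEntry hh hA hA5 hadm (hU hθ) i j)
    (hadm.mono fun _ hy _ hθ =>
      (continuousAt_infoEntry hh hA hA5 hy (hU hθ) i j).continuousWithinAt)

lemma aemeasurable_biSup_curvEntry (hh : IsBase h)
    (hA : ∀ θ ∈ Θ, ∀ p ∈ admissible h, fInf f θ p ∈ meanRange h) (hA5 : AssumptionA5 h f Θ)
    (hadm : ∀ᵐ y ∂μ, past y ∈ admissible h) {U : Set (Param d)} (hU : U ⊆ interior Θ)
    (i j : Fin d) : AEMeasurable (fun y => ⨆ θ ∈ U, ‖curvEntry h f Θ i j y θ‖ₑ) μ :=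
  aemeasurable_biSup_enorm
    (fun _ hθ => aemeasurable_curvEntry hh hA hA5 hadm (hU hθ) i j)
    (hadm.mono fun _ hy _ hθ =>
      (continuousAt_curvEntry hh hA hA5 hy (hU hθ) i j).continuousWithinAt)

/-- Along a segment inside the parameter space, the loss grows slowly. -/
lemma loss_line_le (hh : IsBase h)
    (hA : ∀ θ ∈ Θ, ∀ p ∈ admissible h, fInf f θ p ∈ meanRange h) (hA5 : AssumptionA5 h f Θ)
    {y : Path} (hy : y ∈ goodPaths h) {U : Set (Param d)} (hU : U ⊆ interior Θ) {v : Param d}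
    (hv : ‖v‖ ≤ 1) (hline : ∀ s ∈ Set.Icc (-1 : ℝ) 1, θ₀ + s • v ∈ U) {K : Fin d → Fin d → ℝ}
    (hK : ∀ i j, ∀ θ ∈ U, |infoEntry h f Θ i j y θ| + |curvEntry h f Θ i j y θ| ≤ K i j)
    {s : ℝ} (hs : s ∈ Set.Icc (0 : ℝ) 1) :
    loss h f (θ₀ + s • v) y ≤ (1 + s) * loss h f θ₀ y + s * ∑ i, ∑ j, K i j := by
  set H := pastEta h f (past y) with hH
  have hloss : ∀ θ, loss h f θ y = cumulant h (H θ) - H θ * (y 0 : ℝ) - Real.log (h (y 0)) := by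
    intro θ
    rw [loss, pred, law, density, Real.log_mul (Real.exp_pos _).ne' hy.2.ne', Real.log_exp, hH,
      pastEta]
    ring
  have hmem : ∀ s ∈ Set.Icc (-1 : ℝ) 1, θ₀ + s • v ∈ interior Θ := fun s hs => hU (hline s hs)
  have hline' : ∀ s : ℝ, HasDerivAt (fun s : ℝ => θ₀ + s • v) v s := fun s => by
    have := ((hasDerivAt_id s).smul_const v).const_add θ₀
    simpa using this
  have hη : ∀ s ∈ Set.Icc (-1 : ℝ) 1,
      HasDerivAt (fun s => H (θ₀ + s • v)) (fderiv ℝ H (θ₀ + s • v) v) s := fun s hs =>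
    HasFDerivAt.comp_hasDerivAt (l := H) s
      ((contDiffAt_pastEta hh hA hA5 hy.1 (hmem s hs)).differentiableAt two_ne_zero).hasFDerivAt
      (hline' s)
  have hη2 : ∀ s ∈ Set.Icc (-1 : ℝ) 1, HasDerivAt (fun s => fderiv ℝ H (θ₀ + s • v) v)
      (fderiv ℝ (fun θ => fderiv ℝ H θ v) (θ₀ + s • v) v) s := fun s hs =>
    HasFDerivAt.comp_hasDerivAt (l := fun θ => fderiv ℝ H θ v) s
      ((contDiffAt_fderiv_apply (contDiffAt_pastEta hh hA hA5 hy.1 (hmem s hs))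
        v).differentiableAt one_ne_zero).hasFDerivAt (hline' s)
  have hnat : ∀ s ∈ Set.Icc (-1 : ℝ) 1, H (θ₀ + s • v) ∈ natParam h := fun s hs =>
    meanInv_mem (hA _ (interior_subset (hmem s hs)) _ hy.1)
  have hK0 : 0 ≤ ∑ i, ∑ j, K i j := by
    refine Finset.sum_nonneg fun i _ => Finset.sum_nonneg fun j _ => ?_
    exact (by positivity : (0 : ℝ) ≤ _).trans (hK i j _ (hline 0 (by norm_num)))
  have h0 : loss h f θ₀ y = loss h f (θ₀ + (0 : ℝ) • v) y := by simp
  rw [h0]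
  -- Along the segment the second derivative is A''(η) (∂ᵥη)² - (y₀ - A'(η)) ∂ᵥ²η, which is made of
  -- the entries that `hK` bounds.
  refine le_of_second_deriv_le (φ := fun s => loss h f (θ₀ + s • v) y)
    (φ' := fun s => (meanFun h (H (θ₀ + s • v)) - y 0) * fderiv ℝ H (θ₀ + s • v) v)
    (φ'' := fun s => varFun h (H (θ₀ + s • v)) * fderiv ℝ H (θ₀ + s • v) v *
      fderiv ℝ H (θ₀ + s • v) v + (meanFun h (H (θ₀ + s • v)) - y 0) *
      fderiv ℝ (fun θ => fderiv ℝ H θ v) (θ₀ + s • v) v) hK0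
    (fun s hs => loss_nonneg hh (hA _ (interior_subset (hmem s hs))) hy) ?_ ?_ ?_ hs
  · intro s hs
    simp_rw [hloss]
    have h1 := HasDerivAt.comp s (h₂ := cumulant h) (hasDerivAt_cumulant hh (hnat s hs)) (hη s hs)
    have h2 := (h1.sub ((hη s hs).mul_const (y 0 : ℝ))).sub_const (Real.log (h (y 0)))
    refine h2.congr_deriv ?_
    ring
  · intro s hs
    have h1 := HasDerivAt.comp s (h₂ := meanFun h) (hasDerivAt_meanFun hh (hnat s hs)) (hη s hs)
    exact (h1.sub_const (y 0 : ℝ)).mul (hη2 s hs)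
  · intro s hs
    have hcd := contDiffAt_pastEta hh hA hA5 hy.1 (hmem s hs)
    have hvi : ∀ i, |v i| ≤ 1 := fun i => (PiLp.norm_apply_le v i).trans hv
    have h1 : varFun h (H (θ₀ + s • v)) * fderiv ℝ H (θ₀ + s • v) v *
        fderiv ℝ H (θ₀ + s • v) v =
        ∑ i, ∑ j, v i * v j * infoEntry h f Θ i j y (θ₀ + s • v) := by
      rw [fderiv_apply_eq_sum, mul_assoc, Finset.sum_mul_sum, Finset.mul_sum]
      refine Finset.sum_congr rfl fun i _ => ?_
      rw [Finset.mul_sum]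
      refine Finset.sum_congr rfl fun j _ => ?_
      rw [infoEntry, partialD_eq (hmem s hs), partialD_eq (hmem s hs)]
      ring
    have h2 : (meanFun h (H (θ₀ + s • v)) - y 0) *
        fderiv ℝ (fun θ => fderiv ℝ H θ v) (θ₀ + s • v) v =
        ∑ i, ∑ j, -(v i * v j * curvEntry h f Θ i j y (θ₀ + s • v)) := by
      rw [fderiv_fderiv_apply_eq_sum hcd, Finset.mul_sum]
      refine Finset.sum_congr rfl fun i _ => ?_
      rw [Finset.mul_sum]
      refine Finset.sum_congr rfl fun j _ => ?_
      rw [curvEntry, partialD_partialD_eq (hmem s hs)]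
      ring
    rw [h1, h2, ← Finset.sum_add_distrib]
    refine Finset.sum_le_sum fun i _ => ?_
    rw [← Finset.sum_add_distrib]
    refine Finset.sum_le_sum fun j _ => ?_
    refine le_trans ?_ (hK i j _ (hline s hs))
    have h3 : |v i * v j| ≤ 1 := by
      rw [abs_mul]
      exact mul_le_one₀ (hvi i) (abs_nonneg _) (hvi j)
    have h4 : ∀ x : ℝ, v i * v j * x ≤ |x| := fun x =>
      (le_abs_self _).trans (by rw [abs_mul]; exact mul_le_of_le_one_left (abs_nonneg _) h3)
    have h5 := h4 (infoEntry h f Θ i j y (θ₀ + s • v))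
    have h6 := h4 (-curvEntry h f Θ i j y (θ₀ + s • v))
    rw [abs_neg] at h6
    linarith

/-- The integrability assumptions on the derivatives of the model near the true parameter. -/
structure LocalBounds (h : ℕ → ℝ) (f : Param d → ℝ → ℕ → ℝ) (Θ : Set (Param d)) (θ₀ : Param d)
    (μ : Measure Path) (R : ℝ) : Prop where
  pos : 0 < R
  subset : Metric.ball θ₀ R ⊆ interior Θ
  info : ∀ i j, ∫⁻ y, ⨆ θ ∈ Metric.ball θ₀ R, ‖infoEntry h f Θ i j y θ‖ₑ ∂μ < ⊤
  curv : ∀ i j, ∫⁻ y, ⨆ θ ∈ Metric.ball θ₀ R, ‖curvEntry h f Θ i j y θ‖ₑ ∂μ < ⊤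

lemma exists_integrable_bound {G : Path → Param d → ℝ} {U : Set (Param d)}
    (hm : AEMeasurable (fun y => ⨆ θ ∈ U, ‖G y θ‖ₑ) μ)
    (hi : ∫⁻ y, ⨆ θ ∈ U, ‖G y θ‖ₑ ∂μ < ⊤) :
    ∃ K : Path → ℝ, Integrable K μ ∧ ∀ᵐ y ∂μ, ∀ θ ∈ U, |G y θ| ≤ K y := by
  refine ⟨fun y => (⨆ θ ∈ U, ‖G y θ‖ₑ).toReal, integrable_toReal_of_lintegral_ne_top hm hi.ne, ?_⟩
  filter_upwards [ae_lt_top' hm hi.ne] with y hy θ hθ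
  rw [← Real.norm_eq_abs, ← toReal_enorm]
  exact ENNReal.toReal_mono hy.ne (le_iSup₂ (f := fun θ _ => ‖G y θ‖ₑ) θ hθ)

/-- Near the true parameter, the loss is at most a small perturbation of the loss at the true
parameter. -/
lemma LocalBounds.exists_slope (hh : IsBase h)
    (hA : ∀ θ ∈ Θ, ∀ p ∈ admissible h, fInf f θ p ∈ meanRange h) (hA5 : AssumptionA5 h f Θ)
    (hgood : ∀ᵐ y ∂μ, y ∈ goodPaths h) {R : ℝ} (hR : LocalBounds h f Θ θ₀ μ R) :
    ∃ r > (0 : ℝ), ∃ K : Path → ℝ, Integrable K μ ∧ ∀ᵐ y ∂μ, 0 ≤ K y ∧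
      ∀ s ∈ Set.Ioc (0 : ℝ) 1, ∀ θ, dist θ θ₀ ≤ s * r →
        loss h f θ y ≤ (1 + s) * loss h f θ₀ y + s * K y := by
  have hadm : ∀ᵐ y ∂μ, past y ∈ admissible h := hgood.mono fun y hy => hy.1
  choose K₁ hK₁i hK₁ using fun i j => exists_integrable_bound
    (aemeasurable_biSup_infoEntry hh hA hA5 hadm hR.subset i j) (hR.info i j)
  choose K₂ hK₂i hK₂ using fun i j => exists_integrable_bound
    (aemeasurable_biSup_curvEntry hh hA hA5 hadm hR.subset i j) (hR.curv i j)
  have hR0 := hR.pos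
  -- R / 2 keeps the whole segment from θ₀ - v to θ₀ + v inside the ball; 1 bounds the coordinates
  -- of v.
  refine ⟨min (R / 2) 1, by positivity, fun y => ∑ i, ∑ j, (K₁ i j y + K₂ i j y), ?_, ?_⟩
  · exact integrable_finsetSum _ fun i _ => integrable_finsetSum _ fun j _ =>
      (hK₁i i j).add (hK₂i i j)
  filter_upwards [hgood, ae_all_iff.2 fun i => ae_all_iff.2 (hK₁ i),
    ae_all_iff.2 fun i => ae_all_iff.2 (hK₂ i)] with y hy h1 h2
  have hθ₀ : θ₀ ∈ Metric.ball θ₀ R := Metric.mem_ball_self hR0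
  refine ⟨Finset.sum_nonneg fun i _ => Finset.sum_nonneg fun j _ => add_nonneg
    ((abs_nonneg _).trans (h1 i j _ hθ₀)) ((abs_nonneg _).trans (h2 i j _ hθ₀)), ?_⟩
  intro s hs θ hθ
  -- Thus θ is reached at time s on a segment whose size does not shrink with s, which is why K
  -- enters with the factor s.
  set v := s⁻¹ • (θ - θ₀)
  have hvn : ‖v‖ ≤ min (R / 2) 1 := by
    rw [norm_smul, norm_inv, Real.norm_of_nonneg hs.1.le, ← dist_eq_norm, inv_mul_le_iff₀ hs.1]
    exact hθ
  have hθv : θ = θ₀ + s • v := by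
    rw [smul_inv_smul₀ hs.1.ne']
    abel
  rw [hθv]
  refine loss_line_le hh hA hA5 hy hR.subset (hvn.trans (min_le_right _ _)) (fun t ht => ?_)
    (fun i j θ hθ => add_le_add (h1 i j θ hθ) (h2 i j θ hθ)) ⟨hs.1.le, hs.2⟩
  rw [Metric.mem_ball, dist_eq_norm, add_sub_cancel_left, norm_smul, Real.norm_eq_abs]
  have h3 : |t| * ‖v‖ ≤ ‖v‖ := mul_le_of_le_one_left (norm_nonneg _) (abs_le.2 ht)
  have h4 := hvn.trans (min_le_left _ _)
  linarith

/-- The information term is continuous in mean at the true parameter. -/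
lemma LocalBounds.exists_oscillation (hh : IsBase h)
    (hA : ∀ θ ∈ Θ, ∀ p ∈ admissible h, fInf f θ p ∈ meanRange h) (hA5 : AssumptionA5 h f Θ)
    (hgood : ∀ᵐ y ∂μ, y ∈ goodPaths h) {R : ℝ} (hR : LocalBounds h f Θ θ₀ μ R) (i j : Fin d)
    {ε : ℝ} (hε : 0 < ε) :
    Integrable (fun y => infoEntry h f Θ i j y θ₀) μ ∧
    ∃ r > (0 : ℝ), ∃ D : Path → ℝ, Integrable D μ ∧ ∫ y, D y ∂μ ≤ ε ∧
      ∀ᵐ y ∂μ, ∀ θ ∈ Metric.ball θ₀ r,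
        |infoEntry h f Θ i j y θ - infoEntry h f Θ i j y θ₀| ≤ D y := by
  have hadm : ∀ᵐ y ∂μ, past y ∈ admissible h := hgood.mono fun y hy => hy.1
  have hR0 := hR.pos
  have hθ₀ : θ₀ ∈ Metric.ball θ₀ R := Metric.mem_ball_self hR0
  obtain ⟨K, hKi, hK⟩ := exists_integrable_bound
    (aemeasurable_biSup_infoEntry hh hA hA5 hadm hR.subset i j) (hR.info i j)
  have hm₀ := aemeasurable_infoEntry (μ := μ) hh hA hA5 hadm (hR.subset hθ₀) i j
  refine ⟨hKi.mono' hm₀.aestronglyMeasurable (hK.mono fun y hy => hy θ₀ hθ₀), ?_⟩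
  set G : Path → Param d → ℝ := fun y θ => infoEntry h f Θ i j y θ - infoEntry h f Θ i j y θ₀
    with hG
  set U : ℕ → Set (Param d) := fun n => Metric.ball θ₀ (R / ((n : ℝ) + 1)) with hU
  have hUR : ∀ n, U n ⊆ Metric.ball θ₀ R := fun n => Metric.ball_subset_ball (by
    rw [div_le_iff₀ (by positivity)]
    nlinarith [Nat.cast_nonneg (α := ℝ) n])
  have hGc : ∀ y, past y ∈ admissible h → ∀ θ ∈ Metric.ball θ₀ R, ContinuousAt (G y) θ :=
    fun y hy θ hθ =>
      (continuousAt_infoEntry hh hA hA5 hy (hR.subset hθ) i j).sub continuousAt_const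
  have hm : ∀ n, AEMeasurable (fun y => ⨆ θ ∈ U n, ‖G y θ‖ₑ) μ := fun n =>
    aemeasurable_biSup_enorm
      (fun θ hθ => (aemeasurable_infoEntry hh hA hA5 hadm (hR.subset (hUR n hθ)) i j).sub hm₀)
      (hadm.mono fun y hy θ hθ => (hGc y hy θ (hUR n hθ)).continuousWithinAt)
  have hb : ∀ n, ∀ᵐ y ∂μ, ⨆ θ ∈ U n, ‖G y θ‖ₑ ≤ ENNReal.ofReal (2 * K y) := fun n =>
    hK.mono fun y hy => iSup₂_le fun θ hθ => by
      rw [← ofReal_norm]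
      refine ENNReal.ofReal_le_ofReal ?_
      have := abs_sub (infoEntry h f Θ i j y θ) (infoEntry h f Θ i j y θ₀)
      have h1 := hy θ (hUR n hθ)
      have h2 := hy θ₀ hθ₀
      rw [Real.norm_eq_abs]
      linarith
  have hfin : ∫⁻ y, ENNReal.ofReal (2 * K y) ∂μ ≠ ⊤ := (hKi.const_mul 2).lintegral_lt_top.ne
  -- Dominated convergence: continuity at θ₀ makes the supremum over shrinking balls tend to 0, and
  -- twice the envelope dominates it.
  have hlim : Tendsto (fun n => ∫⁻ y, ⨆ θ ∈ U n, ‖G y θ‖ₑ ∂μ) atTop (𝓝 (∫⁻ _, 0 ∂μ)) := by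
    refine tendsto_lintegral_of_dominated_convergence' _ hm hb hfin ?_
    filter_upwards [hadm] with y hy
    rw [ENNReal.tendsto_atTop_zero]
    intro η hη
    have h1 : Tendsto (fun θ => ‖G y θ‖ₑ) (𝓝 θ₀) (𝓝 0) := by
      have := (hGc y hy θ₀ hθ₀).enorm
      rw [ContinuousAt] at this
      simpa [hG] using this
    obtain ⟨r, hr, hr'⟩ := Metric.eventually_nhds_iff_ball.1 (h1.eventually (ge_mem_nhds hη))
    obtain ⟨N, hN⟩ := exists_nat_gt (R / r)
    refine ⟨N, fun n hn => iSup₂_le fun θ hθ => hr' θ (Metric.ball_subset_ball ?_ hθ)⟩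
    rw [div_lt_iff₀ hr] at hN
    rw [div_le_iff₀ (by positivity)]
    have : (N : ℝ) ≤ n := by exact_mod_cast hn
    nlinarith
  rw [lintegral_zero] at hlim
  obtain ⟨n, hn⟩ := (hlim.eventually (ge_mem_nhds (ENNReal.ofReal_pos.2 hε))).exists
  have hlt : ∫⁻ y, ⨆ θ ∈ U n, ‖G y θ‖ₑ ∂μ < ⊤ := hn.trans_lt ENNReal.ofReal_lt_top
  refine ⟨R / ((n : ℝ) + 1), by positivity, fun y => (⨆ θ ∈ U n, ‖G y θ‖ₑ).toReal,
    integrable_toReal_of_lintegral_ne_top (hm n) hlt.ne, ?_, ?_⟩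
  · rw [integral_toReal (hm n) (ae_lt_top' (hm n) hlt.ne)]
    exact ENNReal.toReal_le_of_le_ofReal hε.le hn
  · filter_upwards [ae_lt_top' (hm n) hlt.ne] with y hy θ hθ
    rw [← Real.norm_eq_abs, ← toReal_enorm]
    exact ENNReal.toReal_mono hy.ne (le_iSup₂ (f := fun θ _ => ‖G y θ‖ₑ) θ hθ)

end Smooth

end CountSeries
end

noncomputable section

namespace CountSeries

/-! ### Uniform laws of large numbers for the loss -/

section Averages

variable {d : ℕ} {h : ℕ → ℝ} {f : Param d → ℝ → ℕ → ℝ} {Θ : Set (Param d)} {δ₁ δ₂ : ℝ}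
  {θ θ₀ : Param d} {μ : Measure Path}

/-- Along the windows `(a n, b n]`, the paths `z n` give predictive probabilities that differ by
at most `δ n` from those of `y`. -/
def IsShadow (h : ℕ → ℝ) (f : Param d → ℝ → ℕ → ℝ) (Θ : Set (Param d)) (y : Path)
    (z : ℕ → Path) (a b : ℕ → ℕ) (δ : ℕ → ℝ) : Prop :=
  ∀ᶠ n in atTop, ∀ t ∈ Finset.Ioc (a n) (b n), shift^[t] (z n) ∈ goodPaths h ∧
    ∀ θ ∈ Θ, |pred h f θ (shift^[t] (z n)) - pred h f θ (shift^[t] y)| ≤ δ n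

/-- The predictive probabilities are continuous in the parameter. -/
lemma continuousOn_pred (hh : IsBase h)
    (hA : ∀ θ ∈ Θ, ∀ p ∈ admissible h, fInf f θ p ∈ meanRange h) (hA2 : AssumptionA2 h f Θ)
    {y : Path} (hy : past y ∈ admissible h) : ContinuousOn (fun θ => pred h f θ y) Θ :=
  (continuousOn_law hh (y 0)).comp (hA2 _ hy) fun θ hθ => hA θ hθ _ hy

/-- Around a parameter other than the true one, the loss is bounded from below by an integrable
function with a larger mean than the loss at the true parameter. -/
lemma exists_lower_envelope (hh : IsBase h)
    (hA : ∀ θ ∈ Θ, ∀ p ∈ admissible h, fInf f θ p ∈ meanRange h) (hA2 : AssumptionA2 h f Θ)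
    (hr : IsRegime h f θ₀ μ) (hθ₀ : θ₀ ∈ Θ) (hθ : θ ∈ Θ)
    (hne : ¬ ∀ᵐ y ∂μ, fInf f θ (past y) = fInf f θ₀ (past y)) :
    ∃ ρ > (0 : ℝ), ∃ κ > (0 : ℝ), ∃ Q : Path → ℝ, (∀ y, κ ≤ Q y) ∧
      Integrable (fun y => -Real.log (Q y)) μ ∧
      ∫ y, loss h f θ₀ y ∂μ < ∫ y, -Real.log (Q y) ∂μ ∧
      ∀ᵐ y ∂μ, ∀ θ' ∈ Metric.ball θ ρ ∩ Θ, pred h f θ' y ≤ Q y := by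
  have hprob := hr.prob
  have hgood : ∀ᵐ y ∂μ, y ∈ goodPaths h := hr.ae_good.mono fun y hy => hy 0
  set e : ℕ → ℝ := fun n => 1 / ((n : ℝ) + 1) with he
  have he0 : ∀ n, 0 < e n := fun n => by positivity
  have he1 : ∀ n, e n ≤ 1 := fun n => by
    rw [he, div_le_one (by positivity)]
    linarith [Nat.cast_nonneg (α := ℝ) n]
  have hetend : Tendsto e atTop (𝓝 0) := tendsto_one_div_add_atTop_nhds_zero_nat
  set U : ℕ → Set (Param d) := fun n => Metric.ball θ (e n) ∩ Θ with hU
  set S : ℕ → Path → ENNReal := fun n y => ⨆ θ' ∈ U n, ‖pred h f θ' y‖ₑ with hS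
  have hSm : ∀ n, AEMeasurable (S n) μ := fun n => aemeasurable_biSup_enorm
    (fun θ' _ => (measurable_pred hh f θ').aemeasurable)
    (hgood.mono fun y hy θ' hθ' =>
      (continuousOn_pred hh hA hA2 hy.1 θ' hθ'.2).mono Set.inter_subset_right)
  have henorm : ∀ y ∈ goodPaths h, ∀ θ', ‖pred h f θ' y‖ₑ = ENNReal.ofReal (pred h f θ' y) :=
    fun y hy θ' => Real.enorm_of_nonneg (pred_pos hy).le
  have hS1 : ∀ y ∈ goodPaths h, ∀ n, S n y ≤ 1 := fun y hy n => iSup₂_le fun θ' hθ' => by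
    rw [henorm y hy]
    exact ENNReal.ofReal_le_one.2 (pred_le_one hh (hA θ' hθ'.2) hy)
  have hle : ∀ y ∈ goodPaths h, ∀ n, ∀ θ' ∈ U n, pred h f θ' y ≤ (S n y).toReal := by
    intro y hy n θ' hθ'
    refine (ENNReal.ofReal_le_iff_le_toReal ((hS1 y hy n).trans_lt ENNReal.one_lt_top).ne).1 ?_
    rw [← henorm y hy]
    exact le_iSup₂ (f := fun θ' _ => ‖pred h f θ' y‖ₑ) θ' hθ'
  have hStend : ∀ y ∈ goodPaths h, Tendsto (fun n => (S n y).toReal) atTop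
      (𝓝 (pred h f θ y)) := by
    intro y hy
    rw [Metric.tendsto_atTop]
    intro ε hε
    obtain ⟨η, hη, hηε⟩ := Metric.continuousWithinAt_iff.1
      (continuousOn_pred hh hA hA2 hy.1 θ hθ) (ε / 2) (by positivity)
    obtain ⟨N, hN⟩ := eventually_atTop.1 (hetend.eventually (gt_mem_nhds hη))
    refine ⟨N, fun n hn => ?_⟩
    have h1 := hle y hy n θ ⟨Metric.mem_ball_self (he0 n), hθ⟩
    have h2 : (S n y).toReal ≤ pred h f θ y + ε / 2 := by
      refine ENNReal.toReal_le_of_le_ofReal (by linarith [pred_pos (f := f) (θ := θ) hy]) ?_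
      refine iSup₂_le fun θ' hθ' => ?_
      rw [henorm y hy]
      refine ENNReal.ofReal_le_ofReal ?_
      have := hηε hθ'.2 ((Metric.mem_ball.1 hθ'.1).trans (hN n hn))
      rw [Real.dist_eq] at this
      linarith [(abs_lt.1 this).2]
    rw [Real.dist_eq, abs_lt]
    constructor <;> linarith
  -- Truncation from below bounds the logarithm, and it turns a small additive error of a
  -- probability into a small relative one. The same e n is radius and truncation level, so both
  -- vanish in the limit.
  set Q : ℕ → Path → ℝ := fun n y => max (S n y).toReal (e n) with hQ
  have hQm : ∀ n, AEMeasurable (Q n) μ := fun n => (hSm n).ennreal_toReal.max aemeasurable_const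
  have hQ0 : ∀ n y, e n ≤ Q n y := fun n y => le_max_right _ _
  have hQ1 : ∀ y ∈ goodPaths h, ∀ n, Q n y ≤ 1 := fun y hy n =>
    max_le (ENNReal.toReal_le_of_le_ofReal zero_le_one (by simpa using hS1 y hy n)) (he1 n)
  have hnn : ∀ y ∈ goodPaths h, ∀ n, 0 ≤ -Real.log (Q n y) := fun y hy n =>
    neg_nonneg.2 (Real.log_nonpos ((he0 n).le.trans (hQ0 n y)) (hQ1 y hy n))
  have hint : ∀ n, Integrable (fun y => -Real.log (Q n y)) μ := fun n => by
    refine (integrable_const (-Real.log (e n))).mono'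
      (Real.measurable_log.comp_aemeasurable (hQm n)).neg.aestronglyMeasurable ?_
    filter_upwards [hgood] with y hy
    rw [Real.norm_of_nonneg (hnn y hy n)]
    exact neg_le_neg (Real.log_le_log (he0 n) (hQ0 n y))
  have hQtend : ∀ y ∈ goodPaths h, Tendsto (fun n => ENNReal.ofReal (-Real.log (Q n y))) atTop
      (𝓝 (ENNReal.ofReal (loss h f θ y))) := by
    intro y hy
    have h1 := (hStend y hy).max hetend
    rw [max_eq_left (pred_pos (f := f) (θ := θ) hy).le] at h1
    exact ENNReal.tendsto_ofReal (h1.log (pred_pos (f := f) (θ := θ) hy).ne').neg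
  have hfatou : ∫⁻ y, ENNReal.ofReal (loss h f θ y) ∂μ ≤
      liminf (fun n => ∫⁻ y, ENNReal.ofReal (-Real.log (Q n y)) ∂μ) atTop := by
    refine le_trans (le_of_eq (lintegral_congr_ae ?_)) (lintegral_liminf_le' fun n =>
      (Real.measurable_log.comp_aemeasurable (hQm n)).neg.ennreal_ofReal)
    filter_upwards [hgood] with y hy
    exact (hQtend y hy).liminf_eq.symm
  have hlt := (hr.integral_loss_lt hh (hA θ hθ) (hA θ₀ hθ₀) hne).trans_le hfatou
  obtain ⟨n, hn⟩ := (eventually_lt_of_lt_liminf hlt).exists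
  rw [← ofReal_integral_eq_lintegral_ofReal (hint n) (hgood.mono fun y hy => hnn y hy n)] at hn
  refine ⟨e n, he0 n, e n, he0 n, Q n, hQ0 n, hint n, ?_, ?_⟩
  · exact (ENNReal.ofReal_lt_ofReal_iff_of_nonneg (integral_nonneg_of_ae (hgood.mono fun y hy =>
      loss_nonneg hh (hA θ₀ hθ₀) hy))).1 hn
  · filter_upwards [hgood] with y hy θ' hθ'
    exact (hle y hy n θ' hθ').trans (le_max_left _ _)

/-- Away from the true parameter, the average loss is eventually larger than the mean loss at the
true parameter, uniformly. -/
lemma exists_average_loss_ge (hh : IsBase h)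
    (hA : ∀ θ ∈ Θ, ∀ p ∈ admissible h, fInf f θ p ∈ meanRange h) (hA2 : AssumptionA2 h f Θ)
    (hΘ : IsCompact Θ) (hr : IsRegime h f θ₀ μ) (he : Ergodic shift μ) (hθ₀ : θ₀ ∈ Θ)
    (hid : ∀ θ ∈ Θ, (∀ᵐ y ∂μ, fInf f θ (past y) = fInf f θ₀ (past y)) → θ = θ₀)
    {r : ℝ} (hr0 : 0 < r) :
    ∃ c > (0 : ℝ), ∀ᵐ y ∂μ, ∀ a b C z δ, IsWindow a b C → IsShadow h f Θ y z a b δ →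
      Tendsto δ atTop (𝓝 0) → ∀ᶠ n in atTop, ∀ θ ∈ Θ, r ≤ dist θ θ₀ →
        ((b n : ℝ) - a n) * (∫ y, loss h f θ₀ y ∂μ + c) ≤
          ∑ t ∈ Finset.Ioc (a n) (b n), loss h f θ (shift^[t] (z n)) := by
  have hprob := hr.prob
  set H := ∫ y, loss h f θ₀ y ∂μ with hH
  suffices hs : ∃ c > (0 : ℝ), ∀ᵐ y ∂μ, ∀ a b C z δ, IsWindow a b C →
      IsShadow h f Θ y z a b δ → Tendsto δ atTop (𝓝 0) → ∀ᶠ n in atTop,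
      ∀ θ ∈ Θ ∩ {θ | r ≤ dist θ θ₀}, ((b n : ℝ) - a n) * (H + c) ≤
          ∑ t ∈ Finset.Ioc (a n) (b n), loss h f θ (shift^[t] (z n)) by
    obtain ⟨c, hc, hs⟩ := hs
    refine ⟨c, hc, hs.mono fun y hy a b C z δ h1 h2 h3 => (hy a b C z δ h1 h2 h3).mono
      fun n hn θ hθ hθr => hn θ ⟨hθ, hθr⟩⟩
  have hcomp : IsCompact (Θ ∩ {θ | r ≤ dist θ θ₀}) :=
    hΘ.inter_right (isClosed_le continuous_const (by fun_prop))
  -- Compactness reduces the claim to a neighbourhood of each θ ≠ θ₀, with finitely many null sets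
  -- and constants.
  refine hcomp.induction_on (p := fun s => ∃ c > (0 : ℝ), ∀ᵐ y ∂μ, ∀ a b C z δ,
    IsWindow a b C → IsShadow h f Θ y z a b δ → Tendsto δ atTop (𝓝 0) → ∀ᶠ n in atTop,
      ∀ θ ∈ s, ((b n : ℝ) - a n) * (H + c) ≤
          ∑ t ∈ Finset.Ioc (a n) (b n), loss h f θ (shift^[t] (z n))) ?_ ?_ ?_ ?_
  · exact ⟨1, one_pos, by simp⟩
  · rintro s s' hss ⟨c, hc, hs⟩
    exact ⟨c, hc, hs.mono fun y hy a b C z δ h1 h2 h3 => (hy a b C z δ h1 h2 h3).mono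
      fun n hn θ hθ => hn θ (hss hθ)⟩
  · rintro s s' ⟨c, hc, hs⟩ ⟨c', hc', hs'⟩
    refine ⟨min c c', lt_min hc hc', ?_⟩
    filter_upwards [hs, hs'] with y hy hy' a b C z δ h1 h2 h3
    filter_upwards [hy a b C z δ h1 h2 h3, hy' a b C z δ h1 h2 h3] with n hn hn' θ hθ
    have hm : 0 ≤ (b n : ℝ) - a n := sub_nonneg.2 (by exact_mod_cast h1.le n)
    rcases hθ with hθ | hθ
    · exact le_trans (by gcongr; exact min_le_left _ _) (hn θ hθ)
    · exact le_trans (by gcongr; exact min_le_right _ _) (hn' θ hθ)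
  · rintro θ ⟨hθ, hθr⟩
    have hne : θ ≠ θ₀ := by
      rintro rfl
      rw [Set.mem_ofPred_eq, dist_self] at hθr
      exact hr0.not_ge hθr
    obtain ⟨ρ, hρ, κ, hκ, Q, hQκ, hQi, hQH, hQ⟩ := exists_lower_envelope hh hA hA2 hr hθ₀ hθ
      fun hcon => hne (hid θ hθ hcon)
    set J := ∫ y, -Real.log (Q y) ∂μ with hJ
    refine ⟨Metric.ball θ ρ ∩ Θ, ?_, (J - H) / 3, by linarith, ?_⟩
    · exact inter_mem (mem_nhdsWithin_of_mem_nhds (Metric.ball_mem_nhds θ hρ))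
        (mem_of_superset self_mem_nhdsWithin Set.inter_subset_left)
    have hQ' : ∀ᵐ y ∂μ, ∀ t : ℕ, ∀ θ' ∈ Metric.ball θ ρ ∩ Θ,
        pred h f θ' (shift^[t] y) ≤ Q (shift^[t] y) := ae_all_iff.2 fun t =>
      (hr.shift.iterate t).quasiMeasurePreserving.ae hQ
    filter_upwards [ae_window_average he hQi, hQ'] with y hy1 hy2 a b C z δ h1 h2 h3
    -- Of the gap J - H, one third pays for the ergodic error, one third for the change of path, and
    -- one third is the margin c.
    have hε : 0 < (J - H) / 3 := by linarith
    filter_upwards [hy1 a b C h1 _ hε, h2, h3.eventually (gt_mem_nhds (mul_pos hκ hε))]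
      with n hn1 hn2 hn3 θ' hθ'
    have hm : 0 ≤ (b n : ℝ) - a n := sub_nonneg.2 (by exact_mod_cast h1.le n)
    have h4 : ∀ t ∈ Finset.Ioc (a n) (b n), -Real.log (Q (shift^[t] y)) - (J - H) / 3 ≤
        loss h f θ' (shift^[t] (z n)) := by
      intro t ht
      obtain ⟨hg, hd⟩ := hn2 t ht
      have hq0 : 0 < Q (shift^[t] y) := hκ.trans_le (hQκ _)
      have h5 : pred h f θ' (shift^[t] (z n)) ≤
          Q (shift^[t] y) * (1 + (J - H) / 3) := by
        have h6 := (abs_le.1 (hd θ' hθ'.2)).2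
        have h7 := hy2 t θ' hθ'
        have h8 := mul_le_mul_of_nonneg_right (hQκ (shift^[t] y)) hε.le
        linarith
      have h6 := Real.log_le_log (pred_pos hg) h5
      rw [Real.log_mul hq0.ne' (by positivity)] at h6
      have h7 := Real.log_le_sub_one_of_pos (show 0 < 1 + (J - H) / 3 by positivity)
      rw [loss]
      linarith
    have h5 := Finset.sum_le_sum h4
    rw [Finset.sum_sub_distrib, Finset.sum_const, Nat.card_Ioc, nsmul_eq_mul,
      Nat.cast_sub (h1.le n)] at h5
    have h6 := (abs_le.1 hn1).1
    nlinarith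

/-- Near the true parameter, the average loss is eventually close to its mean at the true
parameter, uniformly. -/
lemma exists_average_loss_le (hh : IsBase h)
    (hA : ∀ θ ∈ Θ, ∀ p ∈ admissible h, fInf f θ p ∈ meanRange h) (hA5 : AssumptionA5 h f Θ)
    (hr : IsRegime h f θ₀ μ) (he : Ergodic shift μ) (hθ₀ : θ₀ ∈ Θ) {R : ℝ}
    (hR : LocalBounds h f Θ θ₀ μ R) {c : ℝ} (hc : 0 < c) :
    ∃ r > (0 : ℝ), ∀ᵐ y ∂μ, ∀ a b C z δ, IsWindow a b C → IsShadow h f Θ y z a b δ →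
      (∃ γ > (0 : ℝ), Tendsto (fun n => δ n * Real.exp (γ * b n)) atTop (𝓝 0)) →
      ∀ᶠ n in atTop, ∀ θ ∈ Θ, dist θ θ₀ ≤ r →
        ∑ t ∈ Finset.Ioc (a n) (b n), loss h f θ (shift^[t] (z n)) ≤
          ((b n : ℝ) - a n) * (∫ y, loss h f θ₀ y ∂μ + c) := by
  have hprob := hr.prob
  have hgood : ∀ᵐ y ∂μ, y ∈ goodPaths h := hr.ae_good.mono fun y hy => hy 0
  obtain ⟨r, hr0, K, hKi, hK⟩ := hR.exists_slope hh hA hA5 hgood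
  have hLi := hr.integrable_loss hh (hA θ₀ hθ₀)
  set H := ∫ y, loss h f θ₀ y ∂μ with hH
  have hH0 : 0 ≤ H := integral_nonneg_of_ae (hgood.mono fun y hy => loss_nonneg hh (hA θ₀ hθ₀) hy)
  have hK0 : 0 ≤ ∫ y, K y ∂μ := integral_nonneg_of_ae (hK.mono fun y hy => hy.1)
  set M := H + ∫ y, K y ∂μ with hM
  have hM0 : 0 ≤ M := add_nonneg hH0 hK0
  -- Small enough that the perturbed bound `G` has mean at most H + c / 3; the remaining thirds of c
  -- serve the ergodic error and the change of path.
  set s := min 1 (c / 3 / (M + 1)) with hs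
  have hs0 : 0 < s := by positivity
  have hs1 : s ≤ 1 := min_le_left _ _
  have hsM : s * M ≤ c / 3 := by
    have h1 : s * (M + 1) ≤ c / 3 := (le_div_iff₀ (by positivity)).1 (min_le_right _ _)
    linarith
  set G : Path → ℝ := fun y => (1 + s) * loss h f θ₀ y + s * K y with hG
  have hGi : Integrable G μ := (hLi.const_mul _).add (hKi.const_mul _)
  have hGint : ∫ y, G y ∂μ ≤ H + c / 3 := by
    rw [hG, integral_add (hLi.const_mul _) (hKi.const_mul _), integral_const_mul,
      integral_const_mul]
    linarith
  have hK' : ∀ᵐ y ∂μ, ∀ t : ℕ, ∀ θ, dist θ θ₀ ≤ s * r →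
      loss h f θ (shift^[t] y) ≤ G (shift^[t] y) := ae_all_iff.2 fun t =>
    (hr.shift.iterate t).quasiMeasurePreserving.ae (hK.mono fun y hy => hy.2 s ⟨hs0, hs1⟩)
  refine ⟨s * r, by positivity, ?_⟩
  filter_upwards [ae_window_average he hGi, ae_abs_iterate_le he hGi, hK', hr.ae_good]
    with y hy1 hy2 hy3 hy4 a b C z δ h1 h2 ⟨γ, hγ, h3⟩
  obtain ⟨B, hB⟩ := hy2 (γ / 2) (by positivity)
  have hbtend : Tendsto (fun n => (b n : ℝ)) atTop atTop :=
    tendsto_atTop_mono (fun n => sub_le_self _ (Nat.cast_nonneg _)) h1.tendsto_real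
  have hx0 : 0 < min (1 / 2) (c / 6) := by positivity
  filter_upwards [hy1 a b C h1 (c / 3) (by positivity), h2, h3.eventually (gt_mem_nhds hx0),
    hbtend.eventually_ge_atTop (B / (γ / 2))] with n hn1 hn2 hn3 hn4 θ hθ hθr
  rw [div_le_iff₀ (by positivity)] at hn4
  have hm : 0 ≤ (b n : ℝ) - a n := sub_nonneg.2 (by exact_mod_cast h1.le n)
  have h4 : ∀ t ∈ Finset.Ioc (a n) (b n), loss h f θ (shift^[t] (z n)) ≤
      G (shift^[t] y) + c / 3 := by
    intro t ht
    obtain ⟨hg, hd⟩ := hn2 t ht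
    have h5 := hy3 t θ hθr
    set p := pred h f θ (shift^[t] y) with hp
    set p' := pred h f θ (shift^[t] (z n)) with hp'
    have hp0 : 0 < p := pred_pos (hy4 t)
    have htb : (t : ℝ) ≤ b n := by exact_mod_cast (Finset.mem_Ioc.1 ht).2
    -- `G` grows sublinearly along the orbit, so the predictive probability is at least exp (-γ b
    -- n). The error δ n is of smaller order, so its relative size `x` tends to 0; this is why
    -- exponential decay is required of δ here.
    have h6 : -Real.log p ≤ γ * b n := by
      have h7 := le_trans (le_abs_self _) (hB t)
      have h8 : -Real.log p = loss h f θ (shift^[t] y) := rfl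
      nlinarith
    have h7 : 1 ≤ p * Real.exp (γ * b n) := by
      rw [← Real.exp_log hp0, ← Real.exp_add]
      exact Real.one_le_exp (by linarith)
    set x := δ n * Real.exp (γ * b n) with hx
    have h8 := abs_le.1 (hd θ hθ)
    have hδ0 : 0 ≤ δ n := (abs_nonneg _).trans (hd θ hθ)
    have h9 : p * (1 - x) ≤ p' := by
      have := mul_le_mul_of_nonneg_left h7 hδ0
      rw [hx]
      nlinarith [h8.1]
    have hx1 : x < 1 / 2 := hn3.trans_le (min_le_left _ _)
    have hx2 : x < c / 6 := hn3.trans_le (min_le_right _ _)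
    have hx3 : 0 ≤ x := by positivity
    have h10 := Real.log_le_log (mul_pos hp0 (by linarith)) h9
    rw [Real.log_mul hp0.ne' (by linarith)] at h10
    have h11 : -(2 * x) ≤ Real.log (1 - x) := by
      have h12 := Real.one_sub_inv_le_log_of_pos (show 0 < 1 - x by linarith)
      have h13 : (1 - x)⁻¹ ≤ 1 + 2 * x := by
        rw [inv_le_iff_one_le_mul₀ (by linarith)]
        nlinarith
      linarith
    rw [loss] at h5 ⊢
    linarith
  have h5 := Finset.sum_le_sum h4
  rw [Finset.sum_add_distrib, Finset.sum_const, Nat.card_Ioc, nsmul_eq_mul,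
    Nat.cast_sub (h1.le n)] at h5
  have h6 := (abs_le.1 hn1).2
  have h7 := mul_le_mul_of_nonneg_left hGint hm
  nlinarith

end Averages

end CountSeries
end

noncomputable section

namespace CountSeries

/-! ### The information matrix -/

section Information

variable {d : ℕ} {h : ℕ → ℝ} {f : Param d → ℝ → ℕ → ℝ} {Θ : Set (Param d)} {δ₁ δ₂ : ℝ}
  {θ θ₀ : Param d} {μ : Measure Path}

lemma infoTerm_apply (y : Path) (n : ℕ) (θ : Param d) (i j : Fin d) :
    infoTerm h f Θ y n θ i j = infoEntry h f Θ i j (shift^[n] y) θ := by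
  have h1 : eta h f y n = pastEta h f (past (shift^[n] y)) := eta_eq_pastEta y n
  simp only [infoTerm, h1, infoEntry, Matrix.of_apply]

lemma infoTerm_pathOf {Ω : Type*} {Y : ℤ → Ω → ℕ} (ω : Ω) (θ : Param d) (i j : Fin d) :
    infoTerm h f Θ (fun t => Y t ω) 0 θ i j = infoEntry h f Θ i j (pathOf Y ω) θ :=
  infoTerm_apply (pathOf Y ω) 0 θ i j

lemma quadForm_eq_sum (M : Matrix (Fin d) (Fin d) ℝ) (x : Param d) :
    ((fun i => x i) ⬝ᵥ M.mulVec fun i => x i) = ∑ i, ∑ j, x i * x j * M i j := by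
  simp only [dotProduct, Matrix.mulVec, Finset.mul_sum]
  exact Finset.sum_congr rfl fun i _ => Finset.sum_congr rfl fun j _ => by ring

/-- A positive definite quadratic form is coercive. -/
lemma exists_coercive {M : Matrix (Fin d) (Fin d) ℝ} (hM : M.PosDef) :
    ∃ c > (0 : ℝ), ∀ x : Param d,
      c * ‖x‖ ^ 2 ≤ (fun i => x i) ⬝ᵥ M.mulVec fun i => x i := by
  set Q : Param d → ℝ := fun x => (fun i => x i) ⬝ᵥ M.mulVec fun i => x i with hQ
  have hQc : Continuous Q := by
    simp_rw [hQ, quadForm_eq_sum]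
    fun_prop
  have hpos : ∀ x : Param d, x ≠ 0 → 0 < Q x := fun x hx => by
    have h1 : (fun i => x i) ≠ 0 := fun h0 => hx (by ext i; exact congrFun h0 i)
    simpa using hM.dotProduct_mulVec_pos h1
  have hsmul : ∀ (s : ℝ) (x : Param d), Q (s • x) = s ^ 2 * Q x := fun s x => by
    simp_rw [hQ, quadForm_eq_sum, Finset.mul_sum]
    refine Finset.sum_congr rfl fun i _ => Finset.sum_congr rfl fun j _ => ?_
    simp
    ring
  rcases (Metric.sphere (0 : Param d) 1).eq_empty_or_nonempty with he | hne
  · refine ⟨1, one_pos, fun x => ?_⟩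
    have hx : x = 0 := by
      by_contra hx
      have : ‖x‖⁻¹ • x ∈ Metric.sphere (0 : Param d) 1 := by
        rw [mem_sphere_zero_iff_norm, norm_smul, norm_inv, norm_norm,
          inv_mul_cancel₀ (norm_ne_zero_iff.2 hx)]
      rw [he] at this
      exact this
    subst hx
    simp [dotProduct]
  obtain ⟨x₀, hx₀, hmin⟩ := (isCompact_sphere (0 : Param d) 1).exists_isMinOn hne hQc.continuousOn
  refine ⟨Q x₀, hpos x₀ (ne_zero_of_mem_unit_sphere ⟨x₀, hx₀⟩), fun x => ?_⟩
  rcases eq_or_ne x 0 with rfl | hx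
  · simp [dotProduct]
  have hxn : ‖x‖ ≠ 0 := norm_ne_zero_iff.2 hx
  have h1 : ‖x‖⁻¹ • x ∈ Metric.sphere (0 : Param d) 1 := by
    rw [mem_sphere_zero_iff_norm, norm_smul, norm_inv, norm_norm, inv_mul_cancel₀ hxn]
  have h2 : Q x₀ ≤ Q (‖x‖⁻¹ • x) := hmin h1
  rw [hsmul, inv_pow, ← div_eq_inv_mul, le_div_iff₀ (by positivity)] at h2
  exact h2

/-- The information terms are positive semidefinite. -/
lemma quadForm_infoTerm_nonneg (hh : IsBase h)
    (hA : ∀ θ ∈ Θ, ∀ p ∈ admissible h, fInf f θ p ∈ meanRange h) {y : Path} {n : ℕ}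
    (hy : shift^[n] y ∈ goodPaths h) (hθ : θ ∈ Θ) (x : Param d) :
    0 ≤ (fun i => x i) ⬝ᵥ (infoTerm h f Θ y n θ).mulVec fun i => x i := by
  have h1 : ((fun i => x i) ⬝ᵥ (infoTerm h f Θ y n θ).mulVec fun i => x i) =
      varFun h (eta h f y n θ) * (∑ i, x i * partialD Θ i (eta h f y n) θ) ^ 2 := by
    rw [quadForm_eq_sum, sq, Finset.sum_mul_sum, Finset.mul_sum]
    refine Finset.sum_congr rfl fun i _ => ?_
    rw [Finset.mul_sum]
    refine Finset.sum_congr rfl fun j _ => ?_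
    simp only [infoTerm, Matrix.of_apply]
    ring
  rw [h1]
  have h2 : eta h f y n θ ∈ natParam h := by
    rw [eta_eq_pastEta]
    exact meanInv_mem (hA θ hθ _ hy.1)
  exact mul_nonneg (varFun_pos hh h2).le (sq_nonneg _)

/-- The averaged information terms are eventually uniformly coercive near the true parameter. -/
lemma exists_average_info_ge (hh : IsBase h)
    (hA : ∀ θ ∈ Θ, ∀ p ∈ admissible h, fInf f θ p ∈ meanRange h) (hA5 : AssumptionA5 h f Θ)
    (hr : IsRegime h f θ₀ μ) (he : Ergodic shift μ) {R : ℝ} (hR : LocalBounds h f Θ θ₀ μ R)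
    (hpd : (Matrix.of fun i j => ∫ y, infoEntry h f Θ i j y θ₀ ∂μ).PosDef) :
    ∃ c > (0 : ℝ), ∃ r > (0 : ℝ), ∀ᵐ y ∂μ, ∀ u : ℕ → ℕ, Tendsto u atTop atTop →
      ∀ᶠ n in atTop, ∀ θ, dist θ θ₀ < r → ∀ x : Param d, (u n : ℝ) * (c * ‖x‖ ^ 2) ≤
        ∑ t ∈ Finset.Icc 1 (u n), ((fun i => x i) ⬝ᵥ
          (infoTerm h f Θ y t θ).mulVec fun i => x i) := by
  have hprob := hr.prob
  have hgood : ∀ᵐ y ∂μ, y ∈ goodPaths h := hr.ae_good.mono fun y hy => hy 0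
  obtain ⟨c, hc, hM⟩ := exists_coercive hpd
  -- Each entry errs by at most 3ε: two ergodic errors and one mean oscillation. The d² entries
  -- together then use at most half of the coercivity constant.
  set ε := c / (6 * ((d : ℝ) ^ 2 + 1)) with hε
  have hε0 : 0 < ε := by positivity
  have hεc : (d : ℝ) ^ 2 * (3 * ε) ≤ c / 2 := by
    have : 6 * ((d : ℝ) ^ 2 + 1) * ε = c := by rw [hε]; field_simp
    nlinarith
  choose hI r hr0 D hDi hDε hD using fun i j =>
    hR.exists_oscillation hh hA hA5 hgood i j hε0
  have hD' : ∀ᵐ y ∂μ, ∀ (t : ℕ) i j, ∀ θ ∈ Metric.ball θ₀ (r i j),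
      |infoEntry h f Θ i j (shift^[t] y) θ - infoEntry h f Θ i j (shift^[t] y) θ₀| ≤
        D i j (shift^[t] y) := ae_all_iff.2 fun t => ae_all_iff.2 fun i => ae_all_iff.2 fun j =>
    (hr.shift.iterate t).quasiMeasurePreserving.ae (hD i j)
  obtain ⟨r', hr'0, hr'⟩ : ∃ r' > (0 : ℝ), ∀ i j, r' ≤ r i j := by
    have h1 : ∀ᶠ s in 𝓝[>] (0 : ℝ), ∀ i j, s ≤ r i j :=
      eventually_all.2 fun i => eventually_all.2 fun j =>
        (ge_mem_nhds (hr0 i j)).filter_mono nhdsWithin_le_nhds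
    obtain ⟨s, hs, hs0⟩ := (h1.and self_mem_nhdsWithin).exists
    exact ⟨s, hs0, hs⟩
  refine ⟨c / 2, by positivity, r', hr'0, ?_⟩
  filter_upwards [ae_all_iff.2 fun i => ae_all_iff.2 fun j => ae_window_average he (hI i j),
    ae_all_iff.2 fun i => ae_all_iff.2 fun j => ae_window_average he (hDi i j), hD']
    with y hy1 hy2 hy3 u hu
  have hw : IsWindow (fun _ => 0) u 1 := ⟨fun n => Nat.zero_le _, by simpa using hu,
    Eventually.of_forall fun n => by simp⟩
  filter_upwards [eventually_all.2 fun i => eventually_all.2 fun j => hy1 i j _ _ _ hw ε hε0,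
    eventually_all.2 fun i => eventually_all.2 fun j => hy2 i j _ _ _ hw ε hε0]
    with n hn1 hn2 θ hθ x
  have hIcc : Finset.Icc 1 (u n) = Finset.Ioc 0 (u n) := by
    ext t
    simp [Nat.one_le_iff_ne_zero, Nat.pos_iff_ne_zero]
  have hun : (0 : ℝ) ≤ u n := Nat.cast_nonneg _
  set S : Fin d → Fin d → ℝ := fun i j =>
    ∑ t ∈ Finset.Ioc 0 (u n), infoEntry h f Θ i j (shift^[t] y) θ with hS
  have hSd : ∀ i j, |S i j - u n * ∫ y, infoEntry h f Θ i j y θ₀ ∂μ| ≤ u n * (3 * ε) := by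
    intro i j
    have h1 : |S i j - ∑ t ∈ Finset.Ioc 0 (u n), infoEntry h f Θ i j (shift^[t] y) θ₀| ≤
        ∑ t ∈ Finset.Ioc 0 (u n), D i j (shift^[t] y) := by
      rw [hS, ← Finset.sum_sub_distrib]
      exact (Finset.abs_sum_le_sum_abs _ _).trans (Finset.sum_le_sum fun t _ =>
        hy3 t i j θ (Metric.mem_ball.2 (hθ.trans_le (hr' i j))))
    have h2 := hn1 i j
    have h3 := (abs_le.1 (hn2 i j)).2
    have h4 := mul_le_mul_of_nonneg_left (hDε i j) hun
    simp only [Nat.cast_zero, sub_zero] at h2 h3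
    have h5 := abs_sub_le (S i j) (∑ t ∈ Finset.Ioc 0 (u n), infoEntry h f Θ i j (shift^[t] y) θ₀)
      (u n * ∫ y, infoEntry h f Θ i j y θ₀ ∂μ)
    linarith
  have hsum : ∑ t ∈ Finset.Icc 1 (u n), ((fun i => x i) ⬝ᵥ
      (infoTerm h f Θ y t θ).mulVec fun i => x i) = ∑ i, ∑ j, x i * x j * S i j := by
    simp_rw [quadForm_eq_sum, infoTerm_apply, hIcc, hS, Finset.mul_sum]
    rw [Finset.sum_comm]
    exact Finset.sum_congr rfl fun i _ => Finset.sum_comm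
  have hxi : ∀ i, |x i| ≤ ‖x‖ := fun i => by
    have := PiLp.norm_apply_le x i
    rwa [Real.norm_eq_abs] at this
  have hterm : ∀ i j, u n * (x i * x j * ∫ y, infoEntry h f Θ i j y θ₀ ∂μ) -
      u n * (3 * ε) * ‖x‖ ^ 2 ≤ x i * x j * S i j := by
    intro i j
    have h1 : |x i * x j * (S i j - u n * ∫ y, infoEntry h f Θ i j y θ₀ ∂μ)| ≤
        ‖x‖ ^ 2 * (u n * (3 * ε)) := by
      rw [abs_mul, abs_mul, sq]
      exact mul_le_mul (mul_le_mul (hxi i) (hxi j) (abs_nonneg _) (norm_nonneg _)) (hSd i j)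
        (abs_nonneg _) (by positivity)
    have h2 := (abs_le.1 h1).1
    linarith
  have h1 := Finset.sum_le_sum fun i (_ : i ∈ Finset.univ) =>
    Finset.sum_le_sum fun j (_ : j ∈ Finset.univ) => hterm i j
  have h2 := hM x
  rw [quadForm_eq_sum] at h2
  simp only [Finset.sum_sub_distrib, Finset.sum_const, Finset.card_univ, Fintype.card_fin,
    nsmul_eq_mul, ← Finset.mul_sum] at h1
  simp only [Matrix.of_apply] at h2
  rw [hsum]
  have h3 := mul_le_mul_of_nonneg_left h2 hun
  have h4 := mul_le_mul_of_nonneg_left (mul_le_mul_of_nonneg_right hεc (sq_nonneg ‖x‖)) hun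
  nlinarith

end Information

/-! ### Assumptions in terms of the law of the path -/

section Transfer

variable {Ω : Type*} [MeasurableSpace Ω] {P : Measure Ω} {d : ℕ} {h : ℕ → ℝ}
  {f : Param d → ℝ → ℕ → ℝ} {Θ : Set (Param d)} {θ₀ : Param d} {Y : ℤ → Ω → ℕ}

/-- Identifiability is assumed at times t ≥ 1, whereas the past is taken at time 0; shift invariance
moves the identity by one step. -/
lemma ProcessAssumptions.eq_of_ae_eq (hY : ProcessAssumptions h f Θ P θ₀ Y)
    (hm : Measurable (pathOf Y)) (hr : IsRegime h f θ₀ (P.map (pathOf Y))) {θ : Param d}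
    (hθ : θ ∈ Θ)
    (heq : ∀ᵐ y ∂P.map (pathOf Y), fInf f θ (past y) = fInf f θ₀ (past y)) : θ = θ₀ := by
  refine hY.a4 θ hθ ⟨1, le_rfl, ?_⟩
  filter_upwards [ae_of_ae_map hm.aemeasurable (hr.shift.quasiMeasurePreserving.ae heq)]
    with ω hω
  have h1 := fitted_eq f (pathOf Y ω) 1
  rw [Nat.cast_one] at h1
  change fitted f (pathOf Y ω) 1 θ = fitted f (pathOf Y ω) 1 θ₀
  rw [h1]
  exact hω

lemma ProcessAssumptions.exists_localBounds (hh : IsBase h)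
    (hA : ∀ θ ∈ Θ, ∀ p ∈ admissible h, fInf f θ p ∈ meanRange h) (hA5 : AssumptionA5 h f Θ)
    (hY : ProcessAssumptions h f Θ P θ₀ Y) (hm : Measurable (pathOf Y))
    (hr : IsRegime h f θ₀ (P.map (pathOf Y))) :
    ∃ R, LocalBounds h f Θ θ₀ (P.map (pathOf Y)) R := by
  obtain ⟨R, hR0, hR⟩ := Metric.isOpen_iff.1 isOpen_interior θ₀ hY.a0
  refine ⟨R, hR0, hR, fun i j => ?_, fun i j => ?_⟩
  · rw [lintegral_map' (aemeasurable_biSup_infoEntry hh hA hA5 hr.admissible hR i j)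
      hm.aemeasurable]
    refine (lintegral_mono fun ω => ?_).trans_lt (hY.a6_first 0 i j)
    refine (biSup_mono (hR.trans interior_subset)).trans (le_of_eq ?_)
    refine biSup_congr fun θ _ => ?_
    rw [← infoTerm_pathOf]
    rfl
  · rw [lintegral_map' (aemeasurable_biSup_curvEntry hh hA hA5 hr.admissible hR i j)
      hm.aemeasurable]
    refine (lintegral_mono fun ω => ?_).trans_lt (hY.a6_second 0 i j)
    refine (biSup_mono (hR.trans interior_subset)).trans (le_of_eq ?_)
    refine biSup_congr fun θ _ => ?_
    have h1 : eta h f (fun s => Y s ω) 0 = pastEta h f (past (pathOf Y ω)) :=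
      eta_zero (pathOf Y ω)
    rw [curvEntry, h1]
    rfl

lemma info_eq (hh : IsBase h)
    (hA : ∀ θ ∈ Θ, ∀ p ∈ admissible h, fInf f θ p ∈ meanRange h) (hA5 : AssumptionA5 h f Θ)
    (hθ₀ : θ₀ ∈ interior Θ) (hm : Measurable (pathOf Y))
    (hr : IsRegime h f θ₀ (P.map (pathOf Y))) :
    info h f Θ P Y θ₀ =
      Matrix.of fun i j => ∫ y, infoEntry h f Θ i j y θ₀ ∂P.map (pathOf Y) := by
  ext i j
  simp only [info, Matrix.of_apply]
  rw [integral_map hm.aemeasurable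
    (aemeasurable_infoEntry hh hA hA5 hr.admissible hθ₀ i j).aestronglyMeasurable]
  exact integral_congr_ae (Eventually.of_forall fun ω => infoTerm_pathOf ω θ₀ i j)

end Transfer

end CountSeries
end

noncomputable section

namespace CountSeries

/-! ### Consistency of the maximum likelihood estimators -/

section Separation

variable {d : ℕ} {h : ℕ → ℝ} {f : Param d → ℝ → ℕ → ℝ} {Θ : Set (Param d)}
  {θ₀ : Param d} {μ : Measure Path}

/-- Parameters far from the true one have eventually a larger total loss than parameters near the
true one. -/
lemma exists_separation (hh : IsBase h)
    (hA : ∀ θ ∈ Θ, ∀ p ∈ admissible h, fInf f θ p ∈ meanRange h) (hA2 : AssumptionA2 h f Θ)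
    (hA5 : AssumptionA5 h f Θ) (hΘ : IsCompact Θ) (hr : IsRegime h f θ₀ μ)
    (he : Ergodic shift μ) (hθ₀ : θ₀ ∈ Θ)
    (hid : ∀ θ ∈ Θ, (∀ᵐ y ∂μ, fInf f θ (past y) = fInf f θ₀ (past y)) → θ = θ₀)
    {R : ℝ} (hR : LocalBounds h f Θ θ₀ μ R) {r : ℝ} (hr0 : 0 < r) :
    ∃ ρ > (0 : ℝ), ∀ᵐ y ∂μ, ∀ a b C z δ, IsWindow a b C → IsShadow h f Θ y z a b δ →
      (∃ γ > (0 : ℝ), Tendsto (fun n => δ n * Real.exp (γ * b n)) atTop (𝓝 0)) →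
      ∀ᶠ n in atTop, ∀ θ ∈ Θ, ∀ θ' ∈ Θ, dist θ θ₀ ≤ ρ → r ≤ dist θ' θ₀ →
        ∑ t ∈ Finset.Ioc (a n) (b n), loss h f θ (shift^[t] (z n)) <
          ∑ t ∈ Finset.Ioc (a n) (b n), loss h f θ' (shift^[t] (z n)) := by
  obtain ⟨c, hc, h1⟩ := exists_average_loss_ge hh hA hA2 hΘ hr he hθ₀ hid hr0
  -- With c in the lower bound and c / 2 in the upper one, the gap is strict as soon as the window
  -- is non-empty.
  obtain ⟨ρ, hρ, h2⟩ := exists_average_loss_le hh hA hA5 hr he hθ₀ hR (half_pos hc)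
  refine ⟨ρ, hρ, ?_⟩
  filter_upwards [h1, h2] with y hy1 hy2 a b C z δ hw hs hδ
  have hδ0 : Tendsto δ atTop (𝓝 0) := by
    obtain ⟨γ, hγ, hδγ⟩ := hδ
    refine squeeze_zero_norm (fun n => ?_) (tendsto_zero_iff_norm_tendsto_zero.1 hδγ)
    rw [norm_mul, Real.norm_of_nonneg (Real.exp_pos _).le]
    exact le_mul_of_one_le_right (norm_nonneg _) (Real.one_le_exp (by positivity))
  filter_upwards [hy1 a b C z δ hw hs hδ0, hy2 a b C z δ hw hs hδ,
    hw.tendsto_real.eventually_gt_atTop 0] with n hn1 hn2 hn3 θ hθ θ' hθ' hd hd'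
  have h3 := hn1 θ' hθ' hd'
  have h4 := hn2 θ hθ hd
  nlinarith

lemma isWindow_zero {b : ℕ → ℕ} (hb : Tendsto b atTop atTop) : IsWindow (fun _ => 0) b 1 :=
  ⟨fun _ => Nat.zero_le _, by simpa using hb, Eventually.of_forall fun _ => by simp⟩

lemma IsMLE.sum_loss_le {z : Path} (hz : ∀ t : ℕ, shift^[t] z ∈ goodPaths h) {k k' : ℕ}
    {e θ : Param d} (he : IsMLE h f Θ z (k + 1) k' e) (hθ : θ ∈ Θ) :
    ∑ t ∈ Finset.Ioc k k', loss h f e (shift^[t] z) ≤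
      ∑ t ∈ Finset.Ioc k k', loss h f θ (shift^[t] z) := by
  have h1 : segLogLik h f z (k + 1) k' θ ≤ segLogLik h f z (k + 1) k' e := he.2 hθ
  have h2 : Finset.Icc (k + 1) k' = Finset.Ioc k k' := by
    ext t
    simp
  simp only [segLogLik, h2, logLik_eq (hz _), Finset.sum_sub_distrib, Finset.sum_neg_distrib] at h1
  linarith

end Separation

/-! ### Paths with a change -/

section Concat

variable {d : ℕ} {h : ℕ → ℝ} {f : Param d → ℝ → ℕ → ℝ} {Θ : Set (Param d)} {δ₁ δ₂ : ℝ}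
  {y₁ y₂ : Path} {s : ℕ}

/-- The past at time s + 1 ends at time s, so it is still that of the first regime. -/
lemma past_concat_of_le {t : ℕ} (hts : t ≤ s + 1) :
    past (shift^[t] (concat s y₁ y₂)) = past (shift^[t] y₁) := by
  ext k
  simp only [past_iterate_shift, concat]
  rw [if_pos (by omega)]

lemma concat_apply_of_le {t : ℕ} (hts : t ≤ s) : concat s y₁ y₂ t = y₁ t := by
  rw [concat, if_pos (by omega)]

lemma concat_apply_of_lt {t : ℕ} (hts : s < t) : concat s y₁ y₂ t = y₂ t := by
  rw [concat, if_neg (by omega)]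

lemma iterate_shift_zero (t : ℕ) (y : Path) : shift^[t] y 0 = y t := by
  rw [iterate_shift_apply, zero_add]

lemma past_iterate_shift_succ (t : ℕ) (y : Path) :
    past (shift^[t + 1] y) = cons (y t) (past (shift^[t] y)) := by
  rw [Function.iterate_succ_apply', past_shift, iterate_shift_zero]

lemma past_concat_admissible (h₁ : ∀ t : ℕ, shift^[t] y₁ ∈ goodPaths h)
    (h₂ : ∀ t : ℕ, shift^[t] y₂ ∈ goodPaths h) (m : ℕ) :
    past (shift^[s + 1 + m] (concat s y₁ y₂)) ∈ admissible h := by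
  induction m with
  | zero =>
    rw [add_zero, past_concat_of_le le_rfl]
    exact (h₁ _).1
  | succ m ih =>
    rw [← add_assoc, past_iterate_shift_succ, concat_apply_of_lt (by omega),
      ← iterate_shift_zero (s + 1 + m) y₂]
    exact admissible_cons (h₂ _).2 ih

lemma concat_mem_goodPaths (h₁ : ∀ t : ℕ, shift^[t] y₁ ∈ goodPaths h)
    (h₂ : ∀ t : ℕ, shift^[t] y₂ ∈ goodPaths h) (t : ℕ) :
    shift^[t] (concat s y₁ y₂) ∈ goodPaths h := by
  rcases le_or_gt t s with hts | hts
  · refine ⟨?_, ?_⟩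
    · rw [past_concat_of_le (hts.trans (Nat.le_succ s))]
      exact (h₁ t).1
    · rw [iterate_shift_zero, concat_apply_of_le hts, ← iterate_shift_zero t y₁]
      exact (h₁ t).2
  · refine ⟨?_, ?_⟩
    · obtain ⟨m, rfl⟩ := Nat.exists_eq_add_of_le hts
      exact past_concat_admissible h₁ h₂ m
    · rw [iterate_shift_zero, concat_apply_of_lt hts, ← iterate_shift_zero t y₂]
      exact (h₂ t).2

/-- After the change, the influence of the previous observations decays geometrically. -/
lemma abs_fInf_concat_sub_le (hc : IsContractive f Θ δ₁ δ₂)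
    (h₁ : ∀ t : ℕ, shift^[t] y₁ ∈ goodPaths h) (h₂ : ∀ t : ℕ, shift^[t] y₂ ∈ goodPaths h)
    {θ : Param d} (hθ : θ ∈ Θ) (m : ℕ) :
    |fInf f θ (past (shift^[s + 1 + m] (concat s y₁ y₂))) -
        fInf f θ (past (shift^[s + 1 + m] y₂))| ≤
      δ₁ ^ m * (discount δ₁ (past (shift^[s + 1] y₁)) + discount δ₁ (past (shift^[s + 1] y₂))) := by
  induction m with
  | zero =>
    rw [add_zero, past_concat_of_le le_rfl, pow_zero, one_mul]
    exact abs_fInf_sub_le hc hθ (h₁ _).1 (h₂ _).1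
  | succ m ih =>
    have hz := past_concat_admissible (s := s) h₁ h₂ m
    have hp := (h₂ (s + 1 + m)).1
    have hpos : 0 < h (y₂ ((s + 1 + m : ℕ) : ℤ)) := by
      rw [← iterate_shift_zero _ y₂]
      exact (h₂ _).2
    rw [← add_assoc, past_iterate_shift_succ, past_iterate_shift_succ,
      concat_apply_of_lt (by omega), fInf_cons hc hθ hpos hz, fInf_cons hc hθ hpos hp]
    refine (hc.lip θ hθ _ _ (fInf_nonneg hc hθ hz) (fInf_nonneg hc hθ hp) _ _).trans ?_
    rw [sub_self, abs_zero, mul_zero, add_zero, pow_succ', mul_assoc]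
    exact mul_le_mul_of_nonneg_left ih hc.fst_nonneg

lemma discount_cons {r : ℝ} (hr0 : 0 ≤ r) (hr1 : r < 1) (a : ℕ) {p : ℕ → ℕ}
    (hp : p ∈ admissible h) : discount r (cons a p) = a + r * discount r p := by
  have h1 : Summable fun k => r ^ k * (cons a p k : ℝ) := by
    rw [← summable_nat_add_iff 1]
    refine ((hp.2 r hr0 hr1).mul_left r).congr fun k => ?_
    rw [cons_succ, pow_succ]
    ring
  rw [discount, h1.tsum_eq_zero_add, discount, ← tsum_mul_left]
  simp only [pow_zero, cons_zero, one_mul, cons_succ, pow_succ]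
  congr 1
  exact tsum_congr fun k => by ring

/-- The value (n + K) / (1 - r) is the fixed point of x ↦ n + K + r x, the step performed by
prepending an observation of size at most n + K. -/
lemma discount_past_le {r K : ℝ} (hr0 : 0 ≤ r) (hr1 : r < 1)
    (h₁ : ∀ t : ℕ, shift^[t] y₁ ∈ goodPaths h) (hK : ∀ t : ℕ, (y₁ t : ℝ) ≤ t + K) (n : ℕ) :
    discount r (past (shift^[n] y₁)) ≤ (n + K) / (1 - r) + discount r (past y₁) := by
  have hr : 0 < 1 - r := sub_pos.2 hr1
  have hD := discount_nonneg hr0 (past y₁)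
  have hK0 : 0 ≤ K := by simpa using (Nat.cast_nonneg (α := ℝ) _).trans (hK 0)
  induction n with
  | zero =>
    rw [Function.iterate_zero, id]
    have : 0 ≤ ((0 : ℕ) + K) / (1 - r) := div_nonneg (by simpa using hK0) hr.le
    linarith
  | succ n ih =>
    rw [past_iterate_shift_succ, discount_cons hr0 hr1 _ (h₁ n).1]
    have h1 := mul_le_mul_of_nonneg_left ih hr0
    have h2 := hK n
    have h3 : (n : ℝ) + K + r * ((n + K) / (1 - r)) = (n + K) / (1 - r) := by
      field_simp
      ring
    have h4 : ((n : ℝ) + K) / (1 - r) ≤ (((n + 1 : ℕ) : ℝ) + K) / (1 - r) := by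
      gcongr
      simp
    have h5 : r * discount r (past y₁) ≤ discount r (past y₁) :=
      mul_le_of_le_one_left hD hr1.le
    linarith

lemma isShadow_concat_left (h₁ : ∀ t : ℕ, shift^[t] y₁ ∈ goodPaths h)
    (h₂ : ∀ t : ℕ, shift^[t] y₂ ∈ goodPaths h) {s a b : ℕ → ℕ} (hbs : ∀ᶠ n in atTop, b n ≤ s n) :
    IsShadow h f Θ y₁ (fun n => concat (s n) y₁ y₂) a b fun _ => 0 := by
  filter_upwards [hbs] with n hn t ht
  have hts := (Finset.mem_Ioc.1 ht).2.trans hn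
  refine ⟨concat_mem_goodPaths h₁ h₂ t, fun θ _ => ?_⟩
  rw [pred, pred, past_concat_of_le (hts.trans (Nat.le_succ _)), iterate_shift_zero,
    iterate_shift_zero, concat_apply_of_le hts, sub_self, abs_zero]

/-- At least κn steps after the change, the wrong past is damped by δ₁ to the power κn, while the
discounted pasts at the change grow only linearly in n. -/
lemma isShadow_concat_right (hh : IsBase h)
    (hA : ∀ θ ∈ Θ, ∀ p ∈ admissible h, fInf f θ p ∈ meanRange h) (hc : IsContractive f Θ δ₁ δ₂)
    (h₁ : ∀ t : ℕ, shift^[t] y₁ ∈ goodPaths h) (h₂ : ∀ t : ℕ, shift^[t] y₂ ∈ goodPaths h)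
    {K κ : ℝ} (hK₁ : ∀ t : ℕ, (y₁ t : ℝ) ≤ t + K) (hK₂ : ∀ t : ℕ, (y₂ t : ℝ) ≤ t + K)
    (hκ : 0 < κ) {s a : ℕ → ℕ} (hs : ∀ n, s n ≤ n) (hsa : ∀ n : ℕ, (s n : ℝ) + κ * n ≤ a n) :
    ∃ δ : ℕ → ℝ, IsShadow h f Θ y₂ (fun n => concat (s n) y₁ y₂) a (fun n => n) δ ∧
      ∃ γ > (0 : ℝ), Tendsto (fun n : ℕ => δ n * Real.exp (γ * n)) atTop (𝓝 0) := by
  have hδ0 := hc.fst_nonneg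
  have hδ1 := hc.fst_lt_one
  have hK0 : 0 ≤ K := by simpa using (Nat.cast_nonneg (α := ℝ) _).trans (hK₁ 0)
  -- Kept away from 0, since δ₁ = 0 is allowed and a logarithm is taken.
  set ρ := max δ₁ (1 / 2) with hρ
  have hρ0 : 0 < ρ := lt_of_lt_of_le (by norm_num) (le_max_right _ _)
  have hρ1 : ρ < 1 := max_lt hδ1 (by norm_num)
  have hL : 0 < -Real.log ρ := neg_pos.2 (Real.log_neg hρ0 hρ1)
  -- Half of the available rate: the error decays like exp (-2γn) up to a linear factor, which
  -- leaves exp (-γn) after multiplication by exp (γn).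
  set γ := -Real.log ρ * κ / 2 with hγ
  have hγ0 : 0 < γ := by positivity
  set D := discount δ₁ (past y₁) + discount δ₁ (past y₂) with hD
  have hD0 : 0 ≤ D := add_nonneg (discount_nonneg hδ0 _) (discount_nonneg hδ0 _)
  set B := 2 * ((1 + K) / (1 - δ₁)) + D with hB
  have h1δ : 0 < 1 - δ₁ := sub_pos.2 hδ1
  have hB0 : 0 ≤ B := by positivity
  refine ⟨fun n => B * ((n : ℝ) + 1) * Real.exp (-(2 * γ * n)), ?_, γ, hγ0, ?_⟩
  · refine Eventually.of_forall fun n t ht => ⟨concat_mem_goodPaths h₁ h₂ t, fun θ hθ => ?_⟩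
    have hat := (Finset.mem_Ioc.1 ht).1
    have hsat : (s n : ℝ) + κ * n + 1 ≤ t := by
      have : (a n : ℝ) + 1 ≤ t := by exact_mod_cast hat
      linarith [hsa n]
    have hst : s n + 1 ≤ t := by
      have : ((s n + 1 : ℕ) : ℝ) ≤ t := by
        push_cast
        have : 0 ≤ κ * n := by positivity
        linarith
      exact_mod_cast this
    obtain ⟨m, rfl⟩ := Nat.exists_eq_add_of_le hst
    push_cast at hsat
    have hm : κ * n ≤ m := by linarith
    have hg := concat_mem_goodPaths (s := s n) h₁ h₂ (s n + 1 + m)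
    have h3 : |pred h f θ (shift^[s n + 1 + m] (concat (s n) y₁ y₂)) -
        pred h f θ (shift^[s n + 1 + m] y₂)| ≤ δ₁ ^ m *
          (discount δ₁ (past (shift^[s n + 1] y₁)) + discount δ₁ (past (shift^[s n + 1] y₂))) := by
      rw [pred, pred, iterate_shift_zero, iterate_shift_zero, concat_apply_of_lt (by omega)]
      exact (abs_law_sub_le hh (hA θ hθ _ hg.1) (hA θ hθ _ (h₂ _).1) _).trans
        (abs_fInf_concat_sub_le hc h₁ h₂ hθ m)
    refine h3.trans ?_
    have h4 : δ₁ ^ m ≤ Real.exp (-(2 * γ * n)) := by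
      calc δ₁ ^ m ≤ ρ ^ m := pow_le_pow_left₀ hδ0 (le_max_left _ _) m
        _ = Real.exp (m * Real.log ρ) := by rw [Real.exp_nat_mul, Real.exp_log hρ0]
        _ ≤ Real.exp (-(2 * γ * n)) := Real.exp_le_exp.2 (by rw [hγ]; nlinarith)
    have hdisc : ∀ y : Path, (∀ t : ℕ, shift^[t] y ∈ goodPaths h) →
        (∀ t : ℕ, (y t : ℝ) ≤ t + K) → discount δ₁ (past (shift^[s n + 1] y)) ≤
          ((n : ℝ) + 1) * ((1 + K) / (1 - δ₁)) + ((n : ℝ) + 1) * discount δ₁ (past y) := by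
      intro y hy hyK
      refine (discount_past_le hδ0 hδ1 hy hyK (s n + 1)).trans (add_le_add ?_ ?_)
      · rw [← mul_div_assoc]
        gcongr
        have : (s n : ℝ) ≤ n := by exact_mod_cast hs n
        have hn : (0 : ℝ) ≤ n * K := by positivity
        push_cast
        linarith
      · have hn : (0 : ℝ) ≤ n := Nat.cast_nonneg n
        exact le_mul_of_one_le_left (discount_nonneg hδ0 _) (by linarith)
    have h5 : discount δ₁ (past (shift^[s n + 1] y₁)) + discount δ₁ (past (shift^[s n + 1] y₂)) ≤
        B * ((n : ℝ) + 1) := by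
      have h6 := hdisc y₁ h₁ hK₁
      have h7 := hdisc y₂ h₂ hK₂
      rw [hB, hD]
      linarith
    refine le_of_le_of_eq ?_ (mul_comm _ _)
    exact mul_le_mul h4 h5 (add_nonneg (discount_nonneg hδ0 _) (discount_nonneg hδ0 _))
      (Real.exp_pos _).le
  · have hr1 : Real.exp (-γ) < 1 := by simpa using hγ0
    have h1 := ((tendsto_self_mul_const_pow_of_lt_one (Real.exp_pos (-γ)).le hr1).add
      (tendsto_pow_atTop_nhds_zero_of_lt_one (Real.exp_pos (-γ)).le hr1)).const_mul B
    rw [add_zero, mul_zero] at h1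
    refine h1.congr fun n => ?_
    rw [← Real.exp_nat_mul, mul_assoc _ (Real.exp _), ← Real.exp_add,
      show -(2 * γ * (n : ℝ)) + γ * n = n * -γ by ring]
    ring

lemma infoTerm_concat {t : ℕ} (hts : t ≤ s) (θ : Param d) :
    infoTerm h f Θ (concat s y₁ y₂) t θ = infoTerm h f Θ y₁ t θ := by
  ext i j
  rw [infoTerm_apply, infoTerm_apply, infoEntry, infoEntry,
    past_concat_of_le (hts.trans (Nat.le_succ _))]

end Concat

/-! ### Lower bounds for the test statistic -/

section Statistic

variable {d : ℕ} {h : ℕ → ℝ} {f : Param d → ℝ → ℕ → ℝ} {Θ : Set (Param d)} {q : ℝ → ℝ}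
  {z : Path} {n u v k : ℕ} {est : ℕ → ℕ → Param d}

/-- The second average runs over both regimes; being positive semidefinite it can be dropped, at the
price of the factor 1 / 2. -/
lemma quadForm_infoHat_ge (hh : IsBase h)
    (hA : ∀ θ ∈ Θ, ∀ p ∈ admissible h, fInf f θ p ∈ meanRange h)
    (hz : ∀ t : ℕ, shift^[t] z ∈ goodPaths h) (hu : 0 < u) (hun : u ≤ n)
    (hest : est (u + 1) n ∈ Θ) (x : Param d) {c : ℝ}
    (hc : (u : ℝ) * c ≤ ∑ t ∈ Finset.Icc 1 u, ((fun i => x i) ⬝ᵥ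
      (infoTerm h f Θ z t (est 1 u)).mulVec fun i => x i)) :
    c / 2 ≤ (fun i => x i) ⬝ᵥ (infoHat h f Θ n u z est).mulVec fun i => x i := by
  have hu' : (0 : ℝ) < u := by exact_mod_cast hu
  have hun' : (u : ℝ) ≤ n := by exact_mod_cast hun
  simp only [infoHat, Matrix.smul_mulVec, Matrix.add_mulVec, Matrix.sum_mulVec, dotProduct_smul,
    dotProduct_add, dotProduct_sum, smul_eq_mul]
  have h1 : 0 ≤ ∑ t ∈ Finset.Icc (u + 1) n, ((fun i => x i) ⬝ᵥ
      (infoTerm h f Θ z t (est (u + 1) n)).mulVec fun i => x i) :=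
    Finset.sum_nonneg fun t _ => quadForm_infoTerm_nonneg hh hA (hz t) hest x
  have h2 : 0 ≤ 1 / ((n : ℝ) - u) := one_div_nonneg.2 (sub_nonneg.2 hun')
  have h3 := mul_nonneg h2 h1
  have h4 := mul_le_mul_of_nonneg_left hc (one_div_pos.2 hu').le
  rw [← mul_assoc, one_div_mul_cancel hu'.ne', one_mul] at h4
  linarith

/-- The factor k² (n - k)² / n³ is of order n when k and n - k are both proportional to n; the other
factors are bounded below. -/
lemma le_statAt (hn : 0 < n) {η Q c r : ℝ} (hη : 0 ≤ η) (hc : 0 ≤ c) (hr : 0 ≤ r)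
    (hk : η * n ^ 2 ≤ (k : ℝ) * ((n : ℝ) - k)) (hq0 : 0 < q ((k : ℝ) / n))
    (hq : q ((k : ℝ) / n) ≤ Q) (hdist : r ≤ dist (est 1 k) (est (k + 1) n))
    (hquad : ∀ x : Param d, c * ‖x‖ ^ 2 ≤
      (fun i => x i) ⬝ᵥ (infoHat h f Θ n u z est).mulVec fun i => x i) :
    1 / Q ^ 2 * η ^ 2 * (c * r ^ 2) * n ≤ statAt h f Θ q n u k z est := by
  have hn' : (0 : ℝ) < n := by exact_mod_cast hn
  have h1 : η ^ 2 * n ≤ (k : ℝ) ^ 2 * ((n : ℝ) - k) ^ 2 / (n : ℝ) ^ 3 := by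
    rw [le_div_iff₀ (by positivity)]
    calc η ^ 2 * n * (n : ℝ) ^ 3 = (η * n ^ 2) ^ 2 := by ring
      _ ≤ ((k : ℝ) * ((n : ℝ) - k)) ^ 2 := pow_le_pow_left₀ (by positivity) hk 2
      _ = _ := by ring
  have h2 : 1 / Q ^ 2 ≤ 1 / q ((k : ℝ) / n) ^ 2 :=
    one_div_le_one_div_of_le (by positivity) (pow_le_pow_left₀ hq0.le hq 2)
  have h3 : c * r ^ 2 ≤ _ := le_trans (by rw [dist_eq_norm] at hdist; gcongr)
    (hquad (est 1 k - est (k + 1) n))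
  calc 1 / Q ^ 2 * η ^ 2 * (c * r ^ 2) * n = 1 / Q ^ 2 * (η ^ 2 * n) * (c * r ^ 2) := by ring
    _ ≤ statAt h f Θ q n u k z est := by
      rw [statAt]
      gcongr

lemma statAt_le_changeStat (hv : v ≤ k) (hk : k + v ≤ n) :
    statAt h f Θ q n u k z est ≤ changeStat h f Θ q n u v z est := by
  refine le_csSup (Set.Finite.bddAbove ?_) ⟨k, ⟨hv, hk⟩, rfl⟩
  exact ((Set.finite_Iic n).subset fun k hk => (Nat.le_add_right k v).trans hk.2).image _

/-- A weight function is bounded on neighbourhoods of the endpoints. -/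
lemma IsWeight.exists_bound (hq : IsWeight q) : ∃ ε₀ > (0 : ℝ), ∀ ε, 0 < ε → ε < ε₀ →
    ∃ Q : ℝ, ∀ t, 0 < t → t ≤ ε → q t ≤ Q ∧ q (1 - t) ≤ Q := by
  obtain ⟨a, ha, hqa⟩ := hq.mono_zero
  obtain ⟨b, hb, hqb⟩ := hq.anti_one
  refine ⟨min a b, lt_min ha hb, fun ε hε hεab => ⟨max (q ε) (q (1 - ε)), fun t ht htε => ?_⟩⟩
  have hεa := hεab.trans_le (min_le_left _ _)
  have hεb := hεab.trans_le (min_le_right _ _)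
  refine ⟨(hqa ⟨ht, htε.trans_lt hεa⟩ ⟨hε, hεa⟩ htε).trans (le_max_left _ _),
    (hqb ⟨by linarith, by linarith⟩ ⟨by linarith, by linarith⟩ (by linarith)).trans
      (le_max_right _ _)⟩

/-- Comparing the estimators on overlapping segments: the losses on the extreme segments. -/
lemma sum_loss_exchange (hz : ∀ t : ℕ, shift^[t] z ∈ goodPaths h) {k₀ k₁ : ℕ} (h₀₁ : k₀ ≤ k₁)
    (h₁n : k₁ ≤ n) {a b : Param d} (ha : IsMLE h f Θ z (k₀ + 1) n a)
    (hb : IsMLE h f Θ z (0 + 1) k₁ b) :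
    ∑ t ∈ Finset.Ioc 0 k₀, loss h f b (shift^[t] z) +
        ∑ t ∈ Finset.Ioc k₁ n, loss h f a (shift^[t] z) ≤
      ∑ t ∈ Finset.Ioc 0 k₀, loss h f a (shift^[t] z) +
        ∑ t ∈ Finset.Ioc k₁ n, loss h f b (shift^[t] z) := by
  have h1 := ha.sum_loss_le hz hb.1
  have h2 := hb.sum_loss_le hz ha.1
  rw [← Finset.sum_Ioc_consecutive _ h₀₁ h₁n, ← Finset.sum_Ioc_consecutive _ h₀₁ h₁n] at h1
  rw [← Finset.sum_Ioc_consecutive _ (Nat.zero_le _) h₀₁,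
    ← Finset.sum_Ioc_consecutive _ (Nat.zero_le _) h₀₁] at h2
  linarith

end Statistic

/-! ### Convergence in probability -/

lemma tendsto_measure_lt_of_ae_tendsto_atTop {Ω : Type*} [MeasurableSpace Ω] {P : Measure Ω}
    [IsProbabilityMeasure P] {C : ℕ → Ω → ℝ} (hm : ∀ n, AEMeasurable (C n) P)
    (hC : ∀ᵐ ω ∂P, Tendsto (fun n => C n ω) atTop atTop) (c : ℝ) :
    Tendsto (fun n => P {ω | c < C n ω}) atTop (𝓝 1) := by
  have hs : ∀ n, NullMeasurableSet {ω | c < C n ω} P := fun n =>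
    nullMeasurableSet_lt aemeasurable_const (hm n)
  have h1 : Tendsto (fun n => ∫⁻ ω, {ω | c < C n ω}.indicator (1 : Ω → ENNReal) ω ∂P) atTop
      (𝓝 (∫⁻ _, 1 ∂P)) := by
    refine tendsto_lintegral_of_dominated_convergence' (fun _ => 1)
      (fun n => aemeasurable_one.indicator₀ (hs n))
      (fun n => Eventually.of_forall fun ω => Set.indicator_le_self' (fun _ _ => zero_le) ω)
      (by simp) ?_
    filter_upwards [hC] with ω hω
    refine tendsto_const_nhds.congr' ?_
    filter_upwards [hω.eventually_gt_atTop c] with n hn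
    exact (Set.indicator_of_mem (s := {ω | c < C n ω}) hn (1 : Ω → ENNReal)).symm
  simpa [lintegral_indicator_one₀ (hs _)] using h1

end CountSeries
end

/-! ### Divergence of the statistic -/

open CountSeries in
theorem mainTheorem2 {Ω : Type*} [MeasurableSpace Ω] (P : Measure Ω) [IsProbabilityMeasure P]
    {d : ℕ} (h : ℕ → ℝ) (hh : IsBase h)
    (Θ : Set (Param d)) (hΘ : IsCompact Θ)
    (f : Param d → ℝ → ℕ → ℝ) (hf : ∀ θ ∈ Θ, ∀ x : ℝ, 0 ≤ x → ∀ y : ℕ, 0 ≤ f θ x y)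
    (hLip : LipschitzCond f Θ)
    (hA1 : AssumptionA1 h f Θ) (hA2 : AssumptionA2 h f Θ) (hA5 : AssumptionA5 h f Θ)
    (θ₁ θ₂ : Param d) (hne : θ₁ ≠ θ₂)
    (X₁ X₂ : ℤ → Ω → ℝ) (Y₁ Y₂ : ℤ → Ω → ℕ)
    (hsol₁ : IsStationarySolution P h f θ₁ X₁ Y₁)
    (hsol₂ : IsStationarySolution P h f θ₂ X₂ Y₂)
    (hY₁ : ProcessAssumptions h f Θ P θ₁ Y₁)
    (hY₂ : ProcessAssumptions h f Θ P θ₂ Y₂)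
    (hinfo : (info h f Θ P Y₁ θ₁).PosDef)
    (τ : ℝ) (hτ : τ ∈ Set.Ioo (0 : ℝ) 1)
    (q : ℝ → ℝ) (hq : IsWeight q)
    (u v : ℕ → ℕ) (hu : Tendsto u atTop atTop) (hv : Tendsto v atTop atTop)
    (hun : Tendsto (fun n : ℕ => (u n : ℝ) / n) atTop (𝓝 0))
    (hvn : Tendsto (fun n : ℕ => (v n : ℝ) / n) atTop (𝓝 0))
    -- the observed process, for the sample size n
    (Y : ℕ → Ω → ℤ → ℕ)
    (hY : ∀ n ω, Y n ω = concat ⌊(n : ℝ) * τ⌋ (fun t => Y₁ t ω) (fun t => Y₂ t ω))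
    -- the estimators, for the sample size n and the times k, …, k'
    (est : ℕ → Ω → ℕ → ℕ → Param d)
    (hest : ∀ n k k', 1 ≤ k → k ≤ k' → k' ≤ n →
      ∀ᵐ ω ∂P, IsMLE h f Θ (Y n ω) k k' (est n ω k k')) :
    (∀ᵐ ω ∂P,
      Tendsto (fun n => changeStat h f Θ q n (u n) (v n) (Y n ω) (est n ω)) atTop atTop) ∧
    ((∀ n, AEMeasurable (fun ω => changeStat h f Θ q n (u n) (v n) (Y n ω) (est n ω)) P) →
      ∀ c : ℝ, Tendsto
        (fun n => P {ω | c < changeStat h f Θ q n (u n) (v n) (Y n ω) (est n ω)})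
        atTop (𝓝 1)) := by
  obtain ⟨δ₁, δ₂, hδ₁, hδ₂, hδ, hlip⟩ := hLip
  have hc : IsContractive f Θ δ₁ δ₂ := ⟨hf, hδ₁, hδ₂, hδ, hlip⟩
  have hA := hA1.1
  have hθ₁ : θ₁ ∈ Θ := interior_subset hY₁.a0
  have hθ₂ : θ₂ ∈ Θ := interior_subset hY₂.a0
  have hm₁ := hsol₁.measurable_pathOf
  have hm₂ := hsol₂.measurable_pathOf
  have hr₁ := hsol₁.isRegime hh hc hθ₁
  have hr₂ := hsol₂.isRegime hh hc hθ₂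
  have he₁ := hr₁.ergodic hh hc hθ₁ (hA _ hθ₁)
  have he₂ := hr₂.ergodic hh hc hθ₂ (hA _ hθ₂)
  have hprob₁ := hr₁.prob
  have hprob₂ := hr₂.prob
  obtain ⟨R₁, hR₁⟩ := hY₁.exists_localBounds hh hA hA5 hm₁ hr₁
  obtain ⟨R₂, hR₂⟩ := hY₂.exists_localBounds hh hA hA5 hm₂ hr₂
  rw [info_eq hh hA hA5 hY₁.a0 hm₁ hr₁] at hinfo
  obtain ⟨c, hc0, r₀, hr₀, hI⟩ := exists_average_info_ge hh hA hA5 hr₁ he₁ hR₁ hinfo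
  have hsep₁ : ∀ r > (0 : ℝ), _ := fun r hr => exists_separation hh hA hA2 hA5 hΘ hr₁ he₁ hθ₁
    (fun θ hθ => hY₁.eq_of_ae_eq hm₁ hr₁ hθ) hR₁ hr
  have hsep₂ : ∀ r > (0 : ℝ), _ := fun r hr => exists_separation hh hA hA2 hA5 hΘ hr₂ he₂ hθ₂
    (fun θ hθ => hY₂.eq_of_ae_eq hm₂ hr₂ hθ) hR₂ hr
  set D := dist θ₁ θ₂ with hD
  have hD0 : 0 < D := dist_pos.2 hne
  obtain ⟨ρ₁, hρ₁, hS₁⟩ := hsep₁ (D / 2) (half_pos hD0)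
  obtain ⟨ρ₂, hρ₂, hS₂⟩ := hsep₂ (D / 2) (half_pos hD0)
  -- A point within 2r of one true parameter then lies inside that regime's separation radius and at
  -- distance at least D / 2 from the other parameter.
  set r := min (min ρ₁ ρ₂) (D / 2) / 2 with hr
  have hr0 : 0 < r := by positivity
  have hrρ₁ : 2 * r ≤ ρ₁ := by
    have := (min_le_left (min ρ₁ ρ₂) (D / 2)).trans (min_le_left _ _)
    linarith
  have hrρ₂ : 2 * r ≤ ρ₂ := by
    have := (min_le_left (min ρ₁ ρ₂) (D / 2)).trans (min_le_right _ _)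
    linarith
  have hrD : 2 * r ≤ D / 2 := by
    have := min_le_right (min ρ₁ ρ₂) (D / 2)
    linarith
  -- Consistency at radius r, used with the true parameter itself as competitor; `hT₀` does the same
  -- at the radius that the information bound needs.
  obtain ⟨σ₁, hσ₁, hT₁⟩ := hsep₁ r hr0
  obtain ⟨σ₂, hσ₂, hT₂⟩ := hsep₂ r hr0
  obtain ⟨σ₀, hσ₀, hT₀⟩ := hsep₁ r₀ hr₀
  obtain ⟨ε₀, hε₀, hqε⟩ := hq.exists_bound
  have hτ0 : 0 < τ := hτ.1
  have hτ1 : 0 < 1 - τ := sub_pos.2 hτ.2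
  -- Small enough for the weight bound near the endpoints, for (0, k₀] to precede the change, and
  -- for (k₁, n] to begin at least εn after it.
  set ε := min ε₀ (min τ (1 - τ)) / 2 with hε
  have hε0 : 0 < ε := by positivity
  have hεε₀ : ε < ε₀ := by
    have := min_le_left ε₀ (min τ (1 - τ))
    linarith
  have hετ : 2 * ε ≤ τ := by
    have := (min_le_right ε₀ (min τ (1 - τ))).trans (min_le_left _ _)
    linarith
  have hετ' : 2 * ε ≤ 1 - τ := by
    have := (min_le_right ε₀ (min τ (1 - τ))).trans (min_le_right _ _)
    linarith
  obtain ⟨Q, hQ⟩ := hqε ε hε0 hεε₀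
  have hQ0 : 0 < Q := (hq.pos ε ⟨hε0, by linarith⟩).trans_le (hQ ε hε0 le_rfl).1
  set s : ℕ → ℕ := fun n => ⌊(n : ℝ) * τ⌋₊ with hs
  set k₀ : ℕ → ℕ := fun n => ⌊ε * n⌋₊ with hk₀
  set k₁ : ℕ → ℕ := fun n => n - k₀ n with hk₁
  have hk₀le : ∀ n, (k₀ n : ℝ) ≤ ε * n := fun n => Nat.floor_le (by positivity)
  have hsle : ∀ n, (s n : ℝ) ≤ n * τ := fun n => Nat.floor_le (by positivity)
  have hk₀n : ∀ n, 2 * k₀ n ≤ n := fun n => by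
    have h1 : ((2 * k₀ n : ℕ) : ℝ) ≤ n := by
      push_cast
      have := hk₀le n
      have hn : (0 : ℝ) ≤ n := Nat.cast_nonneg n
      nlinarith [hτ.2]
    exact_mod_cast h1
  have hk₁cast : ∀ n, (k₁ n : ℝ) = n - k₀ n := fun n => by
    rw [hk₁, Nat.cast_sub (by have := hk₀n n; omega)]
  have hk₀s : ∀ n, k₀ n ≤ s n := fun n => Nat.floor_mono (by
    have hn : (0 : ℝ) ≤ n := Nat.cast_nonneg n
    nlinarith)
  have hsn : ∀ n, s n ≤ n := fun n => by
    have h1 : (s n : ℝ) ≤ n := (hsle n).trans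
      (mul_le_of_le_one_right (Nat.cast_nonneg n) hτ.2.le)
    exact_mod_cast h1
  have hsk₁ : ∀ n : ℕ, (s n : ℝ) + ε * n ≤ k₁ n := fun n => by
    have h1 := hsle n
    have h2 := hk₀le n
    have hn : (0 : ℝ) ≤ n := Nat.cast_nonneg n
    rw [hk₁cast]
    nlinarith
  have hεn : Tendsto (fun n : ℕ => ε * n) atTop atTop :=
    tendsto_natCast_atTop_atTop.const_mul_atTop hε0
  have hk₀tend : Tendsto k₀ atTop atTop := tendsto_nat_floor_atTop.comp hεn
  have hk₀ge : ∀ᶠ n in atTop, ε / 2 * n ≤ k₀ n := by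
    filter_upwards [hεn.eventually_ge_atTop 2] with n hn
    have := Nat.lt_floor_add_one (ε * n)
    simp only [hk₀]
    linarith
  have hfloor : ∀ (w : ℕ → ℕ) (x : ℝ), 0 < x →
      Tendsto (fun n : ℕ => (w n : ℝ) / n) atTop (𝓝 0) → ∀ᶠ n : ℕ in atTop, w n ≤ ⌊x * n⌋₊ := by
    intro w x hx hw
    filter_upwards [hw.eventually (gt_mem_nhds hx), eventually_gt_atTop 0] with n hn hn0
    exact Nat.le_floor ((div_lt_iff₀ (by exact_mod_cast hn0)).1 hn).le
  have hus : ∀ᶠ n in atTop, u n ≤ s n := by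
    filter_upwards [hfloor u τ hτ0 hun] with n hn
    rwa [mul_comm] at hn
  have hvk : ∀ᶠ n in atTop, v n ≤ k₀ n := hfloor v ε hε0 hvn
  have hw₀ := isWindow_zero hu
  have hw₁ := isWindow_zero hk₀tend
  -- The window has length k₀ n, eventually at least εn / 2.
  have hw₂ : IsWindow k₁ (fun n => n) (2 / ε) := by
    refine ⟨fun n => Nat.sub_le _ _, hk₀tend.congr fun n => ?_, ?_⟩
    · have := hk₀n n
      simp only [hk₁]
      omega
    · filter_upwards [hk₀ge] with n hn
      rw [hk₁cast, sub_sub_cancel, div_mul_eq_mul_div, le_div_iff₀ hε0]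
      linarith
  have hest' : ∀ᵐ ω ∂P, ∀ n k k', 1 ≤ k → k ≤ k' → k' ≤ n →
      IsMLE h f Θ (Y n ω) k k' (est n ω k k') :=
    ae_all_iff.2 fun n => ae_all_iff.2 fun k => ae_all_iff.2 fun k' => ae_all_iff.2 fun h1 =>
      ae_all_iff.2 fun h2 => ae_all_iff.2 fun h3 => hest n k k' h1 h2 h3
  have hmain : ∀ᵐ ω ∂P, Tendsto
      (fun n => changeStat h f Θ q n (u n) (v n) (Y n ω) (est n ω)) atTop atTop := by
    filter_upwards [ae_of_ae_map hm₁.aemeasurable hS₁, ae_of_ae_map hm₂.aemeasurable hS₂,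
      ae_of_ae_map hm₁.aemeasurable hT₁, ae_of_ae_map hm₂.aemeasurable hT₂,
      ae_of_ae_map hm₁.aemeasurable hT₀, ae_of_ae_map hm₁.aemeasurable hI,
      ae_of_ae_map hm₁.aemeasurable hr₁.ae_good, ae_of_ae_map hm₂.aemeasurable hr₂.ae_good,
      ae_of_ae_map hm₁.aemeasurable (ae_abs_iterate_le he₁ hr₁.integrable),
      ae_of_ae_map hm₂.aemeasurable (ae_abs_iterate_le he₂ hr₂.integrable), hest']
      with ω hS₁ hS₂ hT₁ hT₂ hT₀ hI hg₁ hg₂ hb₁ hb₂ hE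
    set y₁ := pathOf Y₁ ω with hy₁
    set y₂ := pathOf Y₂ ω with hy₂
    have hYn : ∀ n, Y n ω = concat (s n) y₁ y₂ := fun n => by
      rw [hY, hs, Int.natCast_floor_eq_floor (by positivity)]
      rfl
    have hgood : ∀ n t : ℕ, shift^[t] (concat (s n) y₁ y₂) ∈ goodPaths h := fun n t =>
      concat_mem_goodPaths hg₁ hg₂ t
    simp only [hYn] at hE ⊢
    obtain ⟨K₁, hK₁⟩ := hb₁ 1 one_pos
    obtain ⟨K₂, hK₂⟩ := hb₂ 1 one_pos
    have hgrow₁ : ∀ t : ℕ, (y₁ t : ℝ) ≤ t + max K₁ K₂ := fun t => by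
      have h1 := (le_abs_self _).trans (hK₁ t)
      rw [iterate_shift_zero, mul_one] at h1
      exact h1.trans (by gcongr; exact le_max_left _ _)
    have hgrow₂ : ∀ t : ℕ, (y₂ t : ℝ) ≤ t + max K₁ K₂ := fun t => by
      have h1 := (le_abs_self _).trans (hK₂ t)
      rw [iterate_shift_zero, mul_one] at h1
      exact h1.trans (by gcongr; exact le_max_right _ _)
    have hzero : ∀ b : ℕ → ℕ,
        ∃ γ > (0 : ℝ), Tendsto (fun n => (0 : ℝ) * Real.exp (γ * b n)) atTop (𝓝 0) := fun b =>
      ⟨1, one_pos, by simp⟩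
    have hsh₀ := isShadow_concat_left (f := f) (Θ := Θ) hg₁ hg₂ (a := fun _ => 0) hus
    have hsh₁ := isShadow_concat_left (f := f) (Θ := Θ) hg₁ hg₂ (a := fun _ => 0)
      (Eventually.of_forall hk₀s)
    obtain ⟨δ', hsh₂, hδ'⟩ :=
      isShadow_concat_right hh hA hc hg₁ hg₂ hgrow₁ hgrow₂ hε0 hsn hsk₁
    have hconst : 0 < 1 / Q ^ 2 * (ε / 4) ^ 2 * (c / 2 * r ^ 2) := by positivity
    refine tendsto_atTop_mono' _ ?_ (tendsto_natCast_atTop_atTop.const_mul_atTop hconst)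
    filter_upwards [hS₁ _ _ _ _ _ hw₁ hsh₁ (hzero _), hS₂ _ _ _ _ _ hw₂ hsh₂ hδ',
      hT₁ _ _ _ _ _ hw₁ hsh₁ (hzero _), hT₂ _ _ _ _ _ hw₂ hsh₂ hδ',
      hT₀ _ _ _ _ _ hw₀ hsh₀ (hzero _), hI u hu, eventually_gt_atTop 0,
      hk₀tend.eventually_ge_atTop 1, hu.eventually_ge_atTop 1, hus, hvk, hk₀ge]
      with n hS₁ hS₂ hT₁ hT₂ hT₀ hI hn hk₀1 hu1 hus hvk hk₀ge
    have hn' : (0 : ℝ) < n := by exact_mod_cast hn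
    have hk₀n := hk₀n n
    have hk₁n : k₁ n + k₀ n = n := by simp only [hk₁]; omega
    have hsn' : s n < n := by
      have h1 : (s n : ℝ) < n := (hsle n).trans_lt (mul_lt_of_lt_one_right hn' hτ.2)
      exact_mod_cast h1
    have hEu := hE n 1 (u n) le_rfl hu1 (by omega)
    have hEu' := hE n (u n + 1) n (by omega) (by omega) le_rfl
    have hE₀ := hE n 1 (k₀ n) le_rfl hk₀1 (by omega)
    have hE₀' := hE n (k₀ n + 1) n (by omega) (by omega) le_rfl
    have hE₁ := hE n 1 (k₁ n) le_rfl (by omega) (by omega)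
    have hE₁' := hE n (k₁ n + 1) n (by omega) (by omega) le_rfl
    -- An estimate far from the true parameter would have a strictly larger total loss than that
    -- parameter, against its minimality.
    have hcons₀ : dist (est n ω 1 (u n)) θ₁ < r₀ := by
      by_contra! hcon
      exact (hT₀ θ₁ hθ₁ _ hEu.1 (by simpa using hσ₀.le) hcon).not_ge
        (IsMLE.sum_loss_le (k := 0) (hgood n) hEu hθ₁)
    have hcons₁ : dist (est n ω 1 (k₀ n)) θ₁ < r := by
      by_contra! hcon
      exact (hT₁ θ₁ hθ₁ _ hE₀.1 (by simpa using hσ₁.le) hcon).not_ge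
        (IsMLE.sum_loss_le (k := 0) (hgood n) hE₀ hθ₁)
    have hcons₂ : dist (est n ω (k₁ n + 1) n) θ₂ < r := by
      by_contra! hcon
      exact (hT₂ θ₂ hθ₂ _ hE₁'.1 (by simpa using hσ₂.le) hcon).not_ge
        (hE₁'.sum_loss_le (hgood n) hθ₂)
    have hquad : ∀ x : Param d, c / 2 * ‖x‖ ^ 2 ≤ (fun i => x i) ⬝ᵥ
        (infoHat h f Θ n (u n) (concat (s n) y₁ y₂) (est n ω)).mulVec fun i => x i := by
      intro x
      have h1 : (u n : ℝ) * (c * ‖x‖ ^ 2) ≤ ∑ t ∈ Finset.Icc 1 (u n), ((fun i => x i) ⬝ᵥ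
          (infoTerm h f Θ (concat (s n) y₁ y₂) t (est n ω 1 (u n))).mulVec fun i => x i) := by
        refine (hI _ hcons₀ x).trans (le_of_eq (Finset.sum_congr rfl fun t ht => ?_))
        rw [infoTerm_concat ((Finset.mem_Icc.1 ht).2.trans hus)]
      have h2 := quadForm_infoHat_ge hh hA (hgood n) (by omega) (by omega) hEu'.1 x h1
      linarith
    have hk₀R : (k₀ n : ℝ) / n ≤ ε := (div_le_iff₀ hn').2 (hk₀le n)
    have hk₀R' : 0 < (k₀ n : ℝ) / n := div_pos (by exact_mod_cast hk₀1) hn'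
    have hk₁R : (k₁ n : ℝ) / n = 1 - k₀ n / n := by
      rw [hk₁cast, sub_div, div_self hn'.ne']
    have hprod : ε / 4 * (n : ℝ) ^ 2 ≤ k₀ n * ((n : ℝ) - k₀ n) := by
      have h1 : (n : ℝ) / 2 ≤ n - k₀ n := by
        have : ((2 * k₀ n : ℕ) : ℝ) ≤ n := by exact_mod_cast hk₀n
        push_cast at this
        linarith
      calc ε / 4 * (n : ℝ) ^ 2 = ε / 2 * n * (n / 2) := by ring
        _ ≤ k₀ n * ((n : ℝ) - k₀ n) := by gcongr
    -- A gap of size r at k₀ or at k₁ already makes the statistic of order n; the remaining case is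
    -- impossible.
    by_cases hd₀ : r ≤ dist (est n ω 1 (k₀ n)) (est n ω (k₀ n + 1) n)
    · refine le_trans ?_ (statAt_le_changeStat hvk (by omega))
      exact le_statAt hn (by positivity) (by positivity) hr0.le hprod
        (hq.pos _ ⟨hk₀R', by linarith⟩) (hQ _ hk₀R' hk₀R).1 hd₀ hquad
    by_cases hd₁ : r ≤ dist (est n ω 1 (k₁ n)) (est n ω (k₁ n + 1) n)
    · refine le_trans ?_ (statAt_le_changeStat (k := k₁ n) (by omega) (by omega))
      refine le_statAt hn (by positivity) (by positivity) hr0.le ?_ ?_ ?_ hd₁ hquad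
      · rw [hk₁cast]
        linarith
      · rw [hk₁R]
        exact hq.pos _ ⟨by linarith, by linarith⟩
      · rw [hk₁R]
        exact (hQ _ hk₀R' hk₀R).2
    -- With both gaps small, `a` is within 2r of θ₁ and `b` within 2r of θ₂. Minimality of both,
    -- with the mixed segment cancelled, contradicts separation on the two extreme windows.
    exfalso
    push Not at hd₀ hd₁
    set a := est n ω (k₀ n + 1) n with ha
    set b := est n ω 1 (k₁ n) with hb
    have haθ₁ : dist a θ₁ < 2 * r := by
      have := dist_triangle_left a θ₁ (est n ω 1 (k₀ n))
      linarith
    have hbθ₂ : dist b θ₂ < 2 * r := by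
      have := dist_triangle b (est n ω (k₁ n + 1) n) θ₂
      linarith
    have haθ₂ : D / 2 ≤ dist a θ₂ := by
      have := dist_triangle_left θ₁ θ₂ a
      linarith
    have hbθ₁ : D / 2 ≤ dist b θ₁ := by
      have := dist_triangle_left θ₁ θ₂ b
      linarith
    have h1 := hS₁ a hE₀'.1 b hE₁.1 (by linarith) hbθ₁
    have h2 := hS₂ b hE₁.1 a hE₀'.1 (by linarith) haθ₂
    have h3 := sum_loss_exchange (hgood n) (by omega) (by omega) hE₀' hE₁
    linarith
  exact ⟨hmain, fun hmeas c => tendsto_measure_lt_of_ae_tendsto_atTop hmeas hmain c⟩
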